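/- Identify the plane with $\mathbb C$ and put $\omega=e^{i\pi/5}$. **Penrose tilings.** The thin rhomb $ABCD$ has $A=0,\ B=1,\ C=1+\omega,\ D=\omega$; the thick rhomb $EFGH$ has $E=0,\ F=1,\ G=1+\omega^2,\ H=\omega^2$. Their sides carry arrows: single arrows $A\to B$, $C\to B$, $E\to F$, $E\to H$ and double arrows $A\to D$, $C\to D$, $F\to G$, $H\to G$. A Penrose tiling $\mathcal P$ is a set of images of these two marked rhombs under orientation preserving isometries that cover the plane, have pairwise disjoint interiors, and are such that sides of different rhombs with more than one common point coincide, together with kind and direction of their arrows. (The markings are mirror symmetric, so allowing reflections would give the same tilings.) **Recomposition.** Let $Q$ be a point in the interior of the thin rhomb with $|QA|<|QC|$. In every thin rhomb draw the segments $QA,QB,QD$. In every thick rhomb let $R$ be the image of $Q$ under the orientation preserving isometry with $A\mapsto E,\ B\mapsto F$, let $S$ be its image under the one with $D\mapsto G,\ A\mapsto H$, and draw the segments $RE,RF,SG,SH,RS$. Erase the sides of the rhombs. The Ammann tiling $\mathcal T$ consists of the closures of the connected components of the complement of the union of all drawn segments. A tile of $\mathcal T$ is of type $A$ if it contains the quadrilateral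 $HERS$ of some thick rhomb of $\mathcal P$. The corona of a tile $T$ is the set of all $T'\in\mathcal T$ such that $T\cap T'$ contains at least two points. **Prototiles.** With $R=Q$ and $S=\omega^2+\omega^{-1}Q$, let $\mathsf A$ be the pentagon with consecutive vertices $\omega^2Q,\ \omega^2,\ S,\ R,\ 0$; let $\mathsf B$ be the hexagon with consecutive vertices $1+\omega,\ 1+\omega-\omega Q,\ 1,\ Q,\ \omega,\ 1+\omega-\omega^{-1}Q$; let $\mathsf C$ be the pentagon with consecutive vertices $1+\omega^2,\ 1+\omega Q,\ 1,\ R,\ S$. Write $X[p,k]=p+\omega^kX$. Let 1. $K_1=\{\mathsf A,\ \mathsf C,\ \mathsf C[\omega^6,1],\ \mathsf C[\omega^2+\omega^3,8],\ \mathsf B[0,2],\ \mathsf B[1+\omega^9,4]\}$, 2. $K_2=\{\mathsf A,\ \mathsf C,\ \mathsf C[\omega^2+\omega^3,8],\ \mathsf B[0,2],\ \mathsf B[1+\omega^9,4],\ \mathsf B[\omega^3+\omega^4,8]\}$, 3. $K_3=\{\mathsf A,\ \mathsf C,\ \mathsf A[0,8],\ \mathsf C[\omega^2+\omega^3,8],\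 \mathsf B[0,2],\ \mathsf B[\omega^3+\omega^4,8]\}$, 4. $K_4=\{\mathsf A,\ \mathsf C,\ \mathsf A[0,2],\ \mathsf C[0,2],\ \mathsf B[1+\omega^9,4],\ \mathsf B[1+\omega+\omega^2,5]\}$, 5. $K_5=\{\mathsf A,\ \mathsf C,\ \mathsf A[0,2],\ \mathsf C[0,2],\ \mathsf A[0,8],\ \mathsf B[1+\omega+\omega^2,5]\}$. **Theorem.** Let $\mathcal T$ be the Ammann tiling constructed from a Penrose tiling $\mathcal P$ and a point $Q$ as above. Then $K_1,\dots,K_5$ are the only possible coronas of an $A$ tile, and all of them occur: for every tile $T$ of type $A$ of $\mathcal T$ there are $k\in\{1,\dots,5\}$ and an orientation preserving isometry $g$ of the plane such that $T=g(\mathsf A)$ and the corona of $T$ is $\{g(X):X\in K_k\}$; and conversely for every $k\in\{1,\dots,5\}$ there are a tile $T$ of type $A$ of $\mathcal T$ and a $g$ with these properties. -/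

import Mathlib

/-! The Euclidean plane is `ℂ`. -/

/-- The rotation by `π / 5`, as a complex number. -/
noncomputable def omega : ℂ := Complex.exp ((Real.pi / 5 : ℝ) * Complex.I)

/-- An orientation preserving isometry of the plane: `z ↦ pos + dir * z` with `|dir| = 1`. -/
structure Placement where
  pos : ℂ
  dir : Circle

/-- The map of the plane given by a placement. -/
noncomputable def Placement.map (g : Placement) (z : ℂ) : ℂ := g.pos + (g.dir : ℂ) * z

/-! ### Marked Penrose rhombs and Penrose tilings -/

/-- The two Penrose rhombs, with sides of length one: thin (angles `π/5`, `4π/5`) and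
thick (angles `2π/5`, `3π/5`). -/
inductive RhombKind where
  | thin
  | thick

/-- The corners of the reference rhomb in counterclockwise order. For the thin rhomb they are
called `A, B, C, D` (with acute angles at `A` and `C`), for the thick rhomb `E, F, G, H`
(with acute angles at `E` and `G`). -/
noncomputable def RhombKind.refCorner : RhombKind → Fin 4 → ℂ
  | .thin => ![0, 1, 1 + omega, omega]
  | .thick => ![0, 1, 1 + omega ^ 2, omega ^ 2]

/-- A marked rhomb in the plane: the image of a reference rhomb under an orientation preserving
isometry. The marking of the thin rhomb (below) is symmetric about its short diagonal and that of
the thick rhomb about its long diagonal, and neither has another symmetry. Hence mirror images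
of the reference rhombs give no new marked rhombs, and every marked rhomb has exactly one
placement. -/
structure Rhomb where
  kind : RhombKind
  place : Placement

/-- The corners of a rhomb: `A, B, C, D` or `E, F, G, H`, numbered `0, 1, 2, 3`. -/
noncomputable def Rhomb.corner (r : Rhomb) (i : Fin 4) : ℂ := r.place.map (r.kind.refCorner i)

/-- The region covered by a rhomb. -/
noncomputable def Rhomb.carrier (r : Rhomb) : Set ℂ := convexHull ℝ (Set.range r.corner)

/-- The two kinds of edge marks (arrows) of the Penrose rhombs. -/
inductive ArrowKind where
  | single
  | double

/-- A side of a rhomb together with its mark, an arrow of one of two kinds from `tail`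
to `head`. -/
structure MarkedEdge where
  arrow : ArrowKind
  tail : ℂ
  head : ℂ

/-- The segment underlying a marked edge. -/
def MarkedEdge.carrier (e : MarkedEdge) : Set ℂ := segment ℝ e.tail e.head

/-- The four marked edges of a rhomb. Thin rhomb: single arrows `A → B`, `C → B`, double arrows
`A → D`, `C → D`. Thick rhomb: single arrows `E → F`, `E → H`, double arrows
`F → G`, `H → G`. -/
def Rhomb.edges (r : Rhomb) : Set MarkedEdge :=
  match r.kind with
  | .thin =>
    {⟨.single, r.corner 0, r.corner 1⟩, ⟨.single, r.corner 2, r.corner 1⟩,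
      ⟨.double, r.corner 0, r.corner 3⟩, ⟨.double, r.corner 2, r.corner 3⟩}
  | .thick =>
    {⟨.single, r.corner 0, r.corner 1⟩, ⟨.single, r.corner 0, r.corner 3⟩,
      ⟨.double, r.corner 1, r.corner 2⟩, ⟨.double, r.corner 3, r.corner 2⟩}

/-- A Penrose tiling by rhombs: a set of marked rhombs that cover the plane, have pairwise
disjoint interiors, and obey the adjacency rule: sides of different rhombs that have more than
one point in common coincide, including their marks. -/
structure IsPenroseTiling (P : Set Rhomb) : Prop where
  cover : ⋃ r ∈ P, r.carrier = Set.univ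
  disjoint : ∀ r ∈ P, ∀ s ∈ P, r ≠ s → Disjoint (interior r.carrier) (interior s.carrier)
  matching : ∀ r ∈ P, ∀ s ∈ P, r ≠ s → ∀ e ∈ r.edges, ∀ f ∈ s.edges,
    (e.carrier ∩ f.carrier).Nontrivial → e = f

/-! ### Recomposition

The parameter `q` is the position of the added point `Q` in the reference thin rhomb
`A = 0`, `B = 1`, `C = 1 + omega`, `D = omega`. -/

/-- The admissible positions of `Q`: inside the thin rhomb, in the half nearer to `A`. (The three
corners nearest to `Q` are then `A`, `B`, `D`.) -/
def IsAdmissible (q : ℂ) : Prop :=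
  q ∈ interior (convexHull ℝ (Set.range RhombKind.thin.refCorner)) ∧
    dist q (RhombKind.thin.refCorner 0) < dist q (RhombKind.thin.refCorner 2)

/-- The position of the point `S` in the reference thick rhomb: the image of `q` under the
orientation preserving isometry that takes `D` to `G` and `A` to `H`. -/
noncomputable def refS (q : ℂ) : ℂ := omega ^ 2 + omega⁻¹ * q

/-- The edges that recomposition draws in a rhomb. Thin: from `Q` to `A`, `B`, `D`. Thick: let `R`
be the image of `Q` under the orientation preserving isometry with `A ↦ E`, `B ↦ F` (in the
reference rhombs this is the identity), and `S` the image under the one with `D ↦ G`, `A ↦ H`;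
the edges are `RE`, `RF`, `SG`, `SH`, `RS`. -/
noncomputable def Rhomb.drawn (q : ℂ) (r : Rhomb) : Set ℂ :=
  match r.kind with
  | .thin =>
    segment ℝ (r.place.map q) (r.corner 0) ∪ segment ℝ (r.place.map q) (r.corner 1) ∪
      segment ℝ (r.place.map q) (r.corner 3)
  | .thick =>
    segment ℝ (r.place.map q) (r.corner 0) ∪ segment ℝ (r.place.map q) (r.corner 1) ∪
      segment ℝ (r.place.map (refS q)) (r.corner 2) ∪
      segment ℝ (r.place.map (refS q)) (r.corner 3) ∪
      segment ℝ (r.place.map q) (r.place.map (refS q))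

/-- All the drawn edges; the edges of the Penrose tiling itself are erased. -/
def skeleton (P : Set Rhomb) (q : ℂ) : Set ℂ := ⋃ r ∈ P, r.drawn q

/-- The Ammann tiling obtained by recomposition: its tiles are the closures of the regions into
which the drawn edges divide the plane. -/
def ammannTiling (P : Set Rhomb) (q : ℂ) : Set (Set ℂ) :=
  {T | ∃ z ∈ (skeleton P q)ᶜ, T = closure (connectedComponentIn (skeleton P q)ᶜ z)}

/-- The first corona of a tile. -/
def corona (𝒯 : Set (Set ℂ)) (T : Set ℂ) : Set (Set ℂ) :=
  {T' ∈ 𝒯 | ∃ x ∈ T ∩ T', ∃ y ∈ T ∩ T', x ≠ y}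

/-- The quadrilateral `HERS` (always convex) into which the drawn edges and the side `HE` cut a
thick rhomb. -/
noncomputable def Rhomb.quadHERS (q : ℂ) (r : Rhomb) : Set ℂ :=
  convexHull ℝ {r.corner 3, r.corner 0, r.place.map q, r.place.map (refS q)}

/-- The tiles of type `A`: those that contain the quadrilateral `HERS` of a thick rhomb. -/
def IsTileA (P : Set Rhomb) (q : ℂ) (T : Set ℂ) : Prop :=
  T ∈ ammannTiling P q ∧ ∃ r ∈ P, r.kind = .thick ∧ r.quadHERS q ⊆ T

/-! ### The prototiles and the five coronas -/

/-- The prototile `A`: the (convex) pentagon with the vertices `H`, `E`, `R`, `S` of the reference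
thick rhomb and the apex of the copy of the triangle `ABQ` erected outside on `EH`
(`A ↦ E`, `B ↦ H`). -/
noncomputable def protoA (q : ℂ) : Set ℂ :=
  convexHull ℝ {omega ^ 2 * q, omega ^ 2, refS q, q, 0}

/-- The prototile `B`: the (convex) hexagon with the vertices `B`, `Q`, `D`, `C` of the reference
thin rhomb and the apices of the copies of the triangle `ABQ` erected outside on `CB`
(`A ↦ C`, `B ↦ B`) and of the triangle `DAQ` erected outside on `DC` (`D ↦ D`, `A ↦ C`). -/
noncomputable def protoB (q : ℂ) : Set ℂ :=
  convexHull ℝ {1 + omega, 1 + omega - omega * q, 1, q, omega, 1 + omega - omega⁻¹ * q}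

/-- The prototile `C`: the pentagon with the vertices `F`, `R`, `S`, `G` of the reference thick
rhomb and the apex of the copy of the triangle `DAQ` erected outside on `GF` (`D ↦ G`, `A ↦ F`).
It may have a reflex angle at `S`, so it is written as the union of the two polygons into which
its diagonal `FS` cuts it. -/
noncomputable def protoC (q : ℂ) : Set ℂ :=
  convexHull ℝ {1 + omega ^ 2, 1 + omega * q, 1, refS q} ∪ convexHull ℝ {1, q, refS q}

/-- A copy of `X`, rotated by `k * (π / 5)` about the origin and then translated by `p`. -/
noncomputable def moved (p : ℂ) (k : ℕ) (X : Set ℂ) : Set ℂ := (fun z => p + omega ^ k * z) '' X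

/-- The five coronas of an `A` tile, drawn around the prototile `A`. -/
noncomputable def coronaOfA (q : ℂ) : Fin 5 → Set (Set ℂ) :=
  ![{protoA q, protoC q, moved (omega ^ 6) 1 (protoC q),
      moved (omega ^ 2 + omega ^ 3) 8 (protoC q),
      moved 0 2 (protoB q), moved (1 + omega ^ 9) 4 (protoB q)},
    {protoA q, protoC q, moved (omega ^ 2 + omega ^ 3) 8 (protoC q),
      moved 0 2 (protoB q), moved (1 + omega ^ 9) 4 (protoB q),
      moved (omega ^ 3 + omega ^ 4) 8 (protoB q)},
    {protoA q, protoC q, moved 0 8 (protoA q), moved (omega ^ 2 + omega ^ 3) 8 (protoC q),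
      moved 0 2 (protoB q), moved (omega ^ 3 + omega ^ 4) 8 (protoB q)},
    {protoA q, protoC q, moved 0 2 (protoA q), moved 0 2 (protoC q),
      moved (1 + omega ^ 9) 4 (protoB q), moved (1 + omega + omega ^ 2) 5 (protoB q)},
    {protoA q, protoC q, moved 0 2 (protoA q), moved 0 2 (protoC q), moved 0 8 (protoA q),
      moved (1 + omega + omega ^ 2) 5 (protoB q)}]

/-- The tile `T` of the tiling `𝒯` together with its corona is congruent, by an orientation
preserving isometry, to the prototile `A` together with the corona number `k` of the list. -/
def HasCorona (q : ℂ) (𝒯 : Set (Set ℂ)) (T : Set ℂ) (k : Fin 5) : Prop :=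
  ∃ g : Placement, T = g.map '' protoA q ∧
    corona 𝒯 T = (fun X => g.map '' X) '' coronaOfA q k

/-!
A thick rhomb of a Penrose tiling is surrounded by other rhombs in only a few ways, and the corona
of its `A` tile can be read off from at most four of them. The proof has a combinatorial and a
geometric half.

*Combinatorics.* Since the rhombs have disjoint interiors and cover the plane locally finitely,
the matching rule forces exactly one rhomb across every side, glued along the same arrow
(`IsPenroseTiling.exists_neighbor`). In the frame of a given rhomb all rhombs that are reached
across sides have corners in `ℤ[omega]` and directions `omega ^ k`, so they are described by
integers (`LatticeRhomb`). Each angle of a rhomb consists of sectors of opening `π / 5`, and two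
rhombs of the tiling that share such a sector at a corner are equal
(`LatticeRhomb.not_mem_of_clash`). Hence a finite case distinction on the kinds of successive
neighbors, in which every impossible case ends with two clashing rhombs, is a proof; `Deduction`
is the type of such case distinctions and `Deduction.check_sound` their correctness. One of them
shows that around every thick rhomb there is one of five patterns
(`IsPenroseTiling.hasPattern_of_thick`). Others show that each pattern occurs in every Penrose
tiling: starting anywhere, a suitable chain of neighbors inevitably leads to it
(`IsPenroseTiling.exists_hasPattern`).

*Geometry.* The points `Q`, `R`, `S` cut each rhomb into triangles, its pieces. The pieces along
the sides marked `A → B`, `E → F` and `A → D`, `H → G` are attached to the rhomb across that side,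
and the pieces collected by a rhomb make up the copies of the prototiles based on it
(`Rhomb.Holds`, `RhombKind.owner`). These copies cover the plane and have disjoint interiors, every
drawn edge separates two of them, and their outlines are drawn; as their interiors are connected,
they are the tiles of the Ammann tiling (`IsPenroseTiling.mem_ammannTiling`). An `A` tile lies,
except for the points `E` and `H`, in the interior of the union of its thick rhomb `r` and the
neighbor `n` across `HE` (`Rhomb.mem_interior_of_mem_tileA`), so that a tile in its corona contains
a piece of `r` or of `n`. This determines the corona in terms of the rhombs around `r` and `n`
(`IsPenroseTiling.corona_eq_of_thin`, `IsPenroseTiling.corona_eq_of_thick`); for the five patterns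
it is the one in the list.
-/

/-! ### The tenth root of unity and the golden ratio -/

/-- The golden ratio, as a constant that `push_cast` and `simp` do not unfold. -/
noncomputable def gold : ℝ := Real.goldenRatio

local notation "φ" => gold

lemma gold_sq : φ ^ 2 = φ + 1 := Real.goldenRatio_sq

/-- The imaginary part of `omega`. -/
noncomputable def sinFifth : ℝ := Real.sin (Real.pi / 5)

lemma sinFifth_pos : 0 < sinFifth :=
  Real.sin_pos_of_pos_of_lt_pi (by positivity) (by linarith [Real.pi_pos])

lemma omega_re : omega.re = φ / 2 := by
  rw [omega, Complex.exp_ofReal_mul_I_re, Real.cos_pi_div_five, gold, Real.goldenRatio]; ring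

lemma omega_im : omega.im = sinFifth := by
  rw [omega, Complex.exp_ofReal_mul_I_im, sinFifth]

lemma sinFifth_sq : sinFifth ^ 2 = 1 - φ ^ 2 / 4 := by
  have h := Real.sin_sq_add_cos_sq (Real.pi / 5)
  rw [Real.cos_pi_div_five] at h
  rw [sinFifth, gold, Real.goldenRatio]
  linear_combination h

lemma omega_sq : omega ^ 2 = (φ : ℂ) * omega - 1 := by
  have h1 := gold_sq
  have h2 := sinFifth_sq
  apply Complex.ext
  · simp [pow_two, omega_re, omega_im]; linear_combination -h2
  · simp [pow_two, omega_re, omega_im]; ring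

lemma phi_sq_complex : (φ : ℂ) ^ 2 = φ + 1 := by
  exact_mod_cast gold_sq

lemma omega_pow_three : omega ^ 3 = (φ : ℂ) * omega - φ := by
  linear_combination (omega + φ) * omega_sq + omega * phi_sq_complex

lemma omega_pow_four : omega ^ 4 = omega - φ := by
  linear_combination omega * omega_pow_three + (φ : ℂ) * omega_sq + (omega) * phi_sq_complex

lemma omega_pow_five : omega ^ 5 = -1 := by
  linear_combination omega * omega_pow_four + omega_sq

lemma omega_ne_zero : omega ≠ 0 := Complex.exp_ne_zero _

lemma omega_inv : omega⁻¹ = (φ : ℂ) - omega := by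
  rw [inv_eq_iff_eq_inv, eq_comm, inv_eq_iff_eq_inv]
  symm
  apply inv_eq_of_mul_eq_one_right
  linear_combination -omega_sq

lemma phi_gt : 8 / 5 < φ := by
  rw [gold, Real.goldenRatio]
  have : (11 / 5 : ℝ) < √5 := Real.lt_sqrt_of_sq_lt (by norm_num)
  linarith

lemma phi_lt : φ < 17 / 10 := by
  rw [gold, Real.goldenRatio]
  have : √5 < (12 / 5 : ℝ) := (Real.sqrt_lt' (by norm_num)).2 (by norm_num)
  linarith

/-! ### Triangles -/

/-- The cross product of `v - u` and `z - u`: positive iff `z` lies to the left of the line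
directed from `u` to `v`. -/
def cross (u v z : ℂ) : ℝ := (v.re - u.re) * (z.im - u.im) - (v.im - u.im) * (z.re - u.re)

/-- The closed triangle with the given corners. -/
def triangle (u v w : ℂ) : Set ℂ := convexHull ℝ {u, v, w}

lemma continuous_cross (u v : ℂ) : Continuous (cross u v) := by
  unfold cross; fun_prop

lemma cross_rotate (u v w : ℂ) : cross v w u = cross u v w := by unfold cross; ring

lemma cross_swap (u v w : ℂ) : cross v u w = -cross u v w := by unfold cross; ring

lemma cross_self_left (u v : ℂ) : cross u v u = 0 := by unfold cross; ring

lemma cross_self_right (u v : ℂ) : cross u v v = 0 := by unfold cross; ring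

lemma cross_combo (u v x y : ℂ) (a b : ℝ) (h : a + b = 1) :
    cross u v (a • x + b • y) = a * cross u v x + b * cross u v y := by
  obtain rfl : b = 1 - a := by linarith
  simp [cross]; ring

lemma convex_cross_nonneg (u v : ℂ) : Convex ℝ {z | 0 ≤ cross u v z} := by
  intro x hx y hy a b ha hb h
  simp only [Set.mem_ofPred_eq] at *
  rw [cross_combo _ _ _ _ _ _ h]
  positivity

lemma cross_nonneg_of_mem_hull {u v z : ℂ} {s : Set ℂ} (h : ∀ x ∈ s, 0 ≤ cross u v x)
    (hz : z ∈ convexHull ℝ s) : 0 ≤ cross u v z :=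
  convexHull_min (t := {z | 0 ≤ cross u v z}) h (convex_cross_nonneg u v) hz

lemma mem_triangle_of_cross {u v w z : ℂ} (h : 0 < cross u v w) (h1 : 0 ≤ cross u v z)
    (h2 : 0 ≤ cross v w z) (h3 : 0 ≤ cross w u z) : z ∈ triangle u v w := by
  have hs : cross u v z + cross v w z + cross w u z = cross u v w := by unfold cross; ring
  have key : (cross u v w) • z = cross v w z • u + cross w u z • v + cross u v z • w := by
    apply Complex.ext <;> simp [cross] <;> ring
  have key2 : z = (cross v w z / cross u v w) • u + (cross w u z / cross u v w) • v
      + (cross u v z / cross u v w) • w := by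
    have e : z = (cross u v w)⁻¹ • ((cross u v w) • z) := by
      rw [smul_smul, inv_mul_cancel₀ h.ne', one_smul]
    rw [key, smul_add, smul_add, smul_smul, smul_smul, smul_smul] at e
    simpa only [div_eq_inv_mul] using e
  have := (convex_convexHull ℝ ({u, v, w} : Set ℂ)).sum_mem (t := Finset.univ)
    (w := ![cross v w z / cross u v w, cross w u z / cross u v w, cross u v z / cross u v w])
    (z := ![u, v, w]) (by intro i _; fin_cases i <;> simp <;> positivity)
    (by simp [Fin.sum_univ_three]; field_simp; linarith)
    (by intro i _; fin_cases i <;> exact subset_convexHull ℝ _ (by simp))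
  rw [triangle, key2]
  simpa [Fin.sum_univ_three] using this

lemma mem_triangle_iff {u v w z : ℂ} (h : 0 < cross u v w) :
    z ∈ triangle u v w ↔ 0 ≤ cross u v z ∧ 0 ≤ cross v w z ∧ 0 ≤ cross w u z := by
  refine ⟨fun hz => ⟨?_, ?_, ?_⟩, fun ⟨h1, h2, h3⟩ => mem_triangle_of_cross h h1 h2 h3⟩
  · refine cross_nonneg_of_mem_hull ?_ hz
    rintro x (rfl | rfl | rfl) <;> simp [cross_self_left, cross_self_right, h.le]
  · have : 0 ≤ cross v w u := by rw [cross_rotate]; exact h.le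
    refine cross_nonneg_of_mem_hull ?_ hz
    rintro x (rfl | rfl | rfl) <;> simp [cross_self_left, cross_self_right, this]
  · have : 0 ≤ cross w u v := by rw [cross_rotate, cross_rotate]; exact h.le
    refine cross_nonneg_of_mem_hull ?_ hz
    rintro x (rfl | rfl | rfl) <;> simp [cross_self_left, cross_self_right, this]

lemma mem_interior_triangle {u v w z : ℂ} (h : 0 < cross u v w) (h1 : 0 < cross u v z)
    (h2 : 0 < cross v w z) (h3 : 0 < cross w u z) : z ∈ interior (triangle u v w) := by
  rw [mem_interior]
  refine ⟨{z | 0 < cross u v z} ∩ {z | 0 < cross v w z} ∩ {z | 0 < cross w u z}, ?_, ?_,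
    ⟨⟨h1, h2⟩, h3⟩⟩
  · rintro x ⟨⟨hx1, hx2⟩, hx3⟩
    exact mem_triangle_of_cross h (le_of_lt hx1) (le_of_lt hx2) (le_of_lt hx3)
  · exact ((isOpen_lt continuous_const (continuous_cross u v)).inter
      (isOpen_lt continuous_const (continuous_cross v w))).inter
      (isOpen_lt continuous_const (continuous_cross w u))

lemma mem_segment_of_mem_triangle {u v w z : ℂ} (h : 0 < cross u v w)
    (hz : z ∈ triangle u v w) (h0 : cross u v z = 0) : z ∈ segment ℝ u v := by
  obtain ⟨h1, h2, h3⟩ := (mem_triangle_iff h).1 hz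
  have hs : cross u v z + cross v w z + cross w u z = cross u v w := by unfold cross; ring
  refine ⟨cross v w z / cross u v w, cross w u z / cross u v w, by positivity, by positivity,
    by field_simp; linarith, ?_⟩
  have key : (cross u v w) • z = cross v w z • u + cross w u z • v + cross u v z • w := by
    apply Complex.ext <;> simp [cross] <;> ring
  rw [h0, zero_smul, add_zero] at key
  have : z = (cross u v w)⁻¹ • ((cross u v w) • z) := by
    rw [smul_smul, inv_mul_cancel₀ h.ne', one_smul]
  conv_rhs => rw [this]
  rw [key, smul_add, smul_smul, smul_smul]
  simp only [div_eq_inv_mul]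

lemma triangle_rotate (u v w : ℂ) : triangle v w u = triangle u v w := by
  unfold triangle; congr 1; ext x; simp; tauto

lemma triangle_subset_interior_union {u v w z : ℂ} (h : 0 < cross u v w)
    (hz : z ∈ triangle u v w) : z ∈ interior (triangle u v w) ∨ z ∈ segment ℝ u v ∨
      z ∈ segment ℝ v w ∨ z ∈ segment ℝ w u := by
  obtain ⟨h1, h2, h3⟩ := (mem_triangle_iff h).1 hz
  rcases h1.eq_or_lt with e1 | e1
  · exact .inr (.inl (mem_segment_of_mem_triangle h hz e1.symm))
  rcases h2.eq_or_lt with e2 | e2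
  · refine .inr (.inr (.inl (mem_segment_of_mem_triangle (w := u) ?_ ?_ e2.symm)))
    · rwa [cross_rotate]
    · rwa [triangle_rotate]
  rcases h3.eq_or_lt with e3 | e3
  · refine .inr (.inr (.inr (mem_segment_of_mem_triangle (w := v) ?_ ?_ e3.symm)))
    · rwa [cross_rotate, cross_rotate]
    · rwa [triangle_rotate, triangle_rotate]
  exact .inl (mem_interior_triangle h e1 e2 e3)

/-- Two triangles on opposite sides of a common edge: the open edge lies in the interior of
their union. -/
lemma openSegment_subset_interior_union {u v w w' : ℂ} (h : 0 < cross u v w)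
    (h' : 0 < cross v u w') :
    openSegment ℝ u v ⊆ interior (triangle u v w ∪ triangle v u w') := by
  rintro z ⟨a, b, ha, hb, hab, rfl⟩
  rw [mem_interior]
  refine ⟨({z | 0 < cross v w z} ∩ {z | 0 < cross w u z}) ∩
    ({z | 0 < cross u w' z} ∩ {z | 0 < cross w' v z}), ?_, ?_, ⟨⟨?_, ?_⟩, ⟨?_, ?_⟩⟩⟩
  · rintro x ⟨⟨hx1, hx2⟩, hx3, hx4⟩
    rcases le_total 0 (cross u v x) with h0 | h0
    · exact .inl (mem_triangle_of_cross h h0 (le_of_lt hx1) (le_of_lt hx2))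
    · refine .inr (mem_triangle_of_cross h' ?_ (le_of_lt hx3) (le_of_lt hx4))
      rw [cross_swap]; linarith
  · exact ((isOpen_lt continuous_const (continuous_cross _ _)).inter
      (isOpen_lt continuous_const (continuous_cross _ _))).inter
      ((isOpen_lt continuous_const (continuous_cross _ _)).inter
      (isOpen_lt continuous_const (continuous_cross _ _)))
  all_goals simp only [Set.mem_ofPred_eq]; rw [cross_combo _ _ _ _ _ _ hab]
  · rw [cross_self_left, cross_rotate]; simpa using by positivity
  · rw [cross_self_right, cross_rotate, cross_rotate] ; simpa using by positivity
  · rw [cross_self_left, cross_rotate]; simpa using by positivity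
  · rw [cross_self_right, cross_rotate, cross_rotate]; simpa using by positivity

lemma cross_pos_of_mem_interior {u v z : ℂ} {s : Set ℂ} (huv : u ≠ v)
    (hs : ∀ x ∈ s, 0 ≤ cross u v x) (hz : z ∈ interior s) : 0 < cross u v z := by
  refine lt_of_le_of_ne (hs z (interior_subset hz)) fun h0 => ?_
  have hc : Continuous fun t : ℝ => z - t • (Complex.I * (v - u)) := by fun_prop
  have hev : ∀ᶠ t : ℝ in nhds 0, z - t • (Complex.I * (v - u)) ∈ interior s :=
    hc.continuousAt.eventually_mem (by simpa using isOpen_interior.mem_nhds hz)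
  obtain ⟨t, ht, ht0⟩ := ((hev.filter_mono nhdsWithin_le_nhds).and
    (self_mem_nhdsWithin (a := (0 : ℝ)) (s := Set.Ioi 0))).exists
  have h1 := hs _ (interior_subset ht)
  have h2 : cross u v (z - t • (Complex.I * (v - u))) =
      cross u v z - t * ((v.re - u.re) ^ 2 + (v.im - u.im) ^ 2) := by
    simp [cross]; ring
  have h3 : 0 < (v.re - u.re) ^ 2 + (v.im - u.im) ^ 2 := by
    by_contra hn
    apply huv
    have e1 : v.re - u.re = 0 := by nlinarith [sq_nonneg (v.re - u.re), sq_nonneg (v.im - u.im)]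
    have e2 : v.im - u.im = 0 := by nlinarith [sq_nonneg (v.re - u.re), sq_nonneg (v.im - u.im)]
    apply Complex.ext <;> linarith
  have : 0 < t := ht0
  have := mul_pos this h3
  linarith

lemma disjoint_interior_of_cross {u v : ℂ} {s t : Set ℂ} (huv : u ≠ v)
    (hs : ∀ x ∈ s, 0 ≤ cross u v x) (ht : ∀ x ∈ t, cross u v x ≤ 0) :
    Disjoint (interior s) (interior t) := by
  rw [Set.disjoint_left]
  intro z hz hz'
  have h1 := cross_pos_of_mem_interior huv hs hz
  have h2 := cross_pos_of_mem_interior (u := v) (v := u) huv.symm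
    (fun x hx => by rw [cross_swap]; linarith [ht x hx]) hz'
  rw [cross_swap] at h2
  linarith

lemma convex_triangle (u v w : ℂ) : Convex ℝ (triangle u v w) := convex_convexHull _ _

lemma isCompact_triangle (u v w : ℂ) : IsCompact (triangle u v w) :=
  (Set.toFinite _).isCompact_convexHull (𝕜 := ℝ)

lemma interior_triangle_nonempty {u v w : ℂ} (h : 0 < cross u v w) :
    (interior (triangle u v w)).Nonempty := by
  have hs : ∀ x y : ℂ, cross x y ((1 / 3 : ℝ) • (u + v + w)) =
      (cross x y u + cross x y v + cross x y w) / 3 := by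
    intro x y; simp [cross]; ring
  refine ⟨(1 / 3 : ℝ) • (u + v + w), mem_interior_triangle h ?_ ?_ ?_⟩ <;> rw [hs]
  · rw [cross_self_left, cross_self_right]; linarith
  · rw [cross_self_left, cross_self_right, cross_rotate]; linarith
  · rw [cross_self_left, cross_self_right, cross_rotate, cross_rotate]; linarith

lemma closure_interior_triangle {u v w : ℂ} (h : 0 < cross u v w) :
    closure (interior (triangle u v w)) = triangle u v w := by
  rw [(convex_triangle u v w).closure_interior_eq_closure_of_nonempty_interior
    (interior_triangle_nonempty h)]
  exact (isCompact_triangle u v w).isClosed.closure_eq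

/-! ### Placements -/

lemma Placement.map_sub (g : Placement) (z w : ℂ) :
    g.map z - g.map w = (g.dir : ℂ) * (z - w) := by
  simp only [Placement.map]; ring

lemma Placement.map_injective (g : Placement) : Function.Injective g.map := by
  intro z w h
  simpa [Placement.map] using h

/-- A placement as a homeomorphism of the plane. -/
noncomputable def Placement.homeo (g : Placement) : ℂ ≃ₜ ℂ :=
  (Homeomorph.mulLeft₀ (g.dir : ℂ) g.dir.coe_ne_zero).trans (Homeomorph.addLeft g.pos)

lemma Placement.coe_homeo (g : Placement) : ⇑g.homeo = g.map := rfl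

lemma Placement.image_interior (g : Placement) (s : Set ℂ) :
    g.map '' interior s = interior (g.map '' s) := by
  rw [← g.coe_homeo, Homeomorph.image_interior]

lemma Placement.image_convexHull (g : Placement) (s : Set ℂ) :
    g.map '' convexHull ℝ s = convexHull ℝ (g.map '' s) := by
  have h : g.map = ⇑((AffineMap.const ℝ ℂ g.pos) +
      (LinearMap.mulLeft ℝ (g.dir : ℂ)).toAffineMap) := by
    ext z; simp [Placement.map]
  rw [h, AffineMap.image_convexHull]

lemma Placement.image_segment (g : Placement) (u v : ℂ) :
    g.map '' segment ℝ u v = segment ℝ (g.map u) (g.map v) := by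
  rw [← convexHull_pair, g.image_convexHull, Set.image_pair, convexHull_pair]

lemma Placement.dist_map (g : Placement) (z w : ℂ) : dist (g.map z) (g.map w) = dist z w := by
  rw [dist_eq_norm, g.map_sub, norm_mul, Circle.norm_coe, one_mul, dist_eq_norm]

lemma Placement.eq_of_map_eq {g h : Placement} {u v : ℂ} (huv : u ≠ v)
    (hu : g.map u = h.map u) (hv : g.map v = h.map v) : g = h := by
  have hd : (g.dir : ℂ) = h.dir := by
    have h1 := g.map_sub u v
    rw [hu, hv, h.map_sub] at h1
    exact (mul_right_cancel₀ (sub_ne_zero.2 huv) h1).symm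
  have hp : g.pos = h.pos := by
    simp only [Placement.map, hd] at hu
    exact add_right_cancel hu
  cases g; cases h
  simp only [Placement.mk.injEq]
  exact ⟨hp, Circle.ext hd⟩

/-! ### The rhombs in oblique coordinates -/

/-- The corner `D` or `H` of the reference rhomb; together with `1` it spans the rhomb. -/
noncomputable def RhombKind.tau : RhombKind → ℂ
  | .thin => omega
  | .thick => omega ^ 2

lemma RhombKind.refCorner_eq (κ : RhombKind) : κ.refCorner = ![0, 1, 1 + κ.tau, κ.tau] := by
  cases κ <;> rfl

lemma RhombKind.tau_im_pos (κ : RhombKind) : 0 < κ.tau.im := by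
  have := sinFifth_pos
  have := phi_gt
  cases κ
  · simp [tau, omega_im, *]
  · simp [tau, omega_sq, omega_im]; positivity

/-- Oblique coordinates with respect to the sides of the reference rhomb. -/
noncomputable def RhombKind.chart (κ : RhombKind) : (ℝ × ℝ) ≃L[ℝ] ℂ :=
  LinearEquiv.toContinuousLinearEquiv
    { toFun := fun p => p.1 + p.2 * κ.tau
      invFun := fun z => (z.re - z.im / κ.tau.im * κ.tau.re, z.im / κ.tau.im)
      map_add' := fun p p' => by simp; ring
      map_smul' := fun t p => by simp; ring
      left_inv := fun p => by
        have := κ.tau_im_pos.ne'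
        ext <;> simp [this]
      right_inv := fun z => by
        have := κ.tau_im_pos.ne'
        apply Complex.ext <;> simp [this] }

lemma RhombKind.chart_apply (κ : RhombKind) (x y : ℝ) : κ.chart (x, y) = x + y * κ.tau := rfl

/-- The region covered by the reference rhomb. -/
noncomputable def RhombKind.region (κ : RhombKind) : Set ℂ :=
  convexHull ℝ (Set.range κ.refCorner)

lemma RhombKind.region_eq (κ : RhombKind) :
    κ.region = κ.chart '' (Set.Icc 0 1 ×ˢ Set.Icc 0 1) := by
  have h : Set.range κ.refCorner = κ.chart '' (({0, 1} : Set ℝ) ×ˢ ({0, 1} : Set ℝ)) := by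
    rw [κ.refCorner_eq]
    ext z
    simp only [Set.mem_range, Fin.exists_fin_succ, Set.mem_image, Prod.exists, Set.mem_prod,
      κ.chart_apply]
    simp [or_and_right, and_or_left, exists_or]
    tauto
  have hs : segment ℝ (0 : ℝ) 1 = Set.Icc 0 1 := segment_eq_Icc zero_le_one
  rw [region, h]
  have := (κ.chart.toLinearEquiv.toLinearMap).image_convexHull
    (({0, 1} : Set ℝ) ×ˢ ({0, 1} : Set ℝ))
  rw [convexHull_prod, convexHull_pair, hs] at this
  exact this.symm

lemma RhombKind.interior_region (κ : RhombKind) :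
    interior κ.region = κ.chart '' (Set.Ioo 0 1 ×ˢ Set.Ioo 0 1) := by
  rw [κ.region_eq, ← κ.chart.coe_toHomeomorph, ← Homeomorph.image_interior,
    interior_prod_eq, interior_Icc]

lemma RhombKind.chart_mem_region (κ : RhombKind) (x y : ℝ) :
    κ.chart (x, y) ∈ κ.region ↔ (0 ≤ x ∧ x ≤ 1) ∧ (0 ≤ y ∧ y ≤ 1) := by
  rw [κ.region_eq, κ.chart.injective.mem_set_image]
  simp; tauto

lemma RhombKind.chart_mem_interior (κ : RhombKind) (x y : ℝ) :
    κ.chart (x, y) ∈ interior κ.region ↔ (0 < x ∧ x < 1) ∧ (0 < y ∧ y < 1) := by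
  rw [κ.interior_region, κ.chart.injective.mem_set_image]
  simp [Set.mem_prod, Set.mem_Ioo]

lemma RhombKind.exists_chart (κ : RhombKind) (z : ℂ) : ∃ x y, z = κ.chart (x, y) :=
  ⟨_, _, (κ.chart.apply_symm_apply z).symm⟩

lemma RhombKind.exists_side (κ : RhombKind) {z : ℂ} (hz : z ∈ κ.region)
    (hi : z ∉ interior κ.region) : ∃ i, z ∈ segment ℝ (κ.refCorner i) (κ.refCorner (i + 1)) := by
  obtain ⟨x, y, rfl⟩ := κ.exists_chart z
  rw [κ.chart_mem_interior] at hi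
  obtain ⟨⟨hx0, hx1⟩, hy0, hy1⟩ := (κ.chart_mem_region x y).1 hz
  rw [κ.refCorner_eq]
  rcases hx0.eq_or_lt with h | hx0'
  · refine ⟨3, y, 1 - y, by linarith, by linarith, by ring, ?_⟩
    simp [κ.chart_apply, ← h]
  rcases hx1.eq_or_lt with h | hx1'
  · refine ⟨1, 1 - y, y, by linarith, by linarith, by ring, ?_⟩
    simp [κ.chart_apply, h]; ring
  rcases hy0.eq_or_lt with h | hy0'
  · refine ⟨0, 1 - x, x, by linarith, by linarith, by ring, ?_⟩
    simp [κ.chart_apply, ← h]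
  rcases hy1.eq_or_lt with h | hy1'
  · refine ⟨2, x, 1 - x, by linarith, by linarith, by ring, ?_⟩
    simp [κ.chart_apply, h]; ring
  exact absurd ⟨⟨hx0', hx1'⟩, hy0', hy1'⟩ hi

lemma RhombKind.side_subset (κ : RhombKind) {z : ℂ} {i : Fin 4}
    (hz : z ∈ segment ℝ (κ.refCorner i) (κ.refCorner (i + 1))) :
    z ∈ κ.region ∧ z ∉ interior κ.region := by
  refine ⟨(convex_convexHull ℝ _).segment_subset (subset_convexHull ℝ _ (Set.mem_range_self i))
    (subset_convexHull ℝ _ (Set.mem_range_self (i + 1))) hz, ?_⟩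
  obtain ⟨a, b, ha, hb, hab, rfl⟩ := hz
  rw [κ.refCorner_eq]
  have hb' : b = 1 - a := by linarith
  fin_cases i
  · have : κ.chart (b, 0) = a • (0 : ℂ) + b • 1 := by simp [κ.chart_apply]
    simp only [Fin.reduceFinMk, Fin.reduceAdd, Matrix.cons_val]
    rw [← this]
    simp [κ.chart_mem_interior]
  · have : κ.chart (1, b) = a • (1 : ℂ) + b • (1 + κ.tau) := by
      simp [κ.chart_apply, hb']; ring
    simp only [Fin.reduceFinMk, Fin.reduceAdd, Matrix.cons_val]
    rw [← this]
    simp [κ.chart_mem_interior]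
  · have : κ.chart (a, 1) = a • (1 + κ.tau) + b • κ.tau := by
      simp [κ.chart_apply, hb']; ring
    simp only [Fin.reduceFinMk, Fin.reduceAdd, Matrix.cons_val]
    rw [← this]
    simp [κ.chart_mem_interior]
  · have : κ.chart (0, a) = a • κ.tau + b • (0 : ℂ) := by simp [κ.chart_apply]
    simp only [Fin.reduceFinMk, Fin.reduceAdd, Matrix.cons_val]
    rw [← this]
    simp [κ.chart_mem_interior]

lemma RhombKind.refCorner_injective (κ : RhombKind) : Function.Injective κ.refCorner := by
  have h : κ.refCorner = fun i => κ.chart (![(0, 0), (1, 0), (1, 1), (0, 1)] i) := by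
    rw [κ.refCorner_eq]
    funext i
    fin_cases i <;> simp [κ.chart_apply]
  rw [h]
  refine κ.chart.injective.comp ?_
  intro i j hij
  fin_cases i <;> fin_cases j <;> simp_all

lemma RhombKind.closure_interior_region (κ : RhombKind) :
    closure (interior κ.region) = κ.region := by
  rw [κ.interior_region, κ.region_eq, ← κ.chart.coe_toHomeomorph, ← Homeomorph.image_closure,
    closure_prod_eq, closure_Ioo zero_ne_one]

lemma Rhomb.carrier_eq (r : Rhomb) : r.carrier = r.place.map '' r.kind.region := by
  rw [RhombKind.region, Placement.image_convexHull, Rhomb.carrier, ← Set.range_comp]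
  rfl

lemma Rhomb.interior_carrier (r : Rhomb) :
    interior r.carrier = r.place.map '' interior r.kind.region := by
  rw [r.carrier_eq, Placement.image_interior]

lemma Rhomb.isCompact_carrier (r : Rhomb) : IsCompact r.carrier :=
  (Set.finite_range _).isCompact_convexHull (𝕜 := ℝ)

lemma Rhomb.closure_interior_carrier (r : Rhomb) : closure (interior r.carrier) = r.carrier := by
  rw [r.interior_carrier, r.carrier_eq, ← r.place.coe_homeo, ← Homeomorph.image_closure,
    r.kind.closure_interior_region]

lemma Rhomb.corner_mem (r : Rhomb) (i : Fin 4) : r.corner i ∈ r.carrier :=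
  subset_convexHull ℝ _ ⟨i, rfl⟩

lemma Rhomb.corner_injective (r : Rhomb) : Function.Injective r.corner :=
  r.place.map_injective.comp r.kind.refCorner_injective

lemma Rhomb.exists_side (r : Rhomb) {z : ℂ} (hz : z ∈ r.carrier)
    (hi : z ∉ interior r.carrier) : ∃ i, z ∈ segment ℝ (r.corner i) (r.corner (i + 1)) := by
  rw [r.carrier_eq] at hz
  obtain ⟨w, hw, rfl⟩ := hz
  rw [r.interior_carrier, r.place.map_injective.mem_set_image] at hi
  obtain ⟨i, h⟩ := r.kind.exists_side hw hi
  refine ⟨i, ?_⟩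
  rw [Rhomb.corner, Rhomb.corner, ← Placement.image_segment]
  exact ⟨w, h, rfl⟩

lemma Rhomb.side_subset (r : Rhomb) {z : ℂ} {i : Fin 4}
    (hz : z ∈ segment ℝ (r.corner i) (r.corner (i + 1))) :
    z ∈ r.carrier ∧ z ∉ interior r.carrier := by
  rw [Rhomb.corner, Rhomb.corner, ← Placement.image_segment] at hz
  obtain ⟨w, hw, rfl⟩ := hz
  rw [r.interior_carrier, r.carrier_eq, r.place.map_injective.mem_set_image,
    r.place.map_injective.mem_set_image]
  exact r.kind.side_subset hw

lemma Rhomb.eq_of_corner_eq {r s : Rhomb} (hk : r.kind = s.kind) {i j : Fin 4} (hij : i ≠ j)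
    (hi : r.corner i = s.corner i) (hj : r.corner j = s.corner j) : r = s := by
  cases r with | mk κ g =>
  cases s with | mk κ' h =>
  obtain rfl : κ = κ' := hk
  congr 1
  exact Placement.eq_of_map_eq (κ.refCorner_injective.ne hij) hi hj

/-! ### Sectors -/

/-- The side from corner `i` to corner `i + 1` of the reference rhomb points in the direction
`omega ^ sideDir i`. -/
def RhombKind.sideDir : RhombKind → Fin 4 → ℕ
  | .thin => ![0, 1, 5, 6]
  | .thick => ![0, 2, 5, 7]

/-- The angle of the rhomb at its corner `i`, in units of `π / 5`. -/
def RhombKind.angle : RhombKind → Fin 4 → ℕ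
  | .thin => ![1, 4, 1, 4]
  | .thick => ![2, 3, 2, 3]

lemma RhombKind.refCorner_sub (κ : RhombKind) (i : Fin 4) :
    κ.refCorner (i + 1) - κ.refCorner i = omega ^ κ.sideDir i := by
  have h5 := omega_pow_five
  cases κ <;> fin_cases i <;> simp [refCorner, sideDir]
  · exact h5.symm
  · linear_combination -omega * h5
  · exact h5.symm
  · linear_combination -omega ^ 2 * h5

lemma Rhomb.corner_sub (r : Rhomb) (i : Fin 4) :
    r.corner (i + 1) - r.corner i = r.place.dir * omega ^ r.kind.sideDir i := by
  rw [Rhomb.corner, Rhomb.corner, Placement.map_sub, RhombKind.refCorner_sub]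

/-- A point in the middle of the sector of opening `π / 5` that starts at `v` in direction `d`. -/
noncomputable def sectorPoint (v d : ℂ) : ℂ := v + d * (1 + omega) / 10

/-- A criterion in terms of the coordinates `x`, `y` of the corner `v` and `α`, `β` of the direction
with respect to `1`, `omega`. -/
lemma sectorPoint_mem_thin {n : ℕ} {v : ℂ} (x y α β : ℝ) (hv : v = x + y * omega)
    (hn : omega ^ n = α + β * omega) (hx : 0 < x + (α - β) / 10 ∧ x + (α - β) / 10 < 1)
    (hy : 0 < y + (α + β + β * φ) / 10 ∧ y + (α + β + β * φ) / 10 < 1) :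
    sectorPoint v (omega ^ n) ∈ interior RhombKind.thin.region := by
  have : sectorPoint v (omega ^ n) =
      RhombKind.thin.chart (x + (α - β) / 10, y + (α + β + β * φ) / 10) := by
    rw [RhombKind.chart_apply, sectorPoint, hn, hv, RhombKind.tau]
    simp only [Complex.ofReal_add, Complex.ofReal_sub, Complex.ofReal_mul, Complex.ofReal_div,
      Complex.ofReal_ofNat]
    linear_combination (β / 10 : ℂ) * omega_sq
  rw [this]
  exact (RhombKind.chart_mem_interior _ _ _).2 ⟨hx, hy⟩

lemma omega_eq : omega = (φ - 1) * (1 + omega ^ 2) := by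
  linear_combination -(φ - 1 : ℂ) * omega_sq - omega * phi_sq_complex

lemma omega_pow_four' : omega ^ 4 = (φ - 1) * omega ^ 2 - 1 := by
  linear_combination omega_pow_four - (φ - 1) * omega_sq - omega * phi_sq_complex

/-- A criterion in terms of the coordinates `x`, `y` of the corner `v` and `α`, `β` of the direction
with respect to `1`, `omega ^ 2`. -/
lemma sectorPoint_mem_thick {n : ℕ} {v : ℂ} (x y α β : ℝ) (hv : v = x + y * omega ^ 2)
    (hn : omega ^ n = α + β * omega ^ 2)
    (hx : 0 < x + (α * φ - β * (φ - 1)) / 10 ∧ x + (α * φ - β * (φ - 1)) / 10 < 1)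
    (hy : 0 < y + (α * (φ - 1) + 2 * β) / 10 ∧ y + (α * (φ - 1) + 2 * β) / 10 < 1) :
    sectorPoint v (omega ^ n) ∈ interior RhombKind.thick.region := by
  have : sectorPoint v (omega ^ n) =
      RhombKind.thick.chart (x + (α * φ - β * (φ - 1)) / 10,
        y + (α * (φ - 1) + 2 * β) / 10) := by
    rw [RhombKind.chart_apply, sectorPoint, hn, hv, RhombKind.tau]
    simp only [Complex.ofReal_add, Complex.ofReal_sub, Complex.ofReal_mul, Complex.ofReal_div,
      Complex.ofReal_ofNat, Complex.ofReal_one]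
    linear_combination (α + β * omega ^ 2) / 10 * omega_eq
      + (β * (φ - 1) / 10 : ℂ) * omega_pow_four' + (β * omega ^ 2 / 10) * phi_sq_complex
  rw [this]
  exact (RhombKind.chart_mem_interior _ _ _).2 ⟨hx, hy⟩

lemma RhombKind.sectorPoint_mem (κ : RhombKind) (i : Fin 4) (m : ℕ) (hm : m < κ.angle i) :
    sectorPoint (κ.refCorner i) (omega ^ (κ.sideDir i + m)) ∈ interior κ.region := by
  have h1 := omega_eq
  have h2 := omega_sq
  have h3 := omega_pow_three
  have h4 := omega_pow_four
  have h4' := omega_pow_four'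
  have h5 := omega_pow_five
  have hp := phi_sq_complex
  have h3' : omega ^ 3 = -(φ - 1) + omega ^ 2 := by
    linear_combination omega_pow_three - omega_sq
  have h6 : omega ^ 6 = -omega := by linear_combination omega * h5
  have h7 : omega ^ 7 = -omega ^ 2 := by linear_combination omega ^ 2 * h5
  have h8 : omega ^ 8 = -omega ^ 3 := by linear_combination omega ^ 3 * h5
  have h9 : omega ^ 9 = -omega ^ 4 := by linear_combination omega ^ 4 * h5
  have g := gold_sq
  have g1 := phi_gt
  have g2 := phi_lt
  cases κ
  · fin_cases i <;> simp [angle] at hm <;> first | subst hm | interval_cases m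
    · exact sectorPoint_mem_thin 0 0 (1) (0) (by simp [refCorner]) (by simp [sideDir])
        ⟨by nlinarith, by nlinarith⟩ ⟨by nlinarith, by nlinarith⟩
    · exact sectorPoint_mem_thin 1 0 (0) (1) (by simp [refCorner]) (by simp [sideDir])
        ⟨by nlinarith, by nlinarith⟩ ⟨by nlinarith, by nlinarith⟩
    · exact sectorPoint_mem_thin 1 0 (-1) (φ) (by simp [refCorner])
        (by simp [sideDir]; linear_combination h2)
        ⟨by nlinarith, by nlinarith⟩ ⟨by nlinarith, by nlinarith⟩
    · exact sectorPoint_mem_thin 1 0 (-φ) (φ) (by simp [refCorner])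
        (by simp [sideDir]; linear_combination h3)
        ⟨by nlinarith, by nlinarith⟩ ⟨by nlinarith, by nlinarith⟩
    · exact sectorPoint_mem_thin 1 0 (-φ) (1) (by simp [refCorner])
        (by simp [sideDir]; linear_combination h4)
        ⟨by nlinarith, by nlinarith⟩ ⟨by nlinarith, by nlinarith⟩
    · exact sectorPoint_mem_thin 1 1 (-(1)) (-(0)) (by simp [refCorner])
        (by simp [sideDir]; linear_combination h5)
        ⟨by nlinarith, by nlinarith⟩ ⟨by nlinarith, by nlinarith⟩
    · exact sectorPoint_mem_thin 0 1 (-(0)) (-(1)) (by simp [refCorner])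
        (by simp [sideDir]; linear_combination h6)
        ⟨by nlinarith, by nlinarith⟩ ⟨by nlinarith, by nlinarith⟩
    · exact sectorPoint_mem_thin 0 1 (-(-1)) (-(φ)) (by simp [refCorner])
        (by simp [sideDir]; linear_combination h7 - h2)
        ⟨by nlinarith, by nlinarith⟩ ⟨by nlinarith, by nlinarith⟩
    · exact sectorPoint_mem_thin 0 1 (-(-φ)) (-(φ)) (by simp [refCorner])
        (by simp [sideDir]; linear_combination h8 - h3)
        ⟨by nlinarith, by nlinarith⟩ ⟨by nlinarith, by nlinarith⟩
    · exact sectorPoint_mem_thin 0 1 (-(-φ)) (-(1)) (by simp [refCorner])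
        (by simp [sideDir]; linear_combination h9 - h4)
        ⟨by nlinarith, by nlinarith⟩ ⟨by nlinarith, by nlinarith⟩
  · fin_cases i <;> simp [angle] at hm <;> first | subst hm | interval_cases m
    · exact sectorPoint_mem_thick 0 0 (1) (0) (by simp [refCorner]) (by simp [sideDir])
        ⟨by nlinarith, by nlinarith⟩ ⟨by nlinarith, by nlinarith⟩
    · exact sectorPoint_mem_thick 0 0 (φ - 1) (φ - 1) (by simp [refCorner])
        (by simp [sideDir]; linear_combination h1)
        ⟨by nlinarith, by nlinarith⟩ ⟨by nlinarith, by nlinarith⟩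
    · exact sectorPoint_mem_thick 1 0 (0) (1) (by simp [refCorner]) (by simp [sideDir])
        ⟨by nlinarith, by nlinarith⟩ ⟨by nlinarith, by nlinarith⟩
    · exact sectorPoint_mem_thick 1 0 (-(φ - 1)) (1) (by simp [refCorner])
        (by simp [sideDir]; linear_combination h3')
        ⟨by nlinarith, by nlinarith⟩ ⟨by nlinarith, by nlinarith⟩
    · exact sectorPoint_mem_thick 1 0 (-1) (φ - 1) (by simp [refCorner])
        (by simp [sideDir]; linear_combination h4')
        ⟨by nlinarith, by nlinarith⟩ ⟨by nlinarith, by nlinarith⟩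
    · exact sectorPoint_mem_thick 1 1 (-(1)) (-(0)) (by simp [refCorner])
        (by simp [sideDir]; linear_combination h5)
        ⟨by nlinarith, by nlinarith⟩ ⟨by nlinarith, by nlinarith⟩
    · exact sectorPoint_mem_thick 1 1 (-(φ - 1)) (-(φ - 1)) (by simp [refCorner])
        (by simp [sideDir]; linear_combination h6 - h1)
        ⟨by nlinarith, by nlinarith⟩ ⟨by nlinarith, by nlinarith⟩
    · exact sectorPoint_mem_thick 0 1 (-(0)) (-(1)) (by simp [refCorner])
        (by simp [sideDir]; linear_combination h7)
        ⟨by nlinarith, by nlinarith⟩ ⟨by nlinarith, by nlinarith⟩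
    · exact sectorPoint_mem_thick 0 1 (-(-(φ - 1))) (-(1)) (by simp [refCorner])
        (by simp [sideDir]; linear_combination h8 - h3')
        ⟨by nlinarith, by nlinarith⟩ ⟨by nlinarith, by nlinarith⟩
    · exact sectorPoint_mem_thick 0 1 (-(-1)) (-(φ - 1)) (by simp [refCorner])
        (by simp [sideDir]; linear_combination h9 - h4')
        ⟨by nlinarith, by nlinarith⟩ ⟨by nlinarith, by nlinarith⟩

/-! ### Local structure of Penrose tilings -/

lemma RhombKind.region_nonempty_interior (κ : RhombKind) : (interior κ.region).Nonempty :=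
  ⟨_, (κ.chart_mem_interior (1 / 2) (1 / 2)).2 (by norm_num)⟩

lemma exists_ball_subset_interior :
    ∃ ρ > 0, ∀ r : Rhomb, ∃ c, Metric.ball c ρ ⊆ interior r.carrier := by
  have h : ∀ κ : RhombKind, ∃ ρ > 0, ∃ c, Metric.ball c ρ ⊆ interior κ.region := by
    intro κ
    obtain ⟨c, hc⟩ := κ.region_nonempty_interior
    obtain ⟨ρ, h0, hρ⟩ := Metric.isOpen_iff.1 isOpen_interior c hc
    exact ⟨ρ, h0, c, hρ⟩
  choose ρ h0 c hc using h
  refine ⟨min (ρ .thin) (ρ .thick), lt_min (h0 _) (h0 _), fun r => ⟨r.place.map (c r.kind), ?_⟩⟩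
  intro z hz
  rw [r.interior_carrier]
  obtain ⟨w, rfl⟩ := r.place.homeo.surjective z
  refine ⟨w, hc r.kind ?_, rfl⟩
  rw [Metric.mem_ball, Placement.coe_homeo, Placement.dist_map] at hz
  rw [Metric.mem_ball]
  refine hz.trans_le ?_
  cases r.kind
  · exact min_le_left _ _
  · exact min_le_right _ _

lemma exists_dist_le : ∃ D, ∀ r : Rhomb, ∀ z ∈ r.carrier, ∀ w ∈ r.carrier, dist z w ≤ D := by
  have h : ∀ κ : RhombKind, ∃ D, ∀ z ∈ κ.region, ∀ w ∈ κ.region, dist z w ≤ D := by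
    intro κ
    have : IsCompact κ.region := (Set.finite_range _).isCompact_convexHull (𝕜 := ℝ)
    obtain ⟨D, hD⟩ := Metric.isBounded_iff.1 this.isBounded
    exact ⟨D, fun z hz w hw => hD hz hw⟩
  choose D hD using h
  refine ⟨max (D .thin) (D .thick), fun r => ?_⟩
  rw [r.carrier_eq]
  rintro _ ⟨z, hz, rfl⟩ _ ⟨w, hw, rfl⟩
  rw [Placement.dist_map]
  refine (hD _ z hz w hw).trans ?_
  cases r.kind
  · exact le_max_left _ _
  · exact le_max_right _ _

namespace IsPenroseTiling

variable {P : Set Rhomb}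

lemma eq_of_mem_interior (hP : IsPenroseTiling P) {r s : Rhomb} (hr : r ∈ P) (hs : s ∈ P) {z : ℂ}
    (hz : z ∈ interior r.carrier) (hz' : z ∈ s.carrier) : r = s := by
  by_contra hne
  rw [← s.closure_interior_carrier, mem_closure_iff] at hz'
  obtain ⟨w, hw1, hw2⟩ := hz' _ isOpen_interior hz
  exact Set.disjoint_left.1 (hP.disjoint r hr s hs hne) hw1 hw2

/-- Only finitely many rhombs meet a given unit disc, since their interiors are disjoint and
contain discs of a fixed radius. -/
lemma locallyFinite (hP : IsPenroseTiling P) :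
    LocallyFinite (fun r : P => r.1.carrier) := by
  obtain ⟨ρ, hρ, hb⟩ := exists_ball_subset_interior
  obtain ⟨D, hD⟩ := exists_dist_le
  intro x
  refine ⟨Metric.ball x 1, Metric.ball_mem_nhds x one_pos, ?_⟩
  set S : Set P := {r | (r.1.carrier ∩ Metric.ball x 1).Nonempty} with hS
  have hfin : Set.Finite {r : S | MeasureTheory.volume (Metric.ball (0 : ℂ) ρ) ≤
      MeasureTheory.volume (interior r.1.1.carrier)} := by
    refine MeasureTheory.Measure.finite_const_le_meas_of_disjoint_iUnion _
      (Metric.measure_ball_pos _ _ hρ) (fun _ => isOpen_interior.measurableSet) ?_ ?_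
    · intro r s hrs
      exact hP.disjoint _ r.1.2 _ s.1.2 fun h => hrs (Subtype.ext (Subtype.ext h))
    · refine ne_top_of_le_ne_top (MeasureTheory.measure_ball_lt_top (x := x) (r := D + 1)).ne
        (MeasureTheory.measure_mono ?_)
      refine Set.iUnion_subset fun r z hz => ?_
      obtain ⟨y, hy1, hy2⟩ := r.2
      have := hD _ z (interior_subset hz) y hy1
      have := dist_triangle z y x
      rw [Metric.mem_ball] at *
      linarith
  have huniv : {r : S | MeasureTheory.volume (Metric.ball (0 : ℂ) ρ) ≤
      MeasureTheory.volume (interior r.1.1.carrier)} = Set.univ := by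
    refine Set.eq_univ_of_forall fun r => ?_
    obtain ⟨c, hc⟩ := hb r.1.1
    have := MeasureTheory.Measure.addHaar_ball_center (MeasureTheory.volume (α := ℂ)) c ρ
    rw [Set.mem_ofPred_eq, ← this]
    exact MeasureTheory.measure_mono hc
  rw [huniv] at hfin
  exact Set.finite_coe_iff.1 (Set.finite_univ_iff.1 hfin)

/-- A point outside the interior of a rhomb of the tiling lies in another rhomb. -/
lemma exists_other (hP : IsPenroseTiling P) {r : Rhomb} {z : ℂ}
    (hz : z ∉ interior r.carrier) : ∃ s ∈ P, s ≠ r ∧ z ∈ s.carrier := by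
  have hlf : LocallyFinite (fun s : {s : P // s.1 ≠ r} => s.1.1.carrier) :=
    hP.locallyFinite.comp_injective Subtype.val_injective
  have hc := hlf.isClosed_iUnion fun s => s.1.1.isCompact_carrier.isClosed
  have hsub : r.carrierᶜ ⊆ ⋃ s : {s : P // s.1 ≠ r}, s.1.1.carrier := by
    intro w hw
    have : w ∈ ⋃ r ∈ P, r.carrier := by rw [hP.cover]; trivial
    simp only [Set.mem_iUnion] at this
    obtain ⟨s, hs, hws⟩ := this
    refine Set.mem_iUnion.2 ⟨⟨⟨s, hs⟩, ?_⟩, hws⟩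
    rintro rfl
    exact hw hws
  have : z ∈ closure (r.carrierᶜ) := by rw [closure_compl]; exact hz
  have := closure_minimal hsub hc this
  obtain ⟨s, hs⟩ := Set.mem_iUnion.1 this
  exact ⟨s.1.1, s.1.2, s.2, hs⟩

/-- Every side of a rhomb overlaps a side of another rhomb: the side is covered by finitely many
sides of other rhombs, and they cannot all meet it in at most one point. -/
lemma exists_overlap (hP : IsPenroseTiling P) {r : Rhomb} (hr : r ∈ P) (i : Fin 4) :
    ∃ s ∈ P, s ≠ r ∧ ∃ j, (segment ℝ (r.corner i) (r.corner (i + 1)) ∩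
      segment ℝ (s.corner j) (s.corner (j + 1))).Nontrivial := by
  by_contra! hcon
  have hcpt : IsCompact (segment ℝ (r.corner i) (r.corner (i + 1))) := by
    rw [← convexHull_pair]; exact (Set.toFinite _).isCompact_convexHull (𝕜 := ℝ)
  have hF := hP.locallyFinite.finite_nonempty_inter_compact hcpt
  have hne : r.corner i ≠ r.corner (i + 1) :=
    r.corner_injective.ne (by fin_cases i <;> decide)
  have hinf : (segment ℝ (r.corner i) (r.corner (i + 1))).Infinite := by
    refine Set.Infinite.mono (openSegment_subset_segment ℝ _ _) ?_
    rw [openSegment_eq_image_lineMap]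
    exact (Set.Ioo_infinite one_pos).image (AffineMap.lineMap_injective ℝ hne).injOn
  refine hinf ?_
  have hfin : (⋃ s ∈ {s : P | (s.1.carrier ∩ segment ℝ (r.corner i) (r.corner (i + 1))).Nonempty ∧
      s.1 ≠ r}, ⋃ j : Fin 4, (segment ℝ (r.corner i) (r.corner (i + 1)) ∩
      segment ℝ (s.1.corner j) (s.1.corner (j + 1)))).Finite := by
    refine (hF.subset fun s hs => hs.1).biUnion fun s hs => Set.finite_iUnion fun j => ?_
    exact (hcon s.1 s.2 hs.2 j).finite
  refine hfin.subset fun z hz => ?_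
  obtain ⟨hz1, hz2⟩ := r.side_subset hz
  obtain ⟨s, hs, hsr, hzs⟩ := hP.exists_other (P := P) hz2
  have hzi : z ∉ interior s.carrier := fun h => hsr (hP.eq_of_mem_interior hs hr h hz1)
  obtain ⟨j, hj⟩ := s.exists_side hzs hzi
  simp only [Set.mem_iUnion]
  exact ⟨⟨s, hs⟩, ⟨⟨z, hzs, hz⟩, hsr⟩, j, hz, hj⟩

end IsPenroseTiling

/-- The mark of side `i` (from corner `i` to corner `i + 1`): the kind of its arrow, and whether
the arrow points from corner `i` to corner `i + 1`. -/
def RhombKind.mark : RhombKind → Fin 4 → ArrowKind × Bool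
  | .thin => ![(.single, true), (.single, false), (.double, true), (.double, false)]
  | .thick => ![(.single, true), (.double, true), (.double, false), (.single, false)]

/-- The side of the rhomb that can be glued to a side with the given mark: it carries the same
arrow, traversed in the opposite direction. -/
def RhombKind.glueSide : RhombKind → ArrowKind × Bool → Fin 4
  | .thin, (.single, true) => 1
  | .thin, (.single, false) => 0
  | .thin, (.double, true) => 3
  | .thin, (.double, false) => 2
  | .thick, (.single, true) => 3
  | .thick, (.single, false) => 0
  | .thick, (.double, true) => 2
  | .thick, (.double, false) => 1

/-- The rhomb `s` lies across side `i` of `r`, glued along the side with the same arrow. -/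
def Rhomb.IsNeighbor (r : Rhomb) (i : Fin 4) (s : Rhomb) : Prop :=
  s.corner (s.kind.glueSide (r.kind.mark i)) = r.corner (i + 1) ∧
    s.corner (s.kind.glueSide (r.kind.mark i) + 1) = r.corner i

/-- The marked edge along side `i`. -/
noncomputable def Rhomb.markedEdge (r : Rhomb) (i : Fin 4) : MarkedEdge :=
  if (r.kind.mark i).2 then ⟨(r.kind.mark i).1, r.corner i, r.corner (i + 1)⟩
  else ⟨(r.kind.mark i).1, r.corner (i + 1), r.corner i⟩

lemma Rhomb.markedEdge_mem (r : Rhomb) (i : Fin 4) : r.markedEdge i ∈ r.edges := by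
  rcases r with ⟨κ, g⟩
  cases κ <;> fin_cases i <;> simp [markedEdge, edges, RhombKind.mark]

lemma Rhomb.markedEdge_carrier (r : Rhomb) (i : Fin 4) :
    (r.markedEdge i).carrier = segment ℝ (r.corner i) (r.corner (i + 1)) := by
  unfold markedEdge
  split
  · rfl
  · exact segment_symm _ _ _

lemma Rhomb.sectorPoint_mem (r : Rhomb) (i : Fin 4) (m : ℕ) (hm : m < r.kind.angle i) :
    sectorPoint (r.corner i) (r.place.dir * omega ^ (r.kind.sideDir i + m)) ∈
      interior r.carrier := by
  rw [r.interior_carrier]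
  refine ⟨_, r.kind.sectorPoint_mem i m hm, ?_⟩
  simp only [sectorPoint, corner, Placement.map]
  ring

namespace IsPenroseTiling

variable {P : Set Rhomb}

lemma eq_of_sector (hP : IsPenroseTiling P) {r s : Rhomb} (hr : r ∈ P) (hs : s ∈ P) {i j : Fin 4}
    {m n : ℕ} (hm : m < r.kind.angle i) (hn : n < s.kind.angle j) (hc : r.corner i = s.corner j)
    (hd : (r.place.dir : ℂ) * omega ^ (r.kind.sideDir i + m) =
      s.place.dir * omega ^ (s.kind.sideDir j + n)) : r = s := by
  have h1 := r.sectorPoint_mem i m hm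
  rw [hc, hd] at h1
  exact hP.eq_of_mem_interior hr hs h1 (interior_subset (s.sectorPoint_mem j n hn))

lemma _root_.RhombKind.angle_pos (κ : RhombKind) (i : Fin 4) : 0 < κ.angle i := by
  cases κ <;> fin_cases i <;> simp [RhombKind.angle]

/-- Two rhombs on the same side of a common side are equal. -/
lemma eq_of_side (hP : IsPenroseTiling P) {r s : Rhomb} (hr : r ∈ P) (hs : s ∈ P) {i j : Fin 4}
    (h0 : r.corner i = s.corner j) (h1 : r.corner (i + 1) = s.corner (j + 1)) : r = s := by
  refine hP.eq_of_sector hr hs (r.kind.angle_pos i) (s.kind.angle_pos j) h0 ?_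
  rw [add_zero, add_zero, ← r.corner_sub, ← s.corner_sub, h0, h1]

theorem exists_neighbor (hP : IsPenroseTiling P) {r : Rhomb} (hr : r ∈ P) (i : Fin 4) :
    ∃ s ∈ P, r.IsNeighbor i s := by
  obtain ⟨s, hs, hsr, j, hj⟩ := hP.exists_overlap hr i
  refine ⟨s, hs, ?_⟩
  have he := hP.matching r hr s hs hsr.symm _ (r.markedEdge_mem i) _ (s.markedEdge_mem j)
    (by rwa [r.markedEdge_carrier, s.markedEdge_carrier])
  have hside := fun h0 h1 => hsr (hP.eq_of_side (i := i) (j := j) hr hs h0 h1).symm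
  unfold Rhomb.markedEdge at he
  have hg : ∀ b, (r.kind.mark i).2 = b → (s.kind.mark j).2 = !b →
      (r.kind.mark i).1 = (s.kind.mark j).1 → s.kind.glueSide (r.kind.mark i) = j := by
    cases r.kind <;> cases s.kind <;> fin_cases i <;> fin_cases j <;>
      simp [RhombKind.mark, RhombKind.glueSide]
  rcases hb : (r.kind.mark i).2 with _ | _ <;> rcases hb' : (s.kind.mark j).2 with _ | _ <;>
    simp [hb, hb'] at he
  · exact (hside he.2.2 he.2.1).elim
  · rw [Rhomb.IsNeighbor, hg _ hb hb' he.1]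
    exact ⟨he.2.1.symm, he.2.2.symm⟩
  · rw [Rhomb.IsNeighbor, hg _ hb hb' he.1]
    exact ⟨he.2.2.symm, he.2.1.symm⟩
  · exact (hside he.2.1 he.2.2).elim

lemma neighbor_unique (hP : IsPenroseTiling P) {r s t : Rhomb} {i : Fin 4} (hs : s ∈ P)
    (ht : t ∈ P) (h : r.IsNeighbor i s) (h' : r.IsNeighbor i t) : s = t :=
  hP.eq_of_side hs ht (h.1.trans h'.1.symm) (h.2.trans h'.2.symm)

end IsPenroseTiling

/-! ### Rhombs with corners in `ℤ[omega]` -/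

/-- The coefficients of an element of `ℤ[omega]` with respect to `1, omega, omega², omega³`. -/
abbrev Coeffs := ℤ × ℤ × ℤ × ℤ

/-- The complex number with the given coefficients. -/
noncomputable def Coeffs.val (p : Coeffs) : ℂ :=
  p.1 + p.2.1 * omega + p.2.2.1 * omega ^ 2 + p.2.2.2 * omega ^ 3

/-- The rotation by `k * (π / 5)` on coefficients. -/
def Coeffs.rot : ℕ → Coeffs → Coeffs
  | 0, p => p
  | k + 1, p => Coeffs.rot k (-p.2.2.2, p.1 + p.2.2.2, p.2.1 - p.2.2.2, p.2.2.1 + p.2.2.2)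

lemma Coeffs.val_add (p p' : Coeffs) : Coeffs.val (p + p') = p.val + p'.val := by
  simp [Coeffs.val]; ring

lemma Coeffs.val_rot (k : ℕ) (p : Coeffs) : (Coeffs.rot k p).val = omega ^ k * p.val := by
  induction k generalizing p with
  | zero => simp [Coeffs.rot]
  | succ k ih =>
    rw [Coeffs.rot, ih, pow_succ, mul_assoc]
    congr 1
    simp [Coeffs.val]
    linear_combination -(p.2.2.2 : ℂ) * (omega_pow_four - omega_pow_three + omega_sq)

instance RhombKind.instDecidableEq : DecidableEq RhombKind
  | .thin, .thin => isTrue rfl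
  | .thick, .thick => isTrue rfl
  | .thin, .thick => isFalse (by simp)
  | .thick, .thin => isFalse (by simp)

/-- A rhomb whose position has integer coefficients and whose direction is `omega ^ dir`. -/
structure LatticeRhomb where
  kind : RhombKind
  pos : Coeffs
  dir : ℕ
  deriving DecidableEq

/-- The rotation by `π / 5` as an element of the unit circle. -/
noncomputable def omegaCircle : Circle := Circle.exp (Real.pi / 5)

lemma coe_omegaCircle : (omegaCircle : ℂ) = omega := by
  rw [omegaCircle, Circle.coe_exp, omega]

/-- The frame `g`, rotated by `k * (π / 5)` about its origin and moved to the point `p` of it. -/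
noncomputable def Placement.sub (g : Placement) (p : ℂ) (k : ℕ) : Placement :=
  ⟨g.map p, g.dir * omegaCircle ^ k⟩

lemma Placement.coe_dir_sub (g : Placement) (p : ℂ) (k : ℕ) :
    ((g.sub p k).dir : ℂ) = g.dir * omega ^ k := by
  simp [Placement.sub, coe_omegaCircle]

lemma Placement.map_sub_apply (g : Placement) (p : ℂ) (k : ℕ) (z : ℂ) :
    (g.sub p k).map z = g.map (p + omega ^ k * z) := by
  rw [Placement.map, coe_dir_sub]
  simp only [sub, map]
  ring

lemma omega_pow_mod (n : ℕ) : omega ^ (n % 10) = omega ^ n := by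
  have h : omega ^ 10 = 1 := by linear_combination (omega ^ 5 - 1) * omega_pow_five
  exact (pow_eq_pow_mod n h).symm

lemma omegaCircle_pow_mod (n : ℕ) : omegaCircle ^ (n % 10) = omegaCircle ^ n := by
  apply Circle.ext
  simp [coe_omegaCircle, omega_pow_mod]

/-- The coefficients of the corners of the reference rhombs. -/
def RhombKind.latticeCorner : RhombKind → Fin 4 → Coeffs
  | .thin => ![(0, 0, 0, 0), (1, 0, 0, 0), (1, 1, 0, 0), (0, 1, 0, 0)]
  | .thick => ![(0, 0, 0, 0), (1, 0, 0, 0), (1, 0, 1, 0), (0, 0, 1, 0)]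

lemma RhombKind.val_latticeCorner (κ : RhombKind) (i : Fin 4) :
    (κ.latticeCorner i).val = κ.refCorner i := by
  cases κ <;> fin_cases i <;> simp [latticeCorner, refCorner, Coeffs.val]

namespace LatticeRhomb

/-- The rhomb in the plane, in the frame `g`. -/
noncomputable def toRhomb (g : Placement) (t : LatticeRhomb) : Rhomb :=
  ⟨t.kind, g.sub t.pos.val t.dir⟩

/-- The coefficients of the corners. -/
def corner (t : LatticeRhomb) (i : Fin 4) : Coeffs :=
  t.pos + Coeffs.rot t.dir (t.kind.latticeCorner i)

lemma toRhomb_corner (g : Placement) (t : LatticeRhomb) (i : Fin 4) :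
    (t.toRhomb g).corner i = g.map (t.corner i).val := by
  rw [Rhomb.corner, toRhomb, Placement.map_sub_apply, corner, Coeffs.val_add, Coeffs.val_rot,
    RhombKind.val_latticeCorner]

/-- The position of `u` when `t` serves as the frame. -/
def comp (t u : LatticeRhomb) : LatticeRhomb :=
  ⟨u.kind, t.pos + Coeffs.rot t.dir u.pos, (t.dir + u.dir) % 10⟩

lemma toRhomb_comp (g : Placement) (t u : LatticeRhomb) :
    (t.comp u).toRhomb g = u.toRhomb (t.toRhomb g).place := by
  simp only [toRhomb, comp, Rhomb.mk.injEq, true_and]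
  simp only [Placement.sub, Placement.mk.injEq]
  constructor
  · rw [Coeffs.val_add, Coeffs.val_rot]
    simp [Placement.map, coe_omegaCircle]; ring
  · rw [omegaCircle_pow_mod, pow_add, mul_assoc]

/-- The rhomb of kind `κ` that can be glued to side `i` of `t`. -/
def neighbor (t : LatticeRhomb) (i : Fin 4) (κ : RhombKind) : LatticeRhomb :=
  let j := κ.glueSide (t.kind.mark i)
  let d := (t.dir + t.kind.sideDir i + 15 - κ.sideDir j) % 10
  ⟨κ, t.corner (i + 1) - Coeffs.rot d (κ.latticeCorner j), d⟩

lemma isNeighbor_neighbor (g : Placement) (t : LatticeRhomb) (i : Fin 4) (κ : RhombKind) :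
    (t.toRhomb g).IsNeighbor i ((t.neighbor i κ).toRhomb g) := by
  have h : ((t.neighbor i κ).toRhomb g).corner (κ.glueSide (t.kind.mark i)) =
      (t.toRhomb g).corner (i + 1) := by
    rw [toRhomb_corner, toRhomb_corner, corner]
    simp [neighbor]
  refine ⟨h, ?_⟩
  have h1 := ((t.neighbor i κ).toRhomb g).corner_sub (κ.glueSide (t.kind.mark i))
  have h2 := (t.toRhomb g).corner_sub i
  rw [h] at h1
  have h3 : (((t.neighbor i κ).toRhomb g).place.dir : ℂ) *
      omega ^ ((t.neighbor i κ).toRhomb g).kind.sideDir (κ.glueSide (t.kind.mark i)) =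
      -((t.toRhomb g).place.dir * omega ^ (t.toRhomb g).kind.sideDir i) := by
    simp only [toRhomb, neighbor, Placement.coe_dir_sub, omega_pow_mod]
    rw [mul_assoc, ← pow_add, Nat.sub_add_cancel, mul_assoc, ← pow_add, pow_add _ _ 15]
    · have : omega ^ 15 = -1 := by
        linear_combination (omega ^ 10 - omega ^ 5 + 1) * omega_pow_five
      rw [this]; ring
    · have : κ.sideDir (κ.glueSide (t.kind.mark i)) ≤ 15 := by
        generalize κ.glueSide (t.kind.mark i) = j
        cases κ <;> fin_cases j <;> simp [RhombKind.sideDir]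
      omega
  rw [h3, ← h2] at h1
  have h4 : ((t.neighbor i κ).toRhomb g).corner (κ.glueSide (t.kind.mark i) + 1) =
      (t.toRhomb g).corner i := by linear_combination h1
  exact h4

end LatticeRhomb

lemma Rhomb.IsNeighbor.eq {r s t : Rhomb} {i : Fin 4} (h : r.IsNeighbor i s)
    (h' : r.IsNeighbor i t) (hk : s.kind = t.kind) : s = t := by
  have hj : ∀ j : Fin 4, j ≠ j + 1 := by decide
  refine Rhomb.eq_of_corner_eq hk (hj (s.kind.glueSide (r.kind.mark i))) ?_ ?_
  · rw [h.1, hk, h'.1]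
  · rw [h.2, hk, h'.2]

namespace LatticeRhomb

/-- Two lattice rhombs clash if they share a corner and a sector of opening `π / 5` at it, but
the sector has different places in them. -/
def clash (s t : LatticeRhomb) : Bool :=
  (List.finRange 4).any fun i => (List.finRange 4).any fun j =>
    decide (s.corner i = t.corner j) &&
      (List.range (s.kind.angle i)).any fun m => (List.range (t.kind.angle j)).any fun n =>
        decide ((s.dir + s.kind.sideDir i + m) % 10 = (t.dir + t.kind.sideDir j + n) % 10) &&
          !(decide (s.kind = t.kind) && decide (i = j) && decide (m = n))

lemma _root_.isPrimitiveRoot_omega : IsPrimitiveRoot omega 10 := by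
  have h := Complex.isPrimitiveRoot_exp 10 (by norm_num)
  have : omega = Complex.exp (2 * Real.pi * Complex.I / (10 : ℕ)) := by
    rw [omega]; congr 1; push_cast; ring
  rwa [this]

lemma _root_.RhombKind.angle_le (κ : RhombKind) (i : Fin 4) : κ.angle i ≤ 4 := by
  cases κ <;> fin_cases i <;> simp [RhombKind.angle]

lemma not_mem_of_clash {P : Set Rhomb} (hP : IsPenroseTiling P) {g : Placement}
    {s t : LatticeRhomb} (hs : s.toRhomb g ∈ P) (ht : t.toRhomb g ∈ P) : s.clash t = false := by
  rw [Bool.eq_false_iff]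
  intro h
  simp only [clash, List.any_eq_true, Bool.and_eq_true, decide_eq_true_eq, List.mem_range,
    List.mem_finRange, true_and, Bool.not_eq_true', Bool.and_eq_false_iff,
    decide_eq_false_iff_not] at h
  obtain ⟨i, j, hc, m, hm, n, hn, hd, hne⟩ := h
  have hcor : (s.toRhomb g).corner i = (t.toRhomb g).corner j := by
    rw [toRhomb_corner, toRhomb_corner, hc]
  have hd' : omega ^ (s.dir + s.kind.sideDir i + m) = omega ^ (t.dir + t.kind.sideDir j + n) := by
    rw [← omega_pow_mod, hd, omega_pow_mod]
  have he : s.toRhomb g = t.toRhomb g := by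
    refine hP.eq_of_sector hs ht hm hn hcor ?_
    simp only [toRhomb, Placement.coe_dir_sub]
    rw [mul_assoc, mul_assoc, ← pow_add, ← pow_add, ← add_assoc, ← add_assoc, hd']
  have hk : s.kind = t.kind := congrArg Rhomb.kind he
  rw [he] at hcor
  obtain rfl := (t.toRhomb g).corner_injective hcor
  have hdir : omega ^ s.dir = omega ^ t.dir := by
    have := congrArg (fun r : Rhomb => (r.place.dir : ℂ)) he
    simpa [toRhomb, Placement.coe_dir_sub] using this
  rw [hk, pow_add, pow_add, pow_add, pow_add, hdir] at hd'
  have hmn : m = n := by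
    refine isPrimitiveRoot_omega.pow_inj ?_ ?_ (mul_left_cancel₀ ?_ hd')
    · exact (hm.trans_le (RhombKind.angle_le _ _)).trans (by norm_num)
    · exact (hn.trans_le (RhombKind.angle_le _ _)).trans (by norm_num)
    · exact mul_ne_zero (pow_ne_zero _ omega_ne_zero) (pow_ne_zero _ omega_ne_zero)
  tauto

end LatticeRhomb

/-- A deduction tree about a growing list of lattice rhombs that are known to belong to a tiling;
rhombs are referred to by their place in the list. -/
inductive Deduction where
  /-- two rhombs of the list clash -/
  | clash (m n : ℕ)
  /-- the goal is reached at rhomb `n` -/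
  | found (n : ℕ)
  /-- across side `i` of rhomb `n` there is a thin or a thick rhomb; append it to the list -/
  | split (n : ℕ) (i : Fin 4) (thin thick : Deduction)

/-- Validity of a deduction from a list of rhombs, for a given test for the goal. -/
def Deduction.check (goal : List LatticeRhomb → LatticeRhomb → Bool) :
    Deduction → List LatticeRhomb → Bool
  | .clash m n, l =>
    match l[m]?, l[n]? with
    | some s, some t => s.clash t
    | _, _ => false
  | .found n, l =>
    match l[n]? with
    | some t => goal l t
    | none => false
  | .split n i d d', l =>
    match l[n]? with
    | some t => d.check goal (l ++ [t.neighbor i .thin]) &&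
      d'.check goal (l ++ [t.neighbor i .thick])
    | none => false

lemma Deduction.check_sound {P : Set Rhomb} (hP : IsPenroseTiling P) {g : Placement}
    {goal : List LatticeRhomb → LatticeRhomb → Bool} {Q : Prop}
    (hQ : ∀ l t, (∀ u ∈ l, u.toRhomb g ∈ P) → t ∈ l → goal l t = true → Q) (d : Deduction)
    (l : List LatticeRhomb) (hl : ∀ u ∈ l, u.toRhomb g ∈ P) (h : d.check goal l = true) : Q := by
  induction d generalizing l with
  | clash m n =>
    simp only [check] at h
    split at h
    · rename_i s t hs ht
      rw [LatticeRhomb.not_mem_of_clash hP (hl _ (List.mem_of_getElem? hs))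
        (hl _ (List.mem_of_getElem? ht))] at h
      cases h
    · cases h
  | found n =>
    simp only [check] at h
    split at h
    · rename_i t ht
      exact hQ l t hl (List.mem_of_getElem? ht) h
    · cases h
  | split n i d d' ih ih' =>
    simp only [check] at h
    split at h
    · rename_i t ht
      rw [Bool.and_eq_true] at h
      obtain ⟨s, hs, hn⟩ := hP.exists_neighbor (hl _ (List.mem_of_getElem? ht)) i
      have hs' := hn.eq (t.isNeighbor_neighbor g i s.kind) rfl
      have hl' : ∀ u ∈ l ++ [t.neighbor i s.kind], u.toRhomb g ∈ P := by
        intro u hu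
        rcases List.mem_append.1 hu with hu | hu
        · exact hl u hu
        · rw [List.mem_singleton.1 hu, ← hs']; exact hs
      rcases hk : s.kind with _ | _ <;> rw [hk] at hl'
      · exact ih _ hl' h.1
      · exact ih' _ hl' h.2
    · cases h

/-- The rhombs, in the frame of a thick rhomb, whose tiles form the corona number `k` of its
`A` tile. -/
def coronaPattern : Fin 5 → List LatticeRhomb :=
  ![[⟨.thick, (0, 0, 0, 0), 0⟩, ⟨.thick, (0, -1, 0, 0), 1⟩, ⟨.thick, (0, 0, 1, 1), 8⟩,
      ⟨.thin, (0, 0, 0, 0), 2⟩, ⟨.thin, (2, -1, 1, -1), 4⟩],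
    [⟨.thick, (0, 0, 0, 0), 0⟩, ⟨.thick, (0, 0, 1, 1), 8⟩, ⟨.thin, (0, 0, 0, 0), 2⟩,
      ⟨.thin, (2, -1, 1, -1), 4⟩, ⟨.thin, (-1, 1, -1, 2), 8⟩],
    [⟨.thick, (0, 0, 0, 0), 0⟩, ⟨.thick, (0, 0, 0, 0), 8⟩, ⟨.thick, (0, 0, 1, 1), 8⟩,
      ⟨.thin, (0, 0, 0, 0), 2⟩, ⟨.thin, (-1, 1, -1, 2), 8⟩],
    [⟨.thick, (0, 0, 0, 0), 0⟩, ⟨.thick, (0, 0, 0, 0), 2⟩, ⟨.thin, (2, -1, 1, -1), 4⟩,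
      ⟨.thin, (1, 1, 1, 0), 5⟩],
    [⟨.thick, (0, 0, 0, 0), 0⟩, ⟨.thick, (0, 0, 0, 0), 2⟩, ⟨.thick, (0, 0, 0, 0), 8⟩,
      ⟨.thin, (1, 1, 1, 0), 5⟩]]

/-- The rhombs of the pattern number `k` around `r` belong to `P`. -/
def HasPattern (P : Set Rhomb) (r : Rhomb) (k : Fin 5) : Prop :=
  ∀ u ∈ coronaPattern k, u.toRhomb r.place ∈ P

/-- The pattern number `k` around `t` is contained in the list. -/
def patternGoal (k : Fin 5) (l : List LatticeRhomb) (t : LatticeRhomb) : Bool :=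
  (coronaPattern k).all fun u => decide (t.comp u ∈ l)

lemma HasPattern.of_patternGoal {P : Set Rhomb} {g : Placement} {k : Fin 5}
    {l : List LatticeRhomb} {t : LatticeRhomb} (hl : ∀ u ∈ l, u.toRhomb g ∈ P)
    (h : patternGoal k l t = true) : HasPattern P (t.toRhomb g) k := by
  intro u hu
  rw [← LatticeRhomb.toRhomb_comp]
  simp only [patternGoal, List.all_eq_true, decide_eq_true_eq] at h
  exact hl _ (h u hu)

/-- The reference thick rhomb. -/
def thickOrigin : LatticeRhomb := ⟨.thick, (0, 0, 0, 0), 0⟩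

lemma toRhomb_thickOrigin (r : Rhomb) (hr : r.kind = .thick) :
    thickOrigin.toRhomb r.place = r := by
  cases r with | mk κ g =>
  obtain rfl : κ = .thick := hr
  simp [thickOrigin, LatticeRhomb.toRhomb, Coeffs.val, Placement.sub, Placement.map]

/-! ### The patterns around thick rhombs -/

/-- Around every thin rhomb there is a thick one. -/
def Deduction.existsThick : Deduction :=
  .split 0 3 (.split 0 2 (.clash 2 1) (.found 2)) (.found 1)

/-- Around every thick rhomb one finds one of the five patterns. -/
def Deduction.classify : Deduction :=
  .split 0 2 (.split 0 3 (.split 2 1 (.clash 3 0) (.clash 3 1)) (.split 0 0 (.found 0) (.found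
  0))) (.split 0 3 (.split 2 3 (.split 0 0 (.found 0) (.found 0)) (.split 3 0 (.split 0 0
  (.clash 5 4) (.clash 5 4)) (.split 0 0 (.found 0) (.clash 5 4)))) (.split 1 0 (.clash 3 2)
  (.clash 3 2)))

/-- Near every thick rhomb one finds the pattern number `0`. -/
def Deduction.reachFirst : Deduction :=
  .split 0 0 (.split 1 0 (.clash 2 0) (.split 1 2 (.split 1 3 (.clash 4 3) (.split 2 0 (.found
  2) (.split 4 0 (.clash 6 5) (.clash 6 5)))) (.split 3 3 (.split 0 3 (.clash 5 4) (.clash 5 4))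
  (.split 0 3 (.split 5 1 (.clash 6 0) (.found 0)) (.clash 5 4))))) (.split 0 1 (.split 1 2
  (.split 2 0 (.split 2 1 (.clash 5 4) (.clash 5 4)) (.split 2 1 (.clash 5 4) (.found 4)))
  (.split 2 0 (.clash 4 3) (.clash 4 3))) (.split 2 3 (.clash 3 1) (.clash 3 1)))

/-- Near every pattern number `0` one finds the pattern number `3`. -/
def Deduction.firstToFourth : Deduction :=
  .split 1 0 (.clash 5 4) (.split 4 0 (.clash 6 0) (.split 5 0 (.found 5) (.split 5 1 (.split 8
  1 (.split 8 0 (.clash 10 9) (.clash 10 9)) (.split 6 1 (.split 2 3 (.split 11 1 (.clash 12 2)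
  (.clash 12 10)) (.found 2)) (.split 6 0 (.split 9 3 (.split 12 3 (.split 11 2 (.split 13 0
  (.clash 15 14) (.clash 15 14)) (.clash 14 12)) (.clash 13 11)) (.split 9 2 (.found 9) (.split
  13 0 (.clash 14 12) (.clash 14 12)))) (.split 10 3 (.clash 12 11) (.clash 12 11))))) (.split 8
  3 (.clash 9 7) (.clash 9 7)))))

/-- Near every pattern number `0` one finds the pattern number `4`. -/
def Deduction.firstToFifth : Deduction :=
  .split 1 0 (.clash 5 4) (.split 5 0 (.split 6 0 (.clash 7 5) (.split 4 3 (.clash 8 7) (.split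
  6 2 (.split 6 3 (.clash 10 9) (.split 9 0 (.split 9 1 (.clash 12 11) (.clash 12 11)) (.split 9
  1 (.clash 12 11) (.split 7 0 (.split 10 0 (.clash 14 13) (.split 10 3 (.split 12 3 (.clash 16
  15) (.clash 16 15)) (.found 10))) (.split 8 3 (.clash 14 13) (.clash 14 13)))))) (.split 9 3
  (.clash 10 1) (.clash 10 1))))) (.found 5))

/-- Near every pattern number `3` one finds the pattern number `2`. -/
def Deduction.fourthToThird : Deduction :=
  .split 2 2 (.split 4 0 (.split 4 1 (.clash 6 5) (.clash 6 5)) (.split 4 1 (.clash 6 5) (.split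
  5 0 (.split 7 2 (.split 8 1 (.clash 9 1) (.found 1)) (.clash 8 1)) (.found 5)))) (.split 4 3
  (.clash 5 1) (.clash 5 1))

/-- Near every pattern number `3` one finds the pattern number `1`. -/
def Deduction.fourthToSecond : Deduction :=
  .split 2 2 (.split 4 0 (.split 4 1 (.clash 6 5) (.clash 6 5)) (.split 4 1 (.clash 6 5) (.split
  5 0 (.found 5) (.split 7 2 (.split 8 1 (.split 8 0 (.clash 10 9) (.clash 10 9)) (.split 9 3
  (.split 10 2 (.clash 11 6) (.split 8 0 (.clash 12 9) (.split 10 1 (.clash 13 9) (.split 1 2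
  (.split 7 1 (.split 13 3 (.split 16 1 (.clash 17 13) (.split 12 1 (.clash 18 17) (.split 12 0
  (.found 12) (.split 18 3 (.clash 20 19) (.clash 20 19))))) (.split 11 3 (.clash 17 16) (.clash
  17 16))) (.split 14 1 (.clash 16 15) (.clash 16 15))) (.split 14 0 (.clash 15 7) (.clash 15
  7)))))) (.clash 10 5))) (.split 8 0 (.clash 9 5) (.clash 9 5)))))) (.split 4 3 (.clash 5 1)
  (.clash 5 1))

/-- The goal of `Deduction.classify`. -/
def classifyGoal (l : List LatticeRhomb) (t : LatticeRhomb) : Bool :=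
  decide (t = thickOrigin) && (List.finRange 5).any fun k => patternGoal k l t

namespace IsPenroseTiling

variable {P : Set Rhomb}

theorem hasPattern_of_thick (hP : IsPenroseTiling P) {r : Rhomb} (hr : r ∈ P)
    (hk : r.kind = .thick) : ∃ k, HasPattern P r k := by
  refine Deduction.classify.check_sound hP (g := r.place) (goal := classifyGoal) ?_ [thickOrigin]
    ?_ (by decide +kernel)
  · intro l t hl _ h
    simp only [classifyGoal, Bool.and_eq_true, decide_eq_true_eq, List.any_eq_true,
      List.mem_finRange, true_and] at h
    obtain ⟨rfl, k, h⟩ := h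
    refine ⟨k, ?_⟩
    have := HasPattern.of_patternGoal hl h
    rwa [toRhomb_thickOrigin r hk] at this
  · simpa [toRhomb_thickOrigin r hk] using hr

lemma exists_thick (hP : IsPenroseTiling P) : ∃ r ∈ P, r.kind = .thick := by
  have h0 : (0 : ℂ) ∈ ⋃ r ∈ P, r.carrier := by rw [hP.cover]; trivial
  simp only [Set.mem_iUnion] at h0
  obtain ⟨r, hr, -⟩ := h0
  rcases hk : r.kind with _ | _
  · refine Deduction.existsThick.check_sound hP (g := r.place)
      (goal := fun _ t => decide (t.kind = .thick)) ?_ [⟨.thin, (0, 0, 0, 0), 0⟩] ?_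
      (by decide +kernel)
    · intro l t hl ht h
      exact ⟨_, hl t ht, of_decide_eq_true h⟩
    · have : LatticeRhomb.toRhomb r.place ⟨.thin, (0, 0, 0, 0), 0⟩ = r := by
        cases r with | mk κ g =>
        obtain rfl : κ = .thin := hk
        simp [LatticeRhomb.toRhomb, Coeffs.val, Placement.sub, Placement.map]
      simpa [this] using hr
  · exact ⟨r, hr, hk⟩

/-- A deduction that leads from the pattern number `j` to the pattern number `k`. -/
lemma hasPattern_of_check (hP : IsPenroseTiling P) {l : List LatticeRhomb} {k : Fin 5}
    (d : Deduction) {g : Placement} (hl : ∀ u ∈ l, u.toRhomb g ∈ P)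
    (h : d.check (fun l t => decide (t.kind = .thick) && patternGoal k l t) l = true) :
    ∃ r ∈ P, r.kind = .thick ∧ HasPattern P r k := by
  refine d.check_sound hP ?_ l hl h
  intro l t hl ht h
  rw [Bool.and_eq_true] at h
  exact ⟨_, hl t ht, of_decide_eq_true h.1, HasPattern.of_patternGoal hl h.2⟩

theorem exists_hasPattern (hP : IsPenroseTiling P) (k : Fin 5) :
    ∃ r ∈ P, r.kind = .thick ∧ HasPattern P r k := by
  obtain ⟨r, hr, hk⟩ := hP.exists_thick
  have h0 : ∃ r ∈ P, r.kind = .thick ∧ HasPattern P r 0 :=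
    hP.hasPattern_of_check .reachFirst (l := [thickOrigin]) (g := r.place)
      (by simpa [toRhomb_thickOrigin r hk] using hr) (by decide +kernel)
  obtain ⟨r0, -, -, hp0⟩ := id h0
  have h3 : ∃ r ∈ P, r.kind = .thick ∧ HasPattern P r 3 :=
    hP.hasPattern_of_check .firstToFourth hp0 (by decide +kernel)
  obtain ⟨r3, -, -, hp3⟩ := id h3
  fin_cases k
  · exact h0
  · exact hP.hasPattern_of_check .fourthToSecond hp3 (by decide +kernel)
  · exact hP.hasPattern_of_check .fourthToThird hp3 (by decide +kernel)
  · exact h3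
  · exact hP.hasPattern_of_check .firstToFifth hp0 (by decide +kernel)

end IsPenroseTiling

/-! ### Orientation of the triangles of the recomposition

The lemmas `IsAdmissible.cross_XYZ` say that the points `X`, `Y`, `Z` are the corners of a
triangle in counterclockwise order. The points are named as follows: `O` is `0` (the corner `A`
or `E`), `I` is `1` (`B` or `F`), `C` and `D` are `1 + omega` and `omega`, `G` and `H` are
`1 + omega ^ 2` and `omega ^ 2`, `Q` is `q` (also the point `R` of the thick rhomb), and `S` is
`refS q`. The remaining letters are the apices of the triangles that the prototiles have outside
of the rhomb: `R` is the apex `omega ^ 2 * q` for the prototile `A`, `U` and `V` are the apices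
`1 + omega - omega * q` and `1 + omega - omega⁻¹ * q` for the prototile `B`, and `W` is the apex
`1 + omega * q` for the prototile `C`.

In barycentric coordinates `c`, `a`, `b` of `q` with respect to `A`, `B`, `D`, and with the number
`t = φ - 1`, each of these determinants becomes a polynomial without negative coefficients. -/

/-- The point with coordinates `x`, `y` in the basis `1`, `omega`. -/
noncomputable def lin (x y : ℝ) : ℂ := x + y * omega

lemma cross_lin (x y x' y' x'' y'' : ℝ) : cross (lin x y) (lin x' y') (lin x'' y'') =
    sinFifth * ((x' - x) * (y'' - y) - (y' - y) * (x'' - x)) := by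
  simp [cross, lin, omega_re, omega_im]; ring

lemma lin_zero : (0 : ℂ) = lin 0 0 := by simp [lin]

lemma lin_one : (1 : ℂ) = lin 1 0 := by simp [lin]

lemma omega_eq_lin : omega = lin 0 1 := by simp [lin]

lemma one_add_omega_eq_lin : 1 + omega = lin 1 1 := by simp [lin]

lemma omega_sq_eq_lin : omega ^ 2 = lin (-1) φ := by simp [lin]; linear_combination omega_sq

lemma one_add_omega_sq_eq_lin : 1 + omega ^ 2 = lin 0 φ := by
  simp [lin]; linear_combination omega_sq

lemma refS_lin (a b : ℝ) : refS (lin a b) = lin (-1 + φ * a + b) (φ - a) := by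
  simp [lin, refS, omega_inv]
  linear_combination (1 - b : ℂ) * omega_sq

lemma omega_sq_mul_lin (a b : ℝ) :
    omega ^ 2 * lin a b = lin (-a - φ * b) (φ * a + φ * b) := by
  simp [lin]
  linear_combination (a : ℂ) * omega_sq + (b : ℂ) * omega_pow_three

lemma thinApex_lin (a b : ℝ) :
    1 + omega - omega * lin a b = lin (1 + b) (1 - a - φ * b) := by
  simp [lin]
  linear_combination -(b : ℂ) * omega_sq

lemma thinApex_lin' (a b : ℝ) :
    1 + omega - omega⁻¹ * lin a b = lin (1 - b - φ * a) (1 + a) := by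
  simp [lin, omega_inv]
  linear_combination (b : ℂ) * omega_sq

lemma thickApex_lin (a b : ℝ) : 1 + omega * lin a b = lin (1 - b) (a + φ * b) := by
  simp [lin]
  linear_combination (b : ℂ) * omega_sq

lemma exists_gold_eq : ∃ t : ℝ, 0 < t ∧ φ = 1 + t ∧ t ^ 2 = 1 - t :=
  ⟨φ - 1, by linarith [phi_gt], by ring, by linear_combination gold_sq⟩

/-- An admissible point lies in the triangle `ABD`; `b`, `a`, `c` are its barycentric
coordinates with respect to `D`, `B`, `A`. -/
lemma IsAdmissible.exists_lin {q : ℂ} (h : IsAdmissible q) :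
    ∃ a b c : ℝ, 0 < a ∧ 0 < b ∧ 0 < c ∧ a + b + c = 1 ∧ q = lin a b := by
  obtain ⟨h1, h2⟩ := h
  obtain ⟨a, b, rfl⟩ := RhombKind.thin.exists_chart q
  obtain ⟨⟨ha0, ha1⟩, hb0, hb1⟩ := (RhombKind.thin.chart_mem_interior a b).1 h1
  refine ⟨a, b, 1 - a - b, ha0, hb0, ?_, by ring, rfl⟩
  have hp := phi_gt
  have hs := sinFifth_sq
  rw [Complex.dist_eq, Complex.dist_eq, ← sq_lt_sq₀ (norm_nonneg _) (norm_nonneg _),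
    Complex.sq_norm, Complex.sq_norm, RhombKind.chart_apply] at h2
  simp [RhombKind.refCorner, RhombKind.tau, Complex.normSq_apply, omega_re, omega_im] at h2
  by_contra hcon
  have h3 : (2 + φ) * (1 - a - b) ≤ 0 :=
    mul_nonpos_of_nonneg_of_nonpos (by linarith) (by linarith)
  nlinarith

lemma IsAdmissible.cross_OQS {q : ℂ} (h : IsAdmissible q) :
    0 < cross 0 q (refS q) := by
  obtain ⟨a, b, c, ha, hb, hc, habc, rfl⟩ := h.exists_lin
  obtain ⟨t, ht, hφ, ht2⟩ := exists_gold_eq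
  have key : 0 < sinFifth * (t * (a ^ 2) + a * b + (1 + t) * (a * c) + b * c) := by
    have := sinFifth_pos
    positivity
  refine key.trans_eq ?_
  rw [refS_lin, lin_zero, cross_lin, hφ]
  obtain rfl : c = 1 - a - b := by linarith
  ring

lemma IsAdmissible.cross_OQH {q : ℂ} (h : IsAdmissible q) :
    0 < cross 0 q (omega ^ 2) := by
  obtain ⟨a, b, c, ha, hb, hc, habc, rfl⟩ := h.exists_lin
  obtain ⟨t, ht, hφ, ht2⟩ := exists_gold_eq
  have key : 0 < sinFifth * ((1 + t) * (a ^ 2) + (2 + t) * (a * b) + (1 + t) * (a * c) + b ^ 2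
      + b * c) := by
    have := sinFifth_pos
    positivity
  refine key.trans_eq ?_
  rw [omega_sq_eq_lin, lin_zero, cross_lin, hφ]
  obtain rfl : c = 1 - a - b := by linarith
  ring

lemma IsAdmissible.cross_OQR {q : ℂ} (h : IsAdmissible q) :
    0 < cross 0 q (omega ^ 2 * q) := by
  obtain ⟨a, b, c, ha, hb, hc, habc, rfl⟩ := h.exists_lin
  obtain ⟨t, ht, hφ, ht2⟩ := exists_gold_eq
  have key : 0 < sinFifth * ((1 + t) * (a ^ 2) + (2 + t) * (a * b) + (1 + t) * (b ^ 2)) := by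
    have := sinFifth_pos
    positivity
  refine key.trans_eq ?_
  rw [omega_sq_mul_lin, lin_zero, cross_lin, hφ]
  obtain rfl : c = 1 - a - b := by linarith
  ring

lemma IsAdmissible.cross_OSH {q : ℂ} (h : IsAdmissible q) :
    0 < cross 0 (refS q) (omega ^ 2) := by
  obtain ⟨a, b, c, ha, hb, hc, habc, rfl⟩ := h.exists_lin
  obtain ⟨t, ht, hφ, ht2⟩ := exists_gold_eq
  have key : 0 < sinFifth * ((1 + t) * (a ^ 2) + (2 + 2 * t) * (a * b) + (1 + t) * (a * c) + (1
      + t) * (b ^ 2) + (1 + t) * (b * c)) := by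
    have := sinFifth_pos
    positivity
  refine key.trans_eq ?_
  rw [refS_lin, omega_sq_eq_lin, lin_zero, cross_lin, hφ]
  obtain rfl : c = 1 - a - b := by linarith
  linear_combination -(sinFifth * ((a ^ 2) + (a * b) + (a * (1 - a - b)))) * ht2

lemma IsAdmissible.cross_OSR {q : ℂ} (h : IsAdmissible q) :
    0 < cross 0 (refS q) (omega ^ 2 * q) := by
  obtain ⟨a, b, c, ha, hb, hc, habc, rfl⟩ := h.exists_lin
  obtain ⟨t, ht, hφ, ht2⟩ := exists_gold_eq
  have key : 0 < sinFifth * ((1 + t) * (a ^ 2) + (3 + t) * (a * b) + (2 + t) * (b ^ 2)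
      + b * c) := by
    have := sinFifth_pos
    positivity
  refine key.trans_eq ?_
  rw [omega_sq_mul_lin, refS_lin, lin_zero, cross_lin, hφ]
  obtain rfl : c = 1 - a - b := by linarith
  linear_combination -(sinFifth * ((a ^ 2) + (2) * (a * b) + (b ^ 2) + (b * (1 - a - b)))) * ht2

lemma IsAdmissible.cross_OHR {q : ℂ} (h : IsAdmissible q) :
    0 < cross 0 (omega ^ 2) (omega ^ 2 * q) := by
  obtain ⟨a, b, c, ha, hb, hc, habc, rfl⟩ := h.exists_lin
  obtain ⟨t, ht, hφ, ht2⟩ := exists_gold_eq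
  have key : 0 < sinFifth * (a * b + b ^ 2 + b * c) := by
    have := sinFifth_pos
    positivity
  refine key.trans_eq ?_
  rw [omega_sq_mul_lin, omega_sq_eq_lin, lin_zero, cross_lin, hφ]
  obtain rfl : c = 1 - a - b := by linarith
  linear_combination -(sinFifth * ((a * b) + (b ^ 2) + (b * (1 - a - b)))) * ht2

lemma IsAdmissible.cross_QSH {q : ℂ} (h : IsAdmissible q) :
    0 < cross q (refS q) (omega ^ 2) := by
  obtain ⟨a, b, c, ha, hb, hc, habc, rfl⟩ := h.exists_lin
  obtain ⟨t, ht, hφ, ht2⟩ := exists_gold_eq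
  have key : 0 < sinFifth * (t * (a ^ 2) + (1 + t) * (a * b) + (1 + t) * (a * c) + t * (b ^ 2)
      + (1 + t) * (b * c)) := by
    have := sinFifth_pos
    positivity
  refine key.trans_eq ?_
  rw [refS_lin, omega_sq_eq_lin, cross_lin, hφ]
  obtain rfl : c = 1 - a - b := by linarith
  linear_combination -(sinFifth * ((a ^ 2) + (a * b) + (a * (1 - a - b)))) * ht2

lemma IsAdmissible.cross_QSR {q : ℂ} (h : IsAdmissible q) :
    0 < cross q (refS q) (omega ^ 2 * q) := by
  obtain ⟨a, b, c, ha, hb, hc, habc, rfl⟩ := h.exists_lin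
  obtain ⟨t, ht, hφ, ht2⟩ := exists_gold_eq
  have key : 0 < sinFifth * (t * (a ^ 2) + 2 * (a * b) + (1 + t) * (a * c) + b ^ 2
      + 2 * (b * c)) := by
    have := sinFifth_pos
    positivity
  refine key.trans_eq ?_
  rw [omega_sq_mul_lin, refS_lin, cross_lin, hφ]
  obtain rfl : c = 1 - a - b := by linarith
  linear_combination -(sinFifth * ((a ^ 2) + (2) * (a * b) + (b ^ 2) + (b * (1 - a - b)))) * ht2

lemma IsAdmissible.cross_QHR {q : ℂ} (h : IsAdmissible q) :
    0 < cross q (omega ^ 2) (omega ^ 2 * q) := by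
  obtain ⟨a, b, c, ha, hb, hc, habc, rfl⟩ := h.exists_lin
  obtain ⟨t, ht, hφ, ht2⟩ := exists_gold_eq
  have key : 0 < sinFifth * (a * b + (1 + t) * (a * c) + t ^ 2 * (b ^ 2) + 2 * (b * c)) := by
    have := sinFifth_pos
    positivity
  refine key.trans_eq ?_
  rw [omega_sq_mul_lin, omega_sq_eq_lin, cross_lin, hφ]
  obtain rfl : c = 1 - a - b := by linarith
  linear_combination -(sinFifth * ((a * b) + (b * (1 - a - b)))) * ht2

lemma IsAdmissible.cross_SHR {q : ℂ} (h : IsAdmissible q) :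
    0 < cross (refS q) (omega ^ 2) (omega ^ 2 * q) := by
  obtain ⟨a, b, c, ha, hb, hc, habc, rfl⟩ := h.exists_lin
  obtain ⟨t, ht, hφ, ht2⟩ := exists_gold_eq
  have key : 0 < sinFifth * (t * (a * b) + (1 + t) * (a * c) + (1 + t) * (b * c)) := by
    have := sinFifth_pos
    positivity
  refine key.trans_eq ?_
  rw [omega_sq_mul_lin, refS_lin, omega_sq_eq_lin, cross_lin, hφ]
  obtain rfl : c = 1 - a - b := by linarith
  linear_combination -(sinFifth * ((a * (1 - a - b)))) * ht2

lemma IsAdmissible.cross_CVD {q : ℂ} (h : IsAdmissible q) :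
    0 < cross (1 + omega) (1 + omega - omega⁻¹ * q) omega := by
  obtain ⟨a, b, c, ha, hb, hc, habc, rfl⟩ := h.exists_lin
  obtain ⟨t, ht, hφ, ht2⟩ := exists_gold_eq
  have key : 0 < sinFifth * (a ^ 2 + a * b + a * c) := by
    have := sinFifth_pos
    positivity
  refine key.trans_eq ?_
  rw [thinApex_lin', one_add_omega_eq_lin, omega_eq_lin, cross_lin, hφ]
  obtain rfl : c = 1 - a - b := by linarith
  ring

lemma IsAdmissible.cross_CVQ {q : ℂ} (h : IsAdmissible q) :
    0 < cross (1 + omega) (1 + omega - omega⁻¹ * q) q := by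
  obtain ⟨a, b, c, ha, hb, hc, habc, rfl⟩ := h.exists_lin
  obtain ⟨t, ht, hφ, ht2⟩ := exists_gold_eq
  have key : 0 < sinFifth * ((1 + t) * (a ^ 2) + 2 * (a * b) + (2 + t) * (a * c) + b * c) := by
    have := sinFifth_pos
    positivity
  refine key.trans_eq ?_
  rw [thinApex_lin', one_add_omega_eq_lin, cross_lin, hφ]
  obtain rfl : c = 1 - a - b := by linarith
  ring

lemma IsAdmissible.cross_CVI {q : ℂ} (h : IsAdmissible q) :
    0 < cross (1 + omega) (1 + omega - omega⁻¹ * q) 1 := by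
  obtain ⟨a, b, c, ha, hb, hc, habc, rfl⟩ := h.exists_lin
  obtain ⟨t, ht, hφ, ht2⟩ := exists_gold_eq
  have key : 0 < sinFifth * ((1 + t) * (a ^ 2) + (2 + t) * (a * b) + (1 + t) * (a * c) + b ^ 2
      + b * c) := by
    have := sinFifth_pos
    positivity
  refine key.trans_eq ?_
  rw [thinApex_lin', one_add_omega_eq_lin, lin_one, cross_lin, hφ]
  obtain rfl : c = 1 - a - b := by linarith
  ring

lemma IsAdmissible.cross_CVU {q : ℂ} (h : IsAdmissible q) :
    0 < cross (1 + omega) (1 + omega - omega⁻¹ * q) (1 + omega - omega * q) := by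
  obtain ⟨a, b, c, ha, hb, hc, habc, rfl⟩ := h.exists_lin
  obtain ⟨t, ht, hφ, ht2⟩ := exists_gold_eq
  have key : 0 < sinFifth * ((1 + t) * (a ^ 2) + (2 + t) * (a * b) + (1 + t) * (b ^ 2)) := by
    have := sinFifth_pos
    positivity
  refine key.trans_eq ?_
  rw [thinApex_lin', thinApex_lin, one_add_omega_eq_lin, cross_lin, hφ]
  obtain rfl : c = 1 - a - b := by linarith
  linear_combination -(sinFifth * ((a * b))) * ht2

lemma IsAdmissible.cross_CDQ {q : ℂ} (h : IsAdmissible q) :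
    0 < cross (1 + omega) omega q := by
  obtain ⟨a, b, c, ha, hb, hc, habc, rfl⟩ := h.exists_lin
  have key : 0 < sinFifth * (a ^ 2 + a * b + 2 * (a * c) + b * c + c ^ 2) := by
    have := sinFifth_pos
    positivity
  refine key.trans_eq ?_
  rw [one_add_omega_eq_lin, omega_eq_lin, cross_lin]
  obtain rfl : c = 1 - a - b := by linarith
  ring

lemma IsAdmissible.cross_CDU {q : ℂ} (h : IsAdmissible q) :
    0 < cross (1 + omega) omega (1 + omega - omega * q) := by
  obtain ⟨a, b, c, ha, hb, hc, habc, rfl⟩ := h.exists_lin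
  obtain ⟨t, ht, hφ, ht2⟩ := exists_gold_eq
  have key : 0 < sinFifth * (a ^ 2 + (2 + t) * (a * b) + a * c + (1 + t) * (b ^ 2) + (1
      + t) * (b * c)) := by
    have := sinFifth_pos
    positivity
  refine key.trans_eq ?_
  rw [thinApex_lin, one_add_omega_eq_lin, omega_eq_lin, cross_lin, hφ]
  obtain rfl : c = 1 - a - b := by linarith
  ring

lemma IsAdmissible.cross_CQI {q : ℂ} (h : IsAdmissible q) :
    0 < cross (1 + omega) q 1 := by
  obtain ⟨a, b, c, ha, hb, hc, habc, rfl⟩ := h.exists_lin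
  have key : 0 < sinFifth * (a * b + a * c + b ^ 2 + 2 * (b * c) + c ^ 2) := by
    have := sinFifth_pos
    positivity
  refine key.trans_eq ?_
  rw [one_add_omega_eq_lin, lin_one, cross_lin]
  obtain rfl : c = 1 - a - b := by linarith
  ring

lemma IsAdmissible.cross_CQU {q : ℂ} (h : IsAdmissible q) :
    0 < cross (1 + omega) q (1 + omega - omega * q) := by
  obtain ⟨a, b, c, ha, hb, hc, habc, rfl⟩ := h.exists_lin
  obtain ⟨t, ht, hφ, ht2⟩ := exists_gold_eq
  have key : 0 < sinFifth * (2 * (a * b) + a * c + (1 + t) * (b ^ 2) + (2 + t) * (b * c)) := by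
    have := sinFifth_pos
    positivity
  refine key.trans_eq ?_
  rw [thinApex_lin, one_add_omega_eq_lin, cross_lin, hφ]
  obtain rfl : c = 1 - a - b := by linarith
  ring

lemma IsAdmissible.cross_CIU {q : ℂ} (h : IsAdmissible q) :
    0 < cross (1 + omega) 1 (1 + omega - omega * q) := by
  obtain ⟨a, b, c, ha, hb, hc, habc, rfl⟩ := h.exists_lin
  obtain ⟨t, ht, hφ, ht2⟩ := exists_gold_eq
  have key : 0 < sinFifth * (a * b + b ^ 2 + b * c) := by
    have := sinFifth_pos
    positivity
  refine key.trans_eq ?_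
  rw [thinApex_lin, one_add_omega_eq_lin, lin_one, cross_lin, hφ]
  obtain rfl : c = 1 - a - b := by linarith
  ring

lemma IsAdmissible.cross_VDQ {q : ℂ} (h : IsAdmissible q) :
    0 < cross (1 + omega - omega⁻¹ * q) omega q := by
  obtain ⟨a, b, c, ha, hb, hc, habc, rfl⟩ := h.exists_lin
  obtain ⟨t, ht, hφ, ht2⟩ := exists_gold_eq
  have key : 0 < sinFifth * (t ^ 2 * (a ^ 2) + t ^ 2 * (a * c) + c ^ 2) := by
    have := sinFifth_pos
    positivity
  refine key.trans_eq ?_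
  rw [thinApex_lin', omega_eq_lin, cross_lin, hφ]
  obtain rfl : c = 1 - a - b := by linarith
  linear_combination -(sinFifth * ((-1) * (a ^ 2) + (-1) * (a * (1 - a - b)))) * ht2

lemma IsAdmissible.cross_VDI {q : ℂ} (h : IsAdmissible q) :
    0 < cross (1 + omega - omega⁻¹ * q) omega 1 := by
  obtain ⟨a, b, c, ha, hb, hc, habc, rfl⟩ := h.exists_lin
  obtain ⟨t, ht, hφ, ht2⟩ := exists_gold_eq
  have key : 0 < sinFifth * (t ^ 2 * (a ^ 2) + t ^ 2 * (a * b) + (1 + t ^ 2) * (a * c) + b * c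
      + c ^ 2) := by
    have := sinFifth_pos
    positivity
  refine key.trans_eq ?_
  rw [thinApex_lin', omega_eq_lin, lin_one, cross_lin, hφ]
  obtain rfl : c = 1 - a - b := by linarith
  linear_combination -(sinFifth * ((-1) * (a ^ 2) + (-1) * (a * b)
    + (-1) * (a * (1 - a - b)))) * ht2

lemma IsAdmissible.cross_VDU {q : ℂ} (h : IsAdmissible q) :
    0 < cross (1 + omega - omega⁻¹ * q) omega (1 + omega - omega * q) := by
  obtain ⟨a, b, c, ha, hb, hc, habc, rfl⟩ := h.exists_lin
  obtain ⟨t, ht, hφ, ht2⟩ := exists_gold_eq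
  have key : 0 < sinFifth * (t ^ 2 * (a ^ 2) + a * b + 2 * (a * c) + (1 + t) * (b * c)) := by
    have := sinFifth_pos
    positivity
  refine key.trans_eq ?_
  rw [thinApex_lin', thinApex_lin, omega_eq_lin, cross_lin, hφ]
  obtain rfl : c = 1 - a - b := by linarith
  linear_combination -(sinFifth * ((-1) * (a ^ 2) + (-1) * (a * b))) * ht2

lemma IsAdmissible.cross_VQI {q : ℂ} (h : IsAdmissible q) :
    0 < cross (1 + omega - omega⁻¹ * q) q 1 := by
  obtain ⟨a, b, c, ha, hb, hc, habc, rfl⟩ := h.exists_lin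
  obtain ⟨t, ht, hφ, ht2⟩ := exists_gold_eq
  have key : 0 < sinFifth * (t ^ 2 * (a * b) + 2 * (a * c) + 2 * (b * c) + c ^ 2) := by
    have := sinFifth_pos
    positivity
  refine key.trans_eq ?_
  rw [thinApex_lin', lin_one, cross_lin, hφ]
  obtain rfl : c = 1 - a - b := by linarith
  linear_combination -(sinFifth * ((-1) * (a * b))) * ht2

lemma IsAdmissible.cross_VIU {q : ℂ} (h : IsAdmissible q) :
    0 < cross (1 + omega - omega⁻¹ * q) 1 (1 + omega - omega * q) := by
  obtain ⟨a, b, c, ha, hb, hc, habc, rfl⟩ := h.exists_lin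
  obtain ⟨t, ht, hφ, ht2⟩ := exists_gold_eq
  have key : 0 < sinFifth * (a * b + (1 + t) * (a * c) + t ^ 2 * (b ^ 2) + 2 * (b * c)) := by
    have := sinFifth_pos
    positivity
  refine key.trans_eq ?_
  rw [thinApex_lin', thinApex_lin, lin_one, cross_lin, hφ]
  obtain rfl : c = 1 - a - b := by linarith
  linear_combination -(sinFifth * ((-1) * (a * b) + (-1) * (b ^ 2))) * ht2

lemma IsAdmissible.cross_DQI {q : ℂ} (h : IsAdmissible q) :
    0 < cross omega q 1 := by
  obtain ⟨a, b, c, ha, hb, hc, habc, rfl⟩ := h.exists_lin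
  have key : 0 < sinFifth * (a * c + b * c + c ^ 2) := by
    have := sinFifth_pos
    positivity
  refine key.trans_eq ?_
  rw [omega_eq_lin, lin_one, cross_lin]
  obtain rfl : c = 1 - a - b := by linarith
  ring

lemma IsAdmissible.cross_DQU {q : ℂ} (h : IsAdmissible q) :
    0 < cross omega q (1 + omega - omega * q) := by
  obtain ⟨a, b, c, ha, hb, hc, habc, rfl⟩ := h.exists_lin
  obtain ⟨t, ht, hφ, ht2⟩ := exists_gold_eq
  have key : 0 < sinFifth * (t ^ 2 * (a * b) + 2 * (a * c) + 2 * (b * c) + c ^ 2) := by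
    have := sinFifth_pos
    positivity
  refine key.trans_eq ?_
  rw [thinApex_lin, omega_eq_lin, cross_lin, hφ]
  obtain rfl : c = 1 - a - b := by linarith
  linear_combination -(sinFifth * ((-1) * (a * b))) * ht2

lemma IsAdmissible.cross_DIU {q : ℂ} (h : IsAdmissible q) :
    0 < cross omega 1 (1 + omega - omega * q) := by
  obtain ⟨a, b, c, ha, hb, hc, habc, rfl⟩ := h.exists_lin
  obtain ⟨t, ht, hφ, ht2⟩ := exists_gold_eq
  have key : 0 < sinFifth * (t ^ 2 * (a * b) + a * c + t ^ 2 * (b ^ 2) + (1 + t ^ 2) * (b * c)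
      + c ^ 2) := by
    have := sinFifth_pos
    positivity
  refine key.trans_eq ?_
  rw [thinApex_lin, omega_eq_lin, lin_one, cross_lin, hφ]
  obtain rfl : c = 1 - a - b := by linarith
  linear_combination -(sinFifth * ((-1) * (a * b) + (-1) * (b ^ 2)
    + (-1) * (b * (1 - a - b)))) * ht2

lemma IsAdmissible.cross_QIU {q : ℂ} (h : IsAdmissible q) :
    0 < cross q 1 (1 + omega - omega * q) := by
  obtain ⟨a, b, c, ha, hb, hc, habc, rfl⟩ := h.exists_lin
  obtain ⟨t, ht, hφ, ht2⟩ := exists_gold_eq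
  have key : 0 < sinFifth * (t ^ 2 * (b ^ 2) + t ^ 2 * (b * c) + c ^ 2) := by
    have := sinFifth_pos
    positivity
  refine key.trans_eq ?_
  rw [thinApex_lin, lin_one, cross_lin, hφ]
  obtain rfl : c = 1 - a - b := by linarith
  linear_combination -(sinFifth * ((-1) * (b ^ 2) + (-1) * (b * (1 - a - b)))) * ht2

lemma IsAdmissible.cross_IWG {q : ℂ} (h : IsAdmissible q) :
    0 < cross 1 (1 + omega * q) (1 + omega ^ 2) := by
  obtain ⟨a, b, c, ha, hb, hc, habc, rfl⟩ := h.exists_lin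
  obtain ⟨t, ht, hφ, ht2⟩ := exists_gold_eq
  have key : 0 < sinFifth * (a ^ 2 + a * b + a * c) := by
    have := sinFifth_pos
    positivity
  refine key.trans_eq ?_
  rw [thickApex_lin, one_add_omega_sq_eq_lin, lin_one, cross_lin, hφ]
  obtain rfl : c = 1 - a - b := by linarith
  ring

lemma IsAdmissible.cross_IWS {q : ℂ} (h : IsAdmissible q) :
    0 < cross 1 (1 + omega * q) (refS q) := by
  obtain ⟨a, b, c, ha, hb, hc, habc, rfl⟩ := h.exists_lin
  obtain ⟨t, ht, hφ, ht2⟩ := exists_gold_eq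
  have key : 0 < sinFifth * (t ^ 2 * (a ^ 2) + a * b + 2 * (a * c) + (1 + t) * (b * c)) := by
    have := sinFifth_pos
    positivity
  refine key.trans_eq ?_
  rw [thickApex_lin, refS_lin, lin_one, cross_lin, hφ]
  obtain rfl : c = 1 - a - b := by linarith
  linear_combination -(sinFifth * ((-1) * (a ^ 2) + (-1) * (a * b))) * ht2

lemma IsAdmissible.cross_IGS {q : ℂ} (h : IsAdmissible q) :
    0 < cross 1 (1 + omega ^ 2) (refS q) := by
  obtain ⟨a, b, c, ha, hb, hc, habc, rfl⟩ := h.exists_lin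
  obtain ⟨t, ht, hφ, ht2⟩ := exists_gold_eq
  have key : 0 < sinFifth * ((1 + t) * (a * c) + (1 + t) * (b * c) + (1 + t) * (c ^ 2)) := by
    have := sinFifth_pos
    positivity
  refine key.trans_eq ?_
  rw [refS_lin, one_add_omega_sq_eq_lin, lin_one, cross_lin, hφ]
  obtain rfl : c = 1 - a - b := by linarith
  linear_combination -(sinFifth * ((-1) * (a ^ 2) + (-1) * (a * b)
    + (-1) * (a * (1 - a - b)))) * ht2

lemma IsAdmissible.cross_WGS {q : ℂ} (h : IsAdmissible q) :
    0 < cross (1 + omega * q) (1 + omega ^ 2) (refS q) := by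
  obtain ⟨a, b, c, ha, hb, hc, habc, rfl⟩ := h.exists_lin
  obtain ⟨t, ht, hφ, ht2⟩ := exists_gold_eq
  have key : 0 < sinFifth * (t * (a ^ 2) + t * (a * c) + (1 + t) * (c ^ 2)) := by
    have := sinFifth_pos
    positivity
  refine key.trans_eq ?_
  rw [thickApex_lin, refS_lin, one_add_omega_sq_eq_lin, cross_lin, hφ]
  obtain rfl : c = 1 - a - b := by linarith
  linear_combination -(sinFifth * ((-1) * (a ^ 2) + (-1) * (a * (1 - a - b)))) * ht2

lemma IsAdmissible.cross_ISQ {q : ℂ} (h : IsAdmissible q) :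
    0 < cross 1 (refS q) q := by
  obtain ⟨a, b, c, ha, hb, hc, habc, rfl⟩ := h.exists_lin
  obtain ⟨t, ht, hφ, ht2⟩ := exists_gold_eq
  have key : 0 < sinFifth * (t ^ 3 * (a * b) + t * (a * c) + t * (b ^ 2) + 2 * t * (b * c) + (1
      + t) * (c ^ 2)) := by
    have := sinFifth_pos
    positivity
  refine key.trans_eq ?_
  rw [refS_lin, lin_one, cross_lin, hφ]
  obtain rfl : c = 1 - a - b := by linarith
  linear_combination -(sinFifth * ((0 - (t - 1)) * (a * b))) * ht2

lemma IsAdmissible.cross_OIQ {q : ℂ} (h : IsAdmissible q) :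
    0 < cross 0 1 q := by
  obtain ⟨a, b, c, ha, hb, hc, habc, rfl⟩ := h.exists_lin
  have key : 0 < sinFifth * (a * b + b ^ 2 + b * c) := by
    have := sinFifth_pos
    positivity
  refine key.trans_eq ?_
  rw [lin_zero, lin_one, cross_lin]
  obtain rfl : c = 1 - a - b := by linarith
  ring

lemma IsAdmissible.cross_DOQ {q : ℂ} (h : IsAdmissible q) :
    0 < cross omega 0 q := by
  obtain ⟨a, b, c, ha, hb, hc, habc, rfl⟩ := h.exists_lin
  have key : 0 < sinFifth * (a ^ 2 + a * b + a * c) := by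
    have := sinFifth_pos
    positivity
  refine key.trans_eq ?_
  rw [omega_eq_lin, lin_zero, cross_lin]
  obtain rfl : c = 1 - a - b := by linarith
  ring

lemma IsAdmissible.cross_GHS {q : ℂ} (h : IsAdmissible q) :
    0 < cross (1 + omega ^ 2) (omega ^ 2) (refS q) := by
  obtain ⟨a, b, c, ha, hb, hc, habc, rfl⟩ := h.exists_lin
  obtain ⟨t, ht, hφ, ht2⟩ := exists_gold_eq
  have key : 0 < sinFifth * (a ^ 2 + a * b + a * c) := by
    have := sinFifth_pos
    positivity
  refine key.trans_eq ?_
  rw [refS_lin, one_add_omega_sq_eq_lin, omega_sq_eq_lin, cross_lin, hφ]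
  obtain rfl : c = 1 - a - b := by linarith
  ring

lemma IsAdmissible.cross_IGQ {q : ℂ} (h : IsAdmissible q) :
    0 < cross 1 (1 + omega ^ 2) q := by
  obtain ⟨a, b, c, ha, hb, hc, habc, rfl⟩ := h.exists_lin
  obtain ⟨t, ht, hφ, ht2⟩ := exists_gold_eq
  have key : 0 < sinFifth * (t * (a * b) + (1 + t) * (a * c) + t * (b ^ 2) + (1
      + 2 * t) * (b * c) + (1 + t) * (c ^ 2)) := by
    have := sinFifth_pos
    positivity
  refine key.trans_eq ?_
  rw [one_add_omega_sq_eq_lin, lin_one, cross_lin, hφ]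
  obtain rfl : c = 1 - a - b := by linarith
  ring

lemma IsAdmissible.cross_OIS {q : ℂ} (h : IsAdmissible q) :
    0 < cross 0 1 (refS q) := by
  obtain ⟨a, b, c, ha, hb, hc, habc, rfl⟩ := h.exists_lin
  obtain ⟨t, ht, hφ, ht2⟩ := exists_gold_eq
  have key : 0 < sinFifth * (t * (a ^ 2) + (1 + 2 * t) * (a * b) + (1 + 2 * t) * (a * c) + (1
      + t) * (b ^ 2) + (2 + 2 * t) * (b * c) + (1 + t) * (c ^ 2)) := by
    have := sinFifth_pos
    positivity
  refine key.trans_eq ?_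
  rw [refS_lin, lin_zero, lin_one, cross_lin, hφ]
  obtain rfl : c = 1 - a - b := by linarith
  ring

lemma IsAdmissible.cross_ISH {q : ℂ} (h : IsAdmissible q) :
    0 < cross 1 (refS q) (omega ^ 2) := by
  obtain ⟨a, b, c, ha, hb, hc, habc, rfl⟩ := h.exists_lin
  obtain ⟨t, ht, hφ, ht2⟩ := exists_gold_eq
  have key : 0 < sinFifth * (t * (a ^ 2) + (1 + 2 * t) * (a * b) + t * (a * c) + (1
      + t) * (b ^ 2) + (1 + t) * (b * c)) := by
    have := sinFifth_pos
    positivity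
  refine key.trans_eq ?_
  rw [refS_lin, omega_sq_eq_lin, lin_one, cross_lin, hφ]
  obtain rfl : c = 1 - a - b := by linarith
  linear_combination -(sinFifth * ((a ^ 2) + (a * b) + (a * (1 - a - b)))) * ht2

/-! ### Pieces of the rhombs -/

/-- The triangles into which the points `Q`, `R`, `S` cut the reference rhombs. The thin rhomb is
cut into `ABQ`, `DAQ`, `CDQ`, `CQB` (the last two entries are unused), the thick rhomb into `EFR`,
`GHS`, `ERS`, `ESH`, `FSR`, `FGS`. The first two triangles get attached to tiles across a side,
the others belong to the tiles of the rhomb itself. -/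
noncomputable def RhombKind.piece (q : ℂ) : RhombKind → Fin 6 → Set ℂ
  | .thin => ![triangle 0 1 q, triangle omega 0 q, triangle (1 + omega) omega q,
      triangle (1 + omega) q 1, ∅, ∅]
  | .thick => ![triangle 0 1 q, triangle (1 + omega ^ 2) (omega ^ 2) (refS q),
      triangle 0 q (refS q), triangle 0 (refS q) (omega ^ 2), triangle 1 (refS q) q,
      triangle 1 (1 + omega ^ 2) (refS q)]

lemma cross_nonneg_of_mem_triangle {u v x y w z : ℂ} (h1 : 0 ≤ cross u v x)
    (h2 : 0 ≤ cross u v y) (h3 : 0 ≤ cross u v w) (hz : z ∈ triangle x y w) :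
    0 ≤ cross u v z := by
  refine cross_nonneg_of_mem_hull ?_ hz
  rintro p (rfl | rfl | rfl) <;> assumption

lemma cross_nonpos_of_mem_triangle {u v x y w z : ℂ} (h1 : cross u v x ≤ 0)
    (h2 : cross u v y ≤ 0) (h3 : cross u v w ≤ 0) (hz : z ∈ triangle x y w) :
    cross u v z ≤ 0 := by
  have := cross_nonneg_of_mem_triangle (u := v) (v := u) (x := x) (y := y) (w := w) (z := z)
    (by rw [cross_swap]; linarith) (by rw [cross_swap]; linarith) (by rw [cross_swap]; linarith) hz
  rw [cross_swap] at this; linarith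

/-- Two triangles on different sides of a line have disjoint interiors. -/
lemma disjoint_interior_triangle (u v : ℂ) {x y w x' y' w' : ℂ} (huv : u ≠ v)
    (h1 : 0 ≤ cross u v x) (h2 : 0 ≤ cross u v y) (h3 : 0 ≤ cross u v w)
    (h1' : cross u v x' ≤ 0) (h2' : cross u v y' ≤ 0) (h3' : cross u v w' ≤ 0) :
    Disjoint (interior (triangle x y w)) (interior (triangle x' y' w')) :=
  disjoint_interior_of_cross huv (fun _ hz => cross_nonneg_of_mem_triangle h1 h2 h3 hz)
    fun _ hz => cross_nonpos_of_mem_triangle h1' h2' h3' hz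

lemma ne_of_cross_pos {u v w : ℂ} (h : 0 < cross u v w) : u ≠ v ∧ v ≠ w ∧ u ≠ w := by
  refine ⟨?_, ?_, ?_⟩ <;> rintro rfl <;> simp [cross, mul_comm] at h

/-- The orientation of a triangle, for all orders of its corners. -/
lemma cross_perms {u v w : ℂ} (h : 0 < cross u v w) :
    0 ≤ cross u v w ∧ 0 ≤ cross v w u ∧ 0 ≤ cross w u v ∧
      cross v u w ≤ 0 ∧ cross u w v ≤ 0 ∧ cross w v u ≤ 0 := by
  unfold cross at *
  refine ⟨?_, ?_, ?_, ?_, ?_, ?_⟩ <;> linarith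

lemma cross_add_one (u w : ℂ) : cross u (u + 1) w = w.im - u.im := by
  simp [cross]

namespace IsAdmissible

variable {q : ℂ}

/-- The heights of the points `Q`, `S`, `H` above the line `EF`. -/
lemma im_lt (h : IsAdmissible q) : q.im < (refS q).im ∧ 0 ≤ q.im ∧
    (refS q).im ≤ (omega ^ 2).im := by
  obtain ⟨a, b, c, ha, hb, hc, habc, rfl⟩ := h.exists_lin
  have hs := sinFifth_pos
  have hp := phi_gt
  rw [refS_lin, omega_sq_eq_lin]
  simp only [lin, Complex.add_im, Complex.ofReal_im, Complex.mul_im, Complex.ofReal_re, omega_im,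
    zero_mul, add_zero, zero_add]
  refine ⟨?_, by positivity, ?_⟩ <;> gcongr <;> nlinarith

set_option linter.unusedSimpArgs false in
/-- Any two pieces are separated by one of their sides, or by a horizontal line through `S`. -/
lemma piece_disjoint (h : IsAdmissible q) (κ : RhombKind) {i j : Fin 6} (hij : i < j) :
    Disjoint (interior (κ.piece q i)) (interior (κ.piece q j)) := by
  obtain ⟨him1, him2, him3⟩ := h.im_lt
  have H := And.intro (cross_perms h.cross_OIQ) <|
    And.intro (cross_perms h.cross_DOQ) <|
    And.intro (cross_perms h.cross_CDQ) <|
    And.intro (cross_perms h.cross_CQI) <|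
    And.intro (cross_perms h.cross_DQI) <|
    And.intro (cross_perms h.cross_OQS) <|
    And.intro (cross_perms h.cross_OQH) <|
    And.intro (cross_perms h.cross_OSH) <|
    And.intro (cross_perms h.cross_QSH) <|
    And.intro (cross_perms h.cross_IGS) <|
    And.intro (cross_perms h.cross_ISQ) <|
    And.intro (cross_perms h.cross_GHS) <|
    And.intro (cross_perms h.cross_IGQ) <|
    And.intro (cross_perms h.cross_OIS) <|
    cross_perms h.cross_ISH
  have hG : (1 + omega ^ 2).im = (omega ^ 2).im := by simp
  cases κ
  · fin_cases i <;> fin_cases j <;> first | exact absurd hij (by decide) | skip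
    all_goals simp only [RhombKind.piece, Fin.reduceFinMk, Fin.zero_eta, Fin.mk_one,
      Matrix.cons_val, Matrix.cons_val_zero, Matrix.cons_val_one, interior_empty,
      Set.disjoint_empty, Set.empty_disjoint]
    · apply disjoint_interior_triangle q 0 (ne_of_cross_pos h.cross_OIQ).2.2.symm <;>
        simp only [cross_self_left, cross_self_right, le_refl, H]
    · apply disjoint_interior_triangle 1 q (ne_of_cross_pos h.cross_OIQ).2.1 <;>
        simp only [cross_self_left, cross_self_right, le_refl, H]
    · apply disjoint_interior_triangle 1 q (ne_of_cross_pos h.cross_OIQ).2.1 <;>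
        simp only [cross_self_left, cross_self_right, le_refl, H]
    · apply disjoint_interior_triangle q omega (ne_of_cross_pos h.cross_DOQ).2.2.symm <;>
        simp only [cross_self_left, cross_self_right, le_refl, H]
    · apply disjoint_interior_triangle q omega (ne_of_cross_pos h.cross_DOQ).2.2.symm <;>
        simp only [cross_self_left, cross_self_right, le_refl, H]
    · apply disjoint_interior_triangle q (1 + omega) (ne_of_cross_pos h.cross_CDQ).2.2.symm <;>
        simp only [cross_self_left, cross_self_right, le_refl, H]
  · fin_cases i <;> fin_cases j <;> first | exact absurd hij (by decide) | skip
    all_goals simp only [RhombKind.piece, Fin.reduceFinMk, Fin.zero_eta, Fin.mk_one,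
      Matrix.cons_val, Matrix.cons_val_zero, Matrix.cons_val_one]
    · rw [disjoint_comm]
      apply disjoint_interior_triangle (refS q) (refS q + 1) (by simp) <;>
        simp only [cross_add_one, hG, Complex.zero_im, Complex.one_im] <;> linarith
    · apply disjoint_interior_triangle q 0 (ne_of_cross_pos h.cross_OIQ).2.2.symm <;>
        simp only [cross_self_left, cross_self_right, le_refl, H]
    · apply disjoint_interior_triangle q 0 (ne_of_cross_pos h.cross_OIQ).2.2.symm <;>
        simp only [cross_self_left, cross_self_right, le_refl, H]
    · apply disjoint_interior_triangle 1 q (ne_of_cross_pos h.cross_OIQ).2.1 <;>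
        simp only [cross_self_left, cross_self_right, le_refl, H]
    · apply disjoint_interior_triangle 1 q (ne_of_cross_pos h.cross_OIQ).2.1 <;>
        simp only [cross_self_left, cross_self_right, le_refl, H]
    · apply disjoint_interior_triangle (omega ^ 2) (refS q)
        (ne_of_cross_pos h.cross_OSH).2.1.symm <;>
        simp only [cross_self_left, cross_self_right, le_refl, H]
    · apply disjoint_interior_triangle (omega ^ 2) (refS q)
        (ne_of_cross_pos h.cross_OSH).2.1.symm <;>
        simp only [cross_self_left, cross_self_right, le_refl, H]
    · apply disjoint_interior_triangle (refS q) (refS q + 1) (by simp) <;>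
        simp only [cross_add_one, hG, Complex.zero_im, Complex.one_im] <;> linarith
    · apply disjoint_interior_triangle (refS q) (1 + omega ^ 2)
        (ne_of_cross_pos h.cross_IGS).2.1.symm <;>
        simp only [cross_self_left, cross_self_right, le_refl, H]
    · apply disjoint_interior_triangle (refS q) 0 (ne_of_cross_pos h.cross_OQS).2.2.symm <;>
        simp only [cross_self_left, cross_self_right, le_refl, H]
    · apply disjoint_interior_triangle q (refS q) (ne_of_cross_pos h.cross_OQS).2.1 <;>
        simp only [cross_self_left, cross_self_right, le_refl, H]
    · apply disjoint_interior_triangle 1 (refS q) (ne_of_cross_pos h.cross_IGS).2.2 <;>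
        simp only [cross_self_left, cross_self_right, le_refl, H]
    · apply disjoint_interior_triangle q (refS q) (ne_of_cross_pos h.cross_OQS).2.1 <;>
        simp only [cross_self_left, cross_self_right, le_refl, H]
    · apply disjoint_interior_triangle 1 (refS q) (ne_of_cross_pos h.cross_IGS).2.2 <;>
        simp only [cross_self_left, cross_self_right, le_refl, H]
    · apply disjoint_interior_triangle 1 (refS q) (ne_of_cross_pos h.cross_IGS).2.2 <;>
        simp only [cross_self_left, cross_self_right, le_refl, H]

end IsAdmissible

lemma RhombKind.zero_mem (κ : RhombKind) : (0 : ℂ) ∈ κ.region :=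
  subset_convexHull ℝ _ ⟨0, by cases κ <;> rfl⟩

lemma RhombKind.one_mem (κ : RhombKind) : (1 : ℂ) ∈ κ.region :=
  subset_convexHull ℝ _ ⟨1, by cases κ <;> rfl⟩

lemma RhombKind.one_add_tau_mem (κ : RhombKind) : 1 + κ.tau ∈ κ.region :=
  subset_convexHull ℝ _ ⟨2, by cases κ <;> rfl⟩

lemma RhombKind.tau_mem (κ : RhombKind) : κ.tau ∈ κ.region :=
  subset_convexHull ℝ _ ⟨3, by cases κ <;> rfl⟩

lemma RhombKind.cross_side_nonneg (κ : RhombKind) {z : ℂ} (hz : z ∈ κ.region) :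
    0 ≤ cross 0 1 z ∧ 0 ≤ cross 1 (1 + κ.tau) z ∧ 0 ≤ cross (1 + κ.tau) κ.tau z ∧
      0 ≤ cross κ.tau 0 z := by
  obtain ⟨x, y, rfl⟩ := κ.exists_chart z
  obtain ⟨⟨hx0, hx1⟩, hy0, hy1⟩ := (κ.chart_mem_region x y).1 hz
  have ht := κ.tau_im_pos
  rw [κ.chart_apply]
  refine ⟨?_, ?_, ?_, ?_⟩ <;> simp [cross] <;> nlinarith

/-- A quadrilateral is covered by the four triangles with apex `p`, if `p` lies in the triangle
with corners `w`, `u`, `v`. -/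
lemma mem_fan {u v x w p z : ℂ} (huv : 0 < cross u v p) (hvx : 0 < cross v x p)
    (hxw : 0 < cross x w p) (hwu : 0 < cross w u p) (hvw : 0 < cross v w p)
    (z1 : 0 ≤ cross u v z) (z2 : 0 ≤ cross v x z) (z3 : 0 ≤ cross x w z)
    (z4 : 0 ≤ cross w u z) :
    z ∈ triangle u v p ∨ z ∈ triangle v x p ∨ z ∈ triangle x w p ∨ z ∈ triangle w u p := by
  have tri : ∀ {s t}, 0 < cross s t p → 0 ≤ cross s t z → 0 ≤ cross p s z → cross p t z ≤ 0 →
      z ∈ triangle s t p := by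
    intro s t h h1 h2 h3
    refine mem_triangle_of_cross h h1 ?_ h2
    rw [cross_swap]; linarith
  have id1 : cross v w p * cross p u z + cross w u p * cross p v z + cross u v p * cross p w z
      = 0 := by
    unfold cross; ring
  rcases le_or_gt 0 (cross p u z) with hu | hu <;> rcases le_or_gt 0 (cross p v z) with hv | hv <;>
    rcases le_or_gt 0 (cross p x z) with hx | hx <;> rcases le_or_gt 0 (cross p w z) with hw | hw
  all_goals first
    | exact .inl (tri huv z1 hu (le_of_lt hv))
    | exact .inr (.inl (tri hvx z2 hv (le_of_lt hx)))
    | exact .inr (.inr (.inl (tri hxw z3 hx (le_of_lt hw))))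
    | exact .inr (.inr (.inr (tri hwu z4 hw (le_of_lt hu))))
    | skip
  · have e1 := mul_nonneg hvw.le hu
    have e2 := mul_nonneg hwu.le hv
    have e3 := mul_nonneg huv.le hw
    have : cross p u z = 0 := by
      have : cross v w p * cross p u z = 0 := by linarith
      rcases mul_eq_zero.1 this with h | h
      · exact absurd h hvw.ne'
      · exact h
    have : cross p v z = 0 := by
      have : cross w u p * cross p v z = 0 := by linarith
      rcases mul_eq_zero.1 this with h | h
      · exact absurd h hwu.ne'
      · exact h
    exact .inl (tri huv z1 hu this.le)
  · have e1 := mul_neg_of_pos_of_neg hvw hu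
    have e2 := mul_neg_of_pos_of_neg hwu hv
    have e3 := mul_neg_of_pos_of_neg huv hw
    linarith

/-- A triangle is covered by the three triangles with apex `p` in it. -/
lemma mem_fan_triangle {u v w p z : ℂ} (huv : 0 < cross u v p) (hvw : 0 < cross v w p)
    (hwu : 0 < cross w u p) (hz : z ∈ triangle u v w) :
    z ∈ triangle u v p ∨ z ∈ triangle v w p ∨ z ∈ triangle w u p := by
  have h : 0 < cross u v w := by
    have : cross u v w = cross u v p + cross v w p + cross w u p := by unfold cross; ring
    linarith
  obtain ⟨z1, z2, z3⟩ := (mem_triangle_iff h).1 hz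
  have tri : ∀ {s t}, 0 < cross s t p → 0 ≤ cross s t z → 0 ≤ cross p s z → cross p t z ≤ 0 →
      z ∈ triangle s t p := by
    intro s t h h1 h2 h3
    refine mem_triangle_of_cross h h1 ?_ h2
    rw [cross_swap]; linarith
  have id1 : cross v w p * cross p u z + cross w u p * cross p v z + cross u v p * cross p w z
      = 0 := by
    unfold cross; ring
  rcases le_or_gt 0 (cross p u z) with hu | hu <;> rcases le_or_gt 0 (cross p v z) with hv | hv <;>
    rcases le_or_gt 0 (cross p w z) with hw | hw
  all_goals first
    | exact .inl (tri huv z1 hu (le_of_lt hv))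
    | exact .inr (.inl (tri hvw z2 hv (le_of_lt hw)))
    | exact .inr (.inr (tri hwu z3 hw (le_of_lt hu)))
    | skip
  · have e1 := mul_nonneg hvw.le hu
    have e2 := mul_nonneg hwu.le hv
    have e3 := mul_nonneg huv.le hw
    have : cross w u p * cross p v z = 0 := by linarith
    rcases mul_eq_zero.1 this with h | h
    · exact absurd h hwu.ne'
    · exact .inl (tri huv z1 hu h.le)
  · have e1 := mul_neg_of_pos_of_neg hvw hu
    have e2 := mul_neg_of_pos_of_neg hwu hv
    have e3 := mul_neg_of_pos_of_neg huv hw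
    linarith

lemma cross_pos_rotate {u v w : ℂ} (h : 0 < cross u v w) : 0 < cross v w u := by
  rwa [cross_rotate]

namespace IsAdmissible

variable {q : ℂ}

lemma mem_interior (h : IsAdmissible q) (κ : RhombKind) : q ∈ interior κ.region := by
  cases κ
  · exact h.1
  · obtain ⟨a, b, c, ha, hb, hc, habc, rfl⟩ := h.exists_lin
    obtain ⟨t, ht, hφ, ht2⟩ := exists_gold_eq
    have ht1 : t < 1 := by nlinarith
    have e : lin a b = RhombKind.thick.chart (a + t * b, t * b) := by
      have ht2' : (t : ℂ) ^ 2 = 1 - t := by exact_mod_cast ht2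
      rw [RhombKind.chart_apply, lin, RhombKind.tau, omega_sq, hφ]
      push_cast
      linear_combination -(b * omega) * ht2'
    rw [e, RhombKind.chart_mem_interior]
    refine ⟨⟨by positivity, by nlinarith⟩, by positivity, by nlinarith⟩

lemma refS_mem_interior (h : IsAdmissible q) : refS q ∈ interior RhombKind.thick.region := by
  obtain ⟨a, b, c, ha, hb, hc, habc, rfl⟩ := h.exists_lin
  obtain ⟨t, ht, hφ, ht2⟩ := exists_gold_eq
  have ht1 : t < 1 := by nlinarith
  have e : refS (lin a b) = RhombKind.thick.chart (a + b, 1 - t * a) := by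
    have ht2' : (t : ℂ) ^ 2 = 1 - t := by exact_mod_cast ht2
    rw [refS_lin, RhombKind.chart_apply, lin, RhombKind.tau, omega_sq, hφ]
    push_cast
    linear_combination (a * omega) * ht2'
  rw [e, RhombKind.chart_mem_interior]
  refine ⟨⟨by positivity, by linarith⟩, by nlinarith, by nlinarith⟩

lemma closure_interior_piece (h : IsAdmissible q) (κ : RhombKind) (i : Fin 6) :
    closure (interior (κ.piece q i)) = κ.piece q i := by
  cases κ
  · fin_cases i
    · exact closure_interior_triangle h.cross_OIQ
    · exact closure_interior_triangle h.cross_DOQ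
    · exact closure_interior_triangle h.cross_CDQ
    · exact closure_interior_triangle h.cross_CQI
    · simp [RhombKind.piece]
    · simp [RhombKind.piece]
  · fin_cases i
    · exact closure_interior_triangle h.cross_OIQ
    · exact closure_interior_triangle h.cross_GHS
    · exact closure_interior_triangle h.cross_OQS
    · exact closure_interior_triangle h.cross_OSH
    · exact closure_interior_triangle h.cross_ISQ
    · exact closure_interior_triangle h.cross_IGS

lemma piece_subset (h : IsAdmissible q) (κ : RhombKind) (i : Fin 6) :
    κ.piece q i ⊆ κ.region := by
  have tri : ∀ {u v w}, u ∈ κ.region → v ∈ κ.region → w ∈ κ.region →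
      triangle u v w ⊆ κ.region := by
    intro u v w hu hv hw
    refine convexHull_min ?_ (convex_convexHull ℝ _)
    rintro x (rfl | rfl | rfl) <;> assumption
  have h0 := κ.zero_mem
  have h1 := κ.one_mem
  have h2 := κ.one_add_tau_mem
  have h3 := κ.tau_mem
  have hq := interior_subset (h.mem_interior κ)
  cases κ
  · fin_cases i
    · exact tri h0 h1 hq
    · exact tri h3 h0 hq
    · exact tri h2 h3 hq
    · exact tri h2 hq h1
    · exact Set.empty_subset _
    · exact Set.empty_subset _
  · have hS := interior_subset h.refS_mem_interior
    fin_cases i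
    · exact tri h0 h1 hq
    · exact tri h2 h3 hS
    · exact tri h0 hq hS
    · exact tri h0 hS h3
    · exact tri h1 hS hq
    · exact tri h1 h2 hS

lemma exists_piece (h : IsAdmissible q) (κ : RhombKind) {z : ℂ} (hz : z ∈ κ.region) :
    ∃ i, z ∈ κ.piece q i := by
  obtain ⟨z1, z2, z3, z4⟩ := κ.cross_side_nonneg hz
  cases κ
  · have := mem_fan h.cross_OIQ (cross_pos_rotate (cross_pos_rotate h.cross_CQI)) h.cross_CDQ
      h.cross_DOQ (cross_pos_rotate (cross_pos_rotate h.cross_DQI)) z1 z2 z3 z4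
    rcases this with h | h | h | h
    · exact ⟨0, h⟩
    · refine ⟨3, ?_⟩
      change z ∈ triangle (1 + omega) q 1
      rwa [triangle_rotate]
    · exact ⟨2, h⟩
    · exact ⟨1, h⟩
  · have := mem_fan (cross_pos_rotate h.cross_GHS |> cross_pos_rotate |> cross_pos_rotate)
      (cross_pos_rotate (cross_pos_rotate h.cross_OSH)) h.cross_OIS h.cross_IGS
      (cross_pos_rotate (cross_pos_rotate h.cross_ISH)) z3 z4 z1 z2
    rcases this with hz | hz | hz | hz
    · exact ⟨1, hz⟩
    · refine ⟨3, ?_⟩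
      change z ∈ triangle 0 (refS q) (omega ^ 2)
      rwa [triangle_rotate]
    · have := mem_fan_triangle h.cross_OIQ h.cross_ISQ
        (cross_pos_rotate (cross_pos_rotate h.cross_OQS)) hz
      rcases this with hz | hz | hz
      · exact ⟨0, hz⟩
      · exact ⟨4, hz⟩
      · refine ⟨2, ?_⟩
        change z ∈ triangle 0 q (refS q)
        rwa [triangle_rotate]
    · exact ⟨5, hz⟩

end IsAdmissible

/-! ### Prototiles -/

lemma mem_fan_of_cross {p u v z : ℂ} (h : 0 < cross p u v) (h1 : 0 ≤ cross p u z)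
    (h2 : 0 ≤ cross u v z) (h3 : cross p v z ≤ 0) : z ∈ triangle p u v := by
  refine mem_triangle_of_cross h h1 h2 ?_
  rw [cross_swap]; linarith

lemma triangle_subset_hull {u v w : ℂ} {s : Set ℂ} (hu : u ∈ s) (hv : v ∈ s) (hw : w ∈ s) :
    triangle u v w ⊆ convexHull ℝ s := by
  refine convexHull_mono ?_
  rintro x (rfl | rfl | rfl) <;> assumption

/-- Triangulation of a convex quadrilateral from its corner `p`. -/
lemma convexHull_quadrilateral {p a b c : ℂ} (h1 : 0 < cross p a b) (h2 : 0 < cross p b c)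
    (h3 : 0 < cross p a c) (h4 : 0 < cross a b c) :
    convexHull ℝ {p, a, b, c} = triangle p a b ∪ triangle p b c := by
  refine Set.Subset.antisymm (fun z hz => ?_) (Set.union_subset
    (triangle_subset_hull (by simp) (by simp) (by simp))
    (triangle_subset_hull (by simp) (by simp) (by simp)))
  obtain ⟨a1, a2, a3, a4, a5, a6⟩ := cross_perms h1
  obtain ⟨b1, b2, b3, b4, b5, b6⟩ := cross_perms h2
  obtain ⟨c1, c2, c3, c4, c5, c6⟩ := cross_perms h3
  obtain ⟨d1, d2, d3, d4, d5, d6⟩ := cross_perms h4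
  have e1 : 0 ≤ cross p a z :=
    cross_nonneg_of_mem_hull (by simp [cross_self_left, cross_self_right, *]) hz
  have e2 : 0 ≤ cross a b z :=
    cross_nonneg_of_mem_hull (by simp [cross_self_left, cross_self_right, *]) hz
  have e3 : 0 ≤ cross b c z :=
    cross_nonneg_of_mem_hull (by simp [cross_self_left, cross_self_right, *]) hz
  have e4 : 0 ≤ cross c p z :=
    cross_nonneg_of_mem_hull (by simp [cross_self_left, cross_self_right, *]) hz
  rw [cross_swap] at e4
  rcases le_total (cross p b z) 0 with h | h
  · exact .inl (mem_fan_of_cross h1 e1 e2 h)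
  · exact .inr (mem_fan_of_cross h2 h e3 (by linarith))

/-- Triangulation of a convex pentagon from its corner `p`. -/
lemma convexHull_pentagon {p a b c d : ℂ} (pab : 0 < cross p a b) (pac : 0 < cross p a c)
    (pad : 0 < cross p a d) (pbc : 0 < cross p b c) (pbd : 0 < cross p b d)
    (pcd : 0 < cross p c d) (abc : 0 < cross a b c) (abd : 0 < cross a b d)
    (acd : 0 < cross a c d) (bcd : 0 < cross b c d) :
    convexHull ℝ {p, a, b, c, d} = triangle p a b ∪ triangle p b c ∪ triangle p c d := by
  refine Set.Subset.antisymm (fun z hz => ?_) (Set.union_subset (Set.union_subset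
    (triangle_subset_hull (by simp) (by simp) (by simp))
    (triangle_subset_hull (by simp) (by simp) (by simp)))
    (triangle_subset_hull (by simp) (by simp) (by simp)))
  have h1 := cross_perms pab
  have h2 := cross_perms pac
  have h3 := cross_perms pad
  have h4 := cross_perms pbd
  have h5 := cross_perms pcd
  have h6 := cross_perms abc
  have h7 := cross_perms abd
  have h8 := cross_perms acd
  have h9 := cross_perms bcd
  have h10 := cross_perms pbc
  have e1 : 0 ≤ cross p a z :=
    cross_nonneg_of_mem_hull (by simp [cross_self_left, cross_self_right, *]) hz
  have e2 : 0 ≤ cross a b z :=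
    cross_nonneg_of_mem_hull (by simp [cross_self_left, cross_self_right, *]) hz
  have e3 : 0 ≤ cross b c z :=
    cross_nonneg_of_mem_hull (by simp [cross_self_left, cross_self_right, *]) hz
  have e4 : 0 ≤ cross c d z :=
    cross_nonneg_of_mem_hull (by simp [cross_self_left, cross_self_right, *]) hz
  have e5 : 0 ≤ cross d p z :=
    cross_nonneg_of_mem_hull (by simp [cross_self_left, cross_self_right, *]) hz
  rw [cross_swap] at e5
  rcases le_total (cross p b z) 0 with h | h
  · exact .inl (.inl (mem_fan_of_cross pab e1 e2 h))
  rcases le_total (cross p c z) 0 with h' | h'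
  · exact .inl (.inr (mem_fan_of_cross pbc h e3 h'))
  · exact .inr (mem_fan_of_cross pcd h' e4 (by linarith))

/-- Triangulation of a convex hexagon from its corner `p`. -/
lemma convexHull_hexagon {p a b c d e : ℂ} (pab : 0 < cross p a b) (pac : 0 < cross p a c)
    (pad : 0 < cross p a d) (pae : 0 < cross p a e) (pbc : 0 < cross p b c)
    (pcd : 0 < cross p c d) (pbe : 0 < cross p b e) (pce : 0 < cross p c e)
    (pde : 0 < cross p d e) (abc : 0 < cross a b c) (abd : 0 < cross a b d)
    (abe : 0 < cross a b e) (bcd : 0 < cross b c d) (bce : 0 < cross b c e)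
    (acd : 0 < cross a c d) (cde : 0 < cross c d e)
    (ade : 0 < cross a d e) (bde : 0 < cross b d e) :
    convexHull ℝ {p, a, b, c, d, e} =
      triangle p a b ∪ triangle p b c ∪ triangle p c d ∪ triangle p d e := by
  refine Set.Subset.antisymm (fun z hz => ?_) (Set.union_subset (Set.union_subset
    (Set.union_subset (triangle_subset_hull (by simp) (by simp) (by simp))
    (triangle_subset_hull (by simp) (by simp) (by simp)))
    (triangle_subset_hull (by simp) (by simp) (by simp)))
    (triangle_subset_hull (by simp) (by simp) (by simp)))
  have h1 := cross_perms pab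
  have h2 := cross_perms pac
  have h3 := cross_perms pad
  have h4 := cross_perms pae
  have h5 := cross_perms pbc
  have h6 := cross_perms pcd
  have h7 := cross_perms pbe
  have h8 := cross_perms pce
  have h9 := cross_perms pde
  have h10 := cross_perms abc
  have h11 := cross_perms abd
  have h12 := cross_perms abe
  have h13 := cross_perms bcd
  have h14 := cross_perms bce
  have h15 := cross_perms acd
  have h16 := cross_perms cde
  have h17 := cross_perms ade
  have h18 := cross_perms bde
  have e1 : 0 ≤ cross p a z :=
    cross_nonneg_of_mem_hull (by simp [cross_self_left, cross_self_right, *]) hz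
  have e2 : 0 ≤ cross a b z :=
    cross_nonneg_of_mem_hull (by simp [cross_self_left, cross_self_right, *]) hz
  have e3 : 0 ≤ cross b c z :=
    cross_nonneg_of_mem_hull (by simp [cross_self_left, cross_self_right, *]) hz
  have e4 : 0 ≤ cross c d z :=
    cross_nonneg_of_mem_hull (by simp [cross_self_left, cross_self_right, *]) hz
  have e5 : 0 ≤ cross d e z :=
    cross_nonneg_of_mem_hull (by simp [cross_self_left, cross_self_right, *]) hz
  have e6 : 0 ≤ cross e p z :=
    cross_nonneg_of_mem_hull (by simp [cross_self_left, cross_self_right, *]) hz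
  rw [cross_swap] at e6
  rcases le_total (cross p b z) 0 with h | h
  · exact .inl (.inl (.inl (mem_fan_of_cross pab e1 e2 h)))
  rcases le_total (cross p c z) 0 with h' | h'
  · exact .inl (.inl (.inr (mem_fan_of_cross pbc h e3 h')))
  rcases le_total (cross p d z) 0 with h'' | h''
  · exact .inl (.inr (mem_fan_of_cross pcd h' e4 h''))
  · exact .inr (mem_fan_of_cross pde h'' e5 (by linarith))

lemma mem_interior_or_segment {U : Set ℂ} {p v w z : ℂ} (h : 0 < cross p v w)
    (hU : triangle p v w ⊆ U) (hz : z ∈ triangle p v w) :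
    z ∈ interior U ∨ z ∈ segment ℝ p v ∨ z ∈ segment ℝ v w ∨ z ∈ segment ℝ p w := by
  rcases triangle_subset_interior_union h hz with h | h | h | h
  · exact .inl (interior_mono hU h)
  · exact .inr (.inl h)
  · exact .inr (.inr (.inl h))
  · exact .inr (.inr (.inr (segment_symm ℝ p w ▸ h)))

/-- A common side of two triangles in `U` is interior to `U`, except for its ends. -/
lemma mem_interior_or_end {U : Set ℂ} {p u v w z : ℂ} (h : 0 < cross p u v) (h' : 0 < cross p v w)
    (hU : triangle p u v ⊆ U) (hU' : triangle p v w ⊆ U) (hz : z ∈ segment ℝ p v) :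
    z ∈ interior U ∨ z = p ∨ z = v := by
  rw [← insert_endpoints_openSegment] at hz
  rcases hz with rfl | rfl | hz
  · exact .inr (.inl rfl)
  · exact .inr (.inr rfl)
  · refine .inl (interior_mono ?_ (openSegment_subset_interior_union (w := w) (w' := u) h' ?_ hz))
    · rw [triangle_rotate u v p, triangle_rotate p u v]
      exact Set.union_subset hU' hU
    · rwa [cross_rotate, cross_rotate]

/-- The three types of tiles. -/
inductive TileKind where
  | A
  | B
  | C

/-- The prototiles. -/
noncomputable def TileKind.proto (q : ℂ) : TileKind → Set ℂ
  | .A => protoA q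
  | .B => protoB q
  | .C => protoC q

/-- The boundaries of the prototiles, as unions of their sides. -/
def TileKind.outline (q : ℂ) : TileKind → Set ℂ
  | .A => segment ℝ 0 q ∪ segment ℝ q (refS q) ∪ segment ℝ (refS q) (omega ^ 2) ∪
      segment ℝ (omega ^ 2) (omega ^ 2 * q) ∪ segment ℝ 0 (omega ^ 2 * q)
  | .B => segment ℝ (1 + omega) (1 + omega - omega⁻¹ * q) ∪
      segment ℝ (1 + omega - omega⁻¹ * q) omega ∪ segment ℝ omega q ∪ segment ℝ q 1 ∪
      segment ℝ 1 (1 + omega - omega * q) ∪ segment ℝ (1 + omega) (1 + omega - omega * q)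
  | .C => segment ℝ 1 (1 + omega * q) ∪ segment ℝ (1 + omega * q) (1 + omega ^ 2) ∪
      segment ℝ (1 + omega ^ 2) (refS q) ∪ segment ℝ (refS q) q ∪ segment ℝ 1 q

namespace IsAdmissible

variable {q : ℂ}

lemma protoA_eq (h : IsAdmissible q) : protoA q = triangle 0 q (refS q) ∪
    triangle 0 (refS q) (omega ^ 2) ∪ triangle 0 (omega ^ 2) (omega ^ 2 * q) := by
  rw [← convexHull_pentagon h.cross_OQS h.cross_OQH h.cross_OQR h.cross_OSH h.cross_OSR
    h.cross_OHR h.cross_QSH h.cross_QSR h.cross_QHR h.cross_SHR, protoA]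
  congr 1; ext x; simp; tauto

lemma protoB_eq (h : IsAdmissible q) : protoB q =
    triangle (1 + omega) (1 + omega - omega⁻¹ * q) omega ∪ triangle (1 + omega) omega q ∪
    triangle (1 + omega) q 1 ∪ triangle (1 + omega) 1 (1 + omega - omega * q) := by
  rw [← convexHull_hexagon h.cross_CVD h.cross_CVQ h.cross_CVI h.cross_CVU h.cross_CDQ
    h.cross_CQI h.cross_CDU h.cross_CQU h.cross_CIU h.cross_VDQ h.cross_VDI h.cross_VDU
    h.cross_DQI h.cross_DQU h.cross_VQI h.cross_QIU h.cross_VIU h.cross_DIU, protoB]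
  congr 1; ext x; simp; tauto

lemma convexHull_protoC (h : IsAdmissible q) :
    convexHull ℝ {1 + omega ^ 2, 1 + omega * q, 1, refS q} =
      triangle 1 (1 + omega * q) (1 + omega ^ 2) ∪ triangle 1 (1 + omega ^ 2) (refS q) := by
  rw [← convexHull_quadrilateral h.cross_IWG h.cross_IGS h.cross_IWS h.cross_WGS]
  congr 1; ext x; simp; tauto

lemma protoC_eq (h : IsAdmissible q) : protoC q = triangle 1 (1 + omega * q) (1 + omega ^ 2) ∪
    triangle 1 (1 + omega ^ 2) (refS q) ∪ triangle 1 (refS q) q := by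
  rw [← h.convexHull_protoC, protoC, triangle]
  congr 2; ext x; simp; tauto

lemma closure_interior_proto (h : IsAdmissible q) (X : TileKind) :
    closure (interior (X.proto q)) = X.proto q := by
  have key : ∀ {U : Set ℂ} {u v w : ℂ}, 0 < cross u v w → triangle u v w ⊆ U →
      triangle u v w ⊆ closure (interior U) := by
    intro U u v w h hU
    calc triangle u v w = closure (interior (triangle u v w)) := (closure_interior_triangle h).symm
      _ ⊆ closure (interior U) := closure_mono (interior_mono hU)
  have hcl : IsClosed (X.proto q) := by
    cases X <;> simp only [TileKind.proto, h.protoA_eq, h.protoB_eq, h.protoC_eq]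
    · exact (((isCompact_triangle _ _ _).union (isCompact_triangle _ _ _)).union
        (isCompact_triangle _ _ _)).isClosed
    · exact ((((isCompact_triangle _ _ _).union (isCompact_triangle _ _ _)).union
        (isCompact_triangle _ _ _)).union (isCompact_triangle _ _ _)).isClosed
    · exact (((isCompact_triangle _ _ _).union (isCompact_triangle _ _ _)).union
        (isCompact_triangle _ _ _)).isClosed
  refine Set.Subset.antisymm (closure_minimal interior_subset hcl) ?_
  cases X <;> simp only [TileKind.proto, h.protoA_eq, h.protoB_eq, h.protoC_eq]
  · refine Set.union_subset (Set.union_subset (key h.cross_OQS ?_) (key h.cross_OSH ?_))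
      (key h.cross_OHR ?_) <;> intro z hz <;> simp [hz]
  · refine Set.union_subset (Set.union_subset (Set.union_subset (key h.cross_CVD ?_)
      (key h.cross_CDQ ?_)) (key h.cross_CQI ?_)) (key h.cross_CIU ?_) <;>
      intro z hz <;> simp [hz]
  · refine Set.union_subset (Set.union_subset (key h.cross_IWG ?_) (key h.cross_IGS ?_))
      (key h.cross_ISQ ?_) <;> intro z hz <;> simp [hz]

/-- The diagonals of the triangulation of a prototile belong to its interior, so only the outline
can lie on the boundary. -/
lemma proto_subset (h : IsAdmissible q) (X : TileKind) :
    X.proto q ⊆ interior (X.proto q) ∪ X.outline q := by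
  intro z hz
  have le := fun u v : ℂ => left_mem_segment ℝ u v
  have ri := fun u v : ℂ => right_mem_segment ℝ u v
  cases X
  · have e := h.protoA_eq
    have s1 : triangle 0 q (refS q) ⊆ protoA q := by rw [e]; intro z hz; simp [hz]
    have s2 : triangle 0 (refS q) (omega ^ 2) ⊆ protoA q := by rw [e]; intro z hz; simp [hz]
    have s3 : triangle 0 (omega ^ 2) (omega ^ 2 * q) ⊆ protoA q := by
      rw [e]; intro z hz; simp [hz]
    have i1 := fun z => mem_interior_or_end (z := z) h.cross_OQS h.cross_OSH s1 s2
    have i2 := fun z => mem_interior_or_end (z := z) h.cross_OSH h.cross_OHR s2 s3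
    simp only [TileKind.proto, TileKind.outline] at hz ⊢
    have hz' := e ▸ hz
    rcases hz' with (hz' | hz') | hz'
    · rcases mem_interior_or_segment h.cross_OQS s1 hz' with hz | hz | hz | hz
      · exact .inl hz
      · simp [hz]
      · simp [hz]
      · rcases i1 z hz with hz | rfl | rfl
        · exact .inl hz
        · simp [le]
        · simp [le]
    · rcases mem_interior_or_segment h.cross_OSH s2 hz' with hz | hz | hz | hz
      · exact .inl hz
      · rcases i1 z hz with hz | rfl | rfl
        · exact .inl hz
        · simp [le]
        · simp [le]
      · simp [hz]
      · rcases i2 z hz with hz | rfl | rfl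
        · exact .inl hz
        · simp [le]
        · simp [le]
    · rcases mem_interior_or_segment h.cross_OHR s3 hz' with hz | hz | hz | hz
      · exact .inl hz
      · rcases i2 z hz with hz | rfl | rfl
        · exact .inl hz
        · simp [le]
        · simp [le]
      · simp [hz]
      · simp [hz]
  · have e := h.protoB_eq
    have s1 : triangle (1 + omega) (1 + omega - omega⁻¹ * q) omega ⊆ protoB q := by
      rw [e]; intro z hz; simp [hz]
    have s2 : triangle (1 + omega) omega q ⊆ protoB q := by rw [e]; intro z hz; simp [hz]
    have s3 : triangle (1 + omega) q 1 ⊆ protoB q := by rw [e]; intro z hz; simp [hz]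
    have s4 : triangle (1 + omega) 1 (1 + omega - omega * q) ⊆ protoB q := by
      rw [e]; intro z hz; simp [hz]
    have i1 := fun z => mem_interior_or_end (z := z) h.cross_CVD h.cross_CDQ s1 s2
    have i2 := fun z => mem_interior_or_end (z := z) h.cross_CDQ h.cross_CQI s2 s3
    have i3 := fun z => mem_interior_or_end (z := z) h.cross_CQI h.cross_CIU s3 s4
    simp only [TileKind.proto, TileKind.outline] at hz ⊢
    have hz' := e ▸ hz
    have fin : ∀ {v z : ℂ}, (z ∈ interior (protoB q) ∨ z = 1 + omega ∨ z = v) →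
        (v = omega ∨ v = q ∨ v = 1) → z ∈ interior (protoB q) ∪
        (segment ℝ (1 + omega) (1 + omega - omega⁻¹ * q) ∪
        segment ℝ (1 + omega - omega⁻¹ * q) omega ∪ segment ℝ omega q ∪ segment ℝ q 1 ∪
        segment ℝ 1 (1 + omega - omega * q) ∪
        segment ℝ (1 + omega) (1 + omega - omega * q)) := by
      rintro v z (hz | rfl | rfl) hv
      · exact .inl hz
      · simp [le]
      · rcases hv with rfl | rfl | rfl <;> simp [le]
    rcases hz' with ((hz' | hz') | hz') | hz'
    · rcases mem_interior_or_segment h.cross_CVD s1 hz' with hz | hz | hz | hz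
      · exact .inl hz
      · simp [hz]
      · simp [hz]
      · exact fin (i1 z hz) (by simp)
    · rcases mem_interior_or_segment h.cross_CDQ s2 hz' with hz | hz | hz | hz
      · exact .inl hz
      · exact fin (i1 z hz) (by simp)
      · simp [hz]
      · exact fin (i2 z hz) (by simp)
    · rcases mem_interior_or_segment h.cross_CQI s3 hz' with hz | hz | hz | hz
      · exact .inl hz
      · exact fin (i2 z hz) (by simp)
      · simp [hz]
      · exact fin (i3 z hz) (by simp)
    · rcases mem_interior_or_segment h.cross_CIU s4 hz' with hz | hz | hz | hz
      · exact .inl hz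
      · exact fin (i3 z hz) (by simp)
      · simp [hz]
      · simp [hz]
  · have e := h.protoC_eq
    have s1 : triangle 1 (1 + omega * q) (1 + omega ^ 2) ⊆ protoC q := by
      rw [e]; intro z hz; simp [hz]
    have s2 : triangle 1 (1 + omega ^ 2) (refS q) ⊆ protoC q := by rw [e]; intro z hz; simp [hz]
    have s3 : triangle 1 (refS q) q ⊆ protoC q := by rw [e]; intro z hz; simp [hz]
    have i1 := fun z => mem_interior_or_end (z := z) h.cross_IWG h.cross_IGS s1 s2
    have i2 := fun z => mem_interior_or_end (z := z) h.cross_IGS h.cross_ISQ s2 s3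
    simp only [TileKind.proto, TileKind.outline] at hz ⊢
    have hz' := e ▸ hz
    rcases hz' with (hz' | hz') | hz'
    · rcases mem_interior_or_segment h.cross_IWG s1 hz' with hz | hz | hz | hz
      · exact .inl hz
      · simp [hz]
      · simp [hz]
      · rcases i1 z hz with hz | rfl | rfl
        · exact .inl hz
        · simp [le]
        · simp [le]
    · rcases mem_interior_or_segment h.cross_IGS s2 hz' with hz | hz | hz | hz
      · exact .inl hz
      · rcases i1 z hz with hz | rfl | rfl
        · exact .inl hz
        · simp [le]
        · simp [le]
      · simp [hz]
      · rcases i2 z hz with hz | rfl | rfl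
        · exact .inl hz
        · simp [le]
        · simp [le]
    · rcases mem_interior_or_segment h.cross_ISQ s3 hz' with hz | hz | hz | hz
      · exact .inl hz
      · rcases i2 z hz with hz | rfl | rfl
        · exact .inl hz
        · simp [le]
        · simp [le]
      · simp [hz]
      · simp [hz]

/-- The two convex parts of the prototile `C` are connected through the midpoint of the diagonal
`FS`. -/
lemma isPreconnected_interior_proto (h : IsAdmissible q) (X : TileKind) :
    IsPreconnected (interior (X.proto q)) := by
  cases X
  · exact (convex_convexHull ℝ _).interior.isPreconnected
  · exact (convex_convexHull ℝ _).interior.isPreconnected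
  · simp only [TileKind.proto]
    have e := h.protoC_eq
    have s2 : triangle 1 (1 + omega ^ 2) (refS q) ⊆ protoC q := by rw [e]; intro z hz; simp [hz]
    have s3 : triangle 1 (refS q) q ⊆ protoC q := by rw [e]; intro z hz; simp [hz]
    set m : ℂ := (1 / 2 : ℝ) • (1 : ℂ) + (1 / 2 : ℝ) • refS q with hm
    set K := convexHull ℝ {1 + omega ^ 2, 1 + omega * q, 1, refS q} with hK
    set L := triangle 1 (refS q) q with hL
    have hKL : protoC q = K ∪ L := by rw [e, hK, h.convexHull_protoC]
    have hmo : m ∈ openSegment ℝ 1 (refS q) :=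
      ⟨1 / 2, 1 / 2, by norm_num, by norm_num, by norm_num, rfl⟩
    have hmi : m ∈ interior (protoC q) := by
      refine interior_mono ?_ (openSegment_subset_interior_union (w := q)
        (w' := 1 + omega ^ 2) h.cross_ISQ (cross_pos_rotate (cross_pos_rotate h.cross_IGS)) hmo)
      refine Set.union_subset s3 ?_
      rwa [triangle_rotate (1 + omega ^ 2) (refS q) 1, triangle_rotate 1 (1 + omega ^ 2) (refS q)]
    have hKc : Convex ℝ K := convex_convexHull ℝ _
    have hLc : Convex ℝ L := convex_triangle _ _ _
    have hKi : (interior K).Nonempty :=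
      (interior_triangle_nonempty h.cross_IGS).mono (interior_mono
        (by rw [hK, h.convexHull_protoC]; exact Set.subset_union_right))
    have hLi : (interior L).Nonempty := interior_triangle_nonempty h.cross_ISQ
    have hcK : closure (interior K) = closure K :=
      hKc.closure_interior_eq_closure_of_nonempty_interior hKi
    have hcL : closure (interior L) = closure L :=
      hLc.closure_interior_eq_closure_of_nonempty_interior hLi
    have hmK : m ∈ K := hKc.openSegment_subset (subset_convexHull ℝ _ (by simp))
      (subset_convexHull ℝ _ (by simp)) hmo
    have hmL : m ∈ L := hLc.openSegment_subset (subset_convexHull ℝ _ (by simp))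
      (subset_convexHull ℝ _ (by simp)) hmo
    have pK : IsPreconnected (insert m (interior K)) :=
      hKc.interior.isPreconnected.subset_closure (Set.subset_insert _ _)
        (Set.insert_subset (hcK ▸ subset_closure hmK) subset_closure)
    have pL : IsPreconnected (insert m (interior L)) :=
      hLc.interior.isPreconnected.subset_closure (Set.subset_insert _ _)
        (Set.insert_subset (hcL ▸ subset_closure hmL) subset_closure)
    refine (pK.union m (Set.mem_insert _ _) (Set.mem_insert _ _) pL).subset_closure ?_ ?_
    · refine Set.union_subset (Set.insert_subset hmi (interior_mono ?_))
        (Set.insert_subset hmi (interior_mono s3))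
      rw [hKL]; exact Set.subset_union_left
    · refine interior_subset.trans ?_
      rw [hKL, closure_union]
      refine Set.union_subset_union ?_ ?_
      · exact (subset_closure.trans hcK.ge).trans (closure_mono (Set.subset_insert _ _))
      · exact (subset_closure.trans hcL.ge).trans (closure_mono (Set.subset_insert _ _))

end IsAdmissible

/-! ### The tiles and their pieces -/

/-- The kind of rhombs that give rise to the tiles of a type. -/
def TileKind.base : TileKind → RhombKind
  | .A => .thick
  | .B => .thin
  | .C => .thick

/-- The tile of type `X` that is placed like `X.proto q` with respect to `r`. It is a tile of the
tiling if `r` is of the kind `X.base`. -/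
noncomputable def Rhomb.tile (q : ℂ) (r : Rhomb) (X : TileKind) : Set ℂ :=
  r.place.map '' X.proto q

/-- The triangles into which a rhomb is cut by recomposition, numbered as for the reference
rhomb. -/
noncomputable def Rhomb.piece (q : ℂ) (s : Rhomb) (i : Fin 6) : Set ℂ :=
  s.place.map '' s.kind.piece q i

/-- The side of a rhomb that belongs to the piece `0` or `1`: the side `AB`, `EF` or `DA`, `GH`.
(The value for other pieces is irrelevant.) -/
def RhombKind.flapSide : RhombKind → Fin 6 → Fin 4
  | _, 0 => 0
  | .thin, _ => 3
  | .thick, _ => 2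

/-- The rhomb `r` holds the piece `i` of `s` if this piece belongs to a tile based on `r`: the
pieces `0` and `1` are held by the neighbor across their side, the others by `s` itself. -/
def Rhomb.Holds (r s : Rhomb) (i : Fin 6) : Prop :=
  if i < 2 then s.IsNeighbor (s.kind.flapSide i) r else r = s

/-- The type of the tile to which a piece numbered `i` belongs, for a holder of the given kind. -/
def RhombKind.owner : RhombKind → Fin 6 → TileKind
  | .thin => fun _ => .B
  | .thick => ![.A, .C, .A, .A, .C, .C]

lemma RhombKind.base_owner (κ : RhombKind) (i : Fin 6) : (κ.owner i).base = κ := by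
  cases κ <;> fin_cases i <;> rfl

/-- The pieces held by a rhomb, in the frame of the holder. -/
noncomputable def RhombKind.part (q : ℂ) : RhombKind → Fin 6 → Set ℂ
  | .thin => ![triangle (1 + omega) 1 (1 + omega - omega * q),
      triangle omega (1 + omega) (1 + omega - omega⁻¹ * q), triangle (1 + omega) omega q,
      triangle (1 + omega) q 1, ∅, ∅]
  | .thick => ![triangle 0 (omega ^ 2) (omega ^ 2 * q),
      triangle (1 + omega ^ 2) 1 (1 + omega * q),
      triangle 0 q (refS q), triangle 0 (refS q) (omega ^ 2), triangle 1 (refS q) q,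
      triangle 1 (1 + omega ^ 2) (refS q)]

lemma Placement.map_combo (g : Placement) (u v w : ℂ) :
    g.map (u + (v - u) * w) = g.map u + (g.map v - g.map u) * w := by
  simp only [Placement.map]; ring

lemma Placement.image_triangle (g : Placement) (u v w : ℂ) :
    g.map '' triangle u v w = triangle (g.map u) (g.map v) (g.map w) := by
  rw [triangle, g.image_convexHull, Set.image_insert_eq, Set.image_pair, triangle]

/-- The apex of the piece `0` or `1` of a rhomb, when its side is from `0` to `1`. -/
noncomputable def flapTip (q : ℂ) (i : Fin 6) : ℂ := if i = 0 then q else 1 - omega⁻¹ * q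

/-- The apex of the piece `0` or `1` of the reference rhomb, one of `Q`, `R`, `S`. -/
noncomputable def RhombKind.tip (q : ℂ) (κ : RhombKind) (i : Fin 6) : ℂ :=
  κ.refCorner (κ.flapSide i) + (κ.refCorner (κ.flapSide i + 1) - κ.refCorner (κ.flapSide i)) *
    flapTip q i

/-- The side at which a rhomb holds pieces `0` or `1` of its neighbors. -/
def RhombKind.holdSide (κ : RhombKind) (i : Fin 6) : Fin 4 :=
  κ.glueSide (if i = 0 then (.single, true) else (.double, false))

lemma RhombKind.mark_flapSide (κ : RhombKind) {i : Fin 6} (hi : i < 2) :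
    κ.mark (κ.flapSide i) = if i = 0 then (.single, true) else (.double, false) := by
  cases κ <;> fin_cases i <;> simp_all [RhombKind.mark, RhombKind.flapSide]

lemma RhombKind.tip_eq (q : ℂ) (κ : RhombKind) :
    κ.tip q 0 = q ∧ RhombKind.thin.tip q 1 = q ∧ RhombKind.thick.tip q 1 = refS q := by
  have h := omega_ne_zero
  refine ⟨?_, ?_, ?_⟩
  · cases κ <;> simp [tip, flapSide, refCorner, flapTip]
  · simp [tip, flapSide, refCorner, flapTip]; field_simp; ring
  · simp [tip, flapSide, refCorner, flapTip, refS]; ring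

namespace Rhomb

lemma Holds.corner_eq {r s : Rhomb} {i : Fin 6} (h : r.Holds s i) (hi : i < 2) :
    r.corner (r.kind.holdSide i + 1) = s.corner (s.kind.flapSide i) ∧
      r.corner (r.kind.holdSide i) = s.corner (s.kind.flapSide i + 1) := by
  rw [Holds, if_pos hi, IsNeighbor, RhombKind.mark_flapSide _ hi] at h
  exact h.symm

lemma Holds.map_tip {q : ℂ} {r s : Rhomb} {i : Fin 6} (h : r.Holds s i) (hi : i < 2) :
    s.place.map (s.kind.tip q i) = r.place.map (r.kind.refCorner (r.kind.holdSide i + 1) +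
      (r.kind.refCorner (r.kind.holdSide i) - r.kind.refCorner (r.kind.holdSide i + 1)) *
        flapTip q i) := by
  obtain ⟨h1, h2⟩ := h.corner_eq hi
  rw [RhombKind.tip, Placement.map_combo, Placement.map_combo]
  simp only [corner] at h1 h2
  rw [h1, h2]

lemma _root_.RhombKind.piece_eq_tip (q : ℂ) (κ : RhombKind) {i : Fin 6} (hi : i < 2) :
    κ.piece q i = triangle (κ.refCorner (κ.flapSide i)) (κ.refCorner (κ.flapSide i + 1))
      (κ.tip q i) := by
  obtain ⟨h1, h2, h3⟩ := κ.tip_eq q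
  obtain rfl | rfl : i = 0 ∨ i = 1 := by omega
  · rw [h1]
    cases κ <;> simp [RhombKind.piece, RhombKind.flapSide, RhombKind.refCorner]
  · cases κ
    · rw [h2]; simp [RhombKind.piece, RhombKind.flapSide, RhombKind.refCorner]
    · rw [h3]; simp [RhombKind.piece, RhombKind.flapSide, RhombKind.refCorner]

lemma Holds.piece_eq {q : ℂ} {r s : Rhomb} {i : Fin 6} (h : r.Holds s i) :
    s.piece q i = r.place.map '' r.kind.part q i := by
  by_cases hi : i < 2
  · obtain ⟨h1, h2⟩ := h.corner_eq hi
    have h3 := h.map_tip (q := q) hi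
    rw [piece, RhombKind.piece_eq_tip q _ hi, Placement.image_triangle, h3]
    change triangle (s.corner _) (s.corner _) _ = _
    rw [← h1, ← h2, corner, corner, ← Placement.image_triangle]
    congr 1
    have h0 := omega_ne_zero
    obtain rfl | rfl : i = 0 ∨ i = 1 := by omega
    · cases r.kind <;>
        simp [RhombKind.part, RhombKind.holdSide, RhombKind.glueSide, RhombKind.refCorner, flapTip,
          ← sub_eq_add_neg]
    · cases r.kind <;>
        simp [RhombKind.part, RhombKind.holdSide, RhombKind.glueSide, RhombKind.refCorner, flapTip]
      · congr 1; ring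
      · congr 1; field_simp; ring
  · rw [Holds, if_neg hi] at h
    subst h
    rw [piece]
    congr 1
    cases r.kind <;> fin_cases i <;> first | rfl | exact absurd (by decide) hi

end Rhomb

namespace IsAdmissible

variable {q : ℂ}

lemma part_subset (h : IsAdmissible q) (κ : RhombKind) (i : Fin 6) :
    κ.part q i ⊆ (κ.owner i).proto q := by
  intro z hz
  cases κ
  · change z ∈ protoB q
    rw [h.protoB_eq]
    fin_cases i
    · exact .inr hz
    · refine .inl (.inl (.inl ?_))
      rw [triangle_rotate omega]
      exact hz
    · exact .inl (.inl (.inr hz))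
    · exact .inl (.inr hz)
    · exact hz.elim
    · exact hz.elim
  · fin_cases i
    · change z ∈ protoA q; rw [h.protoA_eq]; exact .inr hz
    · change z ∈ protoC q; rw [h.protoC_eq]; refine .inl (.inl ?_)
      rw [triangle_rotate (1 + omega ^ 2)]; exact hz
    · change z ∈ protoA q; rw [h.protoA_eq]; exact .inl (.inl hz)
    · change z ∈ protoA q; rw [h.protoA_eq]; exact .inl (.inr hz)
    · change z ∈ protoC q; rw [h.protoC_eq]; exact .inr hz
    · change z ∈ protoC q; rw [h.protoC_eq]; exact .inl (.inr hz)

lemma exists_part (h : IsAdmissible q) {X : TileKind} {z : ℂ} (hz : z ∈ X.proto q) :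
    ∃ i, X.base.owner i = X ∧ z ∈ X.base.part q i := by
  cases X
  · rw [TileKind.proto, h.protoA_eq] at hz
    rcases hz with (hz | hz) | hz
    · exact ⟨2, rfl, hz⟩
    · exact ⟨3, rfl, hz⟩
    · exact ⟨0, rfl, hz⟩
  · rw [TileKind.proto, h.protoB_eq] at hz
    rcases hz with ((hz | hz) | hz) | hz
    · exact ⟨1, rfl, (triangle_rotate omega (1 + omega) (1 + omega - omega⁻¹ * q)).subset hz⟩
    · exact ⟨2, rfl, hz⟩
    · exact ⟨3, rfl, hz⟩
    · exact ⟨0, rfl, hz⟩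
  · rw [TileKind.proto, h.protoC_eq] at hz
    rcases hz with (hz | hz) | hz
    · exact ⟨1, rfl, (triangle_rotate (1 + omega ^ 2) 1 (1 + omega * q)).subset hz⟩
    · exact ⟨5, rfl, hz⟩
    · exact ⟨4, rfl, hz⟩

end IsAdmissible

namespace Rhomb

variable {q : ℂ} {r s t : Rhomb}

lemma Holds.piece_subset_tile {i : Fin 6} (h : r.Holds s i) (hq : IsAdmissible q) :
    s.piece q i ⊆ r.tile q (r.kind.owner i) := by
  rw [h.piece_eq]
  exact Set.image_mono (hq.part_subset _ _)

lemma IsNeighbor.symm {i : Fin 4} (h : r.IsNeighbor i s) :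
    s.IsNeighbor (s.kind.glueSide (r.kind.mark i)) r := by
  obtain ⟨h1, h2⟩ := h
  have e : r.kind.glueSide (s.kind.mark (s.kind.glueSide (r.kind.mark i))) = i := by
    cases r.kind <;> cases s.kind <;> fin_cases i <;> rfl
  rw [IsNeighbor, e]
  exact ⟨h2.symm, h1.symm⟩

lemma not_isNeighbor_self (r : Rhomb) (i : Fin 4) : ¬ r.IsNeighbor i r := by
  rintro ⟨h1, h2⟩
  have h1 := r.corner_injective h1
  have h2 := r.corner_injective h2
  rw [h1] at h2
  fin_cases i <;> exact absurd h2 (by decide)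

lemma Holds.ne {i : Fin 6} (h : r.Holds s i) (hi : i < 2) : r ≠ s := by
  rintro rfl
  rw [Holds, if_pos hi] at h
  exact r.not_isNeighbor_self _ h

end Rhomb

namespace IsPenroseTiling

variable {P : Set Rhomb} {q : ℂ} {r s t : Rhomb}

lemma exists_holder (hP : IsPenroseTiling P) (hs : s ∈ P) (i : Fin 6) :
    ∃ r ∈ P, r.Holds s i := by
  by_cases hi : i < 2
  · simp only [Rhomb.Holds, if_pos hi]
    exact hP.exists_neighbor hs _
  · exact ⟨s, hs, by simp [Rhomb.Holds, hi]⟩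

lemma exists_held (hP : IsPenroseTiling P) (hr : r ∈ P) (i : Fin 6) :
    ∃ s ∈ P, r.Holds s i := by
  by_cases hi : i < 2
  · simp only [Rhomb.Holds, if_pos hi]
    obtain ⟨s, hs, h⟩ := hP.exists_neighbor hr (r.kind.holdSide i)
    refine ⟨s, hs, ?_⟩
    have := h.symm
    convert this using 1
    obtain rfl | rfl : i = 0 ∨ i = 1 := by omega
    · cases r.kind <;> cases s.kind <;> rfl
    · cases r.kind <;> cases s.kind <;> rfl
  · exact ⟨r, hr, by simp [Rhomb.Holds, hi]⟩

lemma holder_unique (hP : IsPenroseTiling P) {i : Fin 6} (hr : r ∈ P) (ht : t ∈ P)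
    (h : r.Holds s i) (h' : t.Holds s i) : r = t := by
  by_cases hi : i < 2
  · simp only [Rhomb.Holds, if_pos hi] at h h'
    exact hP.neighbor_unique hr ht h h'
  · simp only [Rhomb.Holds, if_neg hi] at h h'
    rw [h, h']

/-- A tile consists of pieces of rhombs of the tiling. -/
lemma exists_mem_piece (hP : IsPenroseTiling P) (hq : IsAdmissible q) (hr : r ∈ P) {X : TileKind}
    (hX : X.base = r.kind) {z : ℂ} (hz : z ∈ r.tile q X) :
    ∃ s ∈ P, ∃ i, r.Holds s i ∧ r.kind.owner i = X ∧ z ∈ s.piece q i := by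
  obtain ⟨w, hw, rfl⟩ := hz
  obtain ⟨i, hi, hw⟩ := hq.exists_part hw
  rw [hX] at hi hw
  obtain ⟨s, hs, h⟩ := hP.exists_held hr i
  exact ⟨s, hs, i, h, hi, h.piece_eq ▸ ⟨w, hw, rfl⟩⟩

end IsPenroseTiling

namespace Rhomb

variable {q : ℂ} {r s t : Rhomb}

lemma closure_interior_piece (hq : IsAdmissible q) (s : Rhomb) (i : Fin 6) :
    closure (interior (s.piece q i)) = s.piece q i := by
  rw [piece, ← Placement.image_interior, ← s.place.coe_homeo, ← Homeomorph.image_closure,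
    hq.closure_interior_piece]

lemma closure_interior_tile (hq : IsAdmissible q) (r : Rhomb) (X : TileKind) :
    closure (interior (r.tile q X)) = r.tile q X := by
  rw [tile, ← Placement.image_interior, ← r.place.coe_homeo, ← Homeomorph.image_closure,
    hq.closure_interior_proto]

lemma piece_subset (hq : IsAdmissible q) (s : Rhomb) (i : Fin 6) :
    s.piece q i ⊆ s.carrier := by
  rw [piece, s.carrier_eq]
  exact Set.image_mono (hq.piece_subset _ _)

lemma exists_piece (hq : IsAdmissible q) {z : ℂ} (hz : z ∈ s.carrier) :
    ∃ i, z ∈ s.piece q i := by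
  rw [s.carrier_eq] at hz
  obtain ⟨w, hw, rfl⟩ := hz
  obtain ⟨i, hi⟩ := hq.exists_piece _ hw
  exact ⟨i, w, hi, rfl⟩

lemma eq_of_mem_interior_piece (hq : IsAdmissible q) {i j : Fin 6} {z : ℂ}
    (hi : z ∈ interior (s.piece q i)) (hj : z ∈ interior (s.piece q j)) : i = j := by
  rw [piece, ← Placement.image_interior] at hi hj
  obtain ⟨w, hw, rfl⟩ := hi
  rw [s.place.map_injective.mem_set_image] at hj
  by_contra hne
  rcases lt_or_gt_of_ne hne with h | h
  · exact Set.disjoint_left.1 (hq.piece_disjoint _ h) hw hj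
  · exact Set.disjoint_left.1 (hq.piece_disjoint _ h) hj hw

end Rhomb

lemma exists_mem_interior {U A : Set ℂ} (hU : IsOpen U) (hA : closure (interior A) = A) {z : ℂ}
    (hz : z ∈ U) (hzA : z ∈ A) : ∃ w ∈ U, w ∈ interior A := by
  rw [← hA, mem_closure_iff] at hzA
  exact hzA U hU hz

namespace IsPenroseTiling

variable {P : Set Rhomb} {q : ℂ} {r s t : Rhomb} {X Y : TileKind}

/-- Different tiles have disjoint interiors. -/
lemma tile_unique (hP : IsPenroseTiling P) (hq : IsAdmissible q) (hr : r ∈ P) (ht : t ∈ P)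
    (hX : X.base = r.kind) (hY : Y.base = t.kind) {z : ℂ} (hz : z ∈ interior (r.tile q X))
    (hz' : z ∈ t.tile q Y) : r = t ∧ X = Y := by
  obtain ⟨y, hy, hy'⟩ := exists_mem_interior isOpen_interior (t.closure_interior_tile hq Y) hz hz'
  obtain ⟨s, hs, i, hi, rfl, hm⟩ := hP.exists_mem_piece hq hr hX (interior_subset hy)
  obtain ⟨x, hx, hx'⟩ := exists_mem_interior (isOpen_interior.inter isOpen_interior)
    (s.closure_interior_piece hq i) ⟨hy, hy'⟩ hm
  obtain ⟨s', hs', j, hj, rfl, hm'⟩ := hP.exists_mem_piece hq ht hY (interior_subset hx.2)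
  obtain ⟨w, hw, hw'⟩ := exists_mem_interior isOpen_interior
    (s'.closure_interior_piece hq j) hx' hm'
  obtain rfl : s = s' := hP.eq_of_mem_interior hs hs'
    (interior_mono (s.piece_subset hq i) hw) (s'.piece_subset hq j (interior_subset hw'))
  obtain rfl := Rhomb.eq_of_mem_interior_piece hq hw hw'
  obtain rfl := hP.holder_unique hr ht hi hj
  exact ⟨rfl, rfl⟩

/-- A point that two tiles have in common is interior to no tile. -/
lemma not_mem_interior_tile (hP : IsPenroseTiling P) (hq : IsAdmissible q) (hr : r ∈ P)
    (ht : t ∈ P) (hX : X.base = r.kind) (hY : Y.base = t.kind) (hne : ¬(r = t ∧ X = Y)) {z : ℂ}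
    (hz : z ∈ r.tile q X) (hz' : z ∈ t.tile q Y) {s : Rhomb} {Z : TileKind} (hs : s ∈ P)
    (hZ : Z.base = s.kind) : z ∉ interior (s.tile q Z) := by
  intro h
  obtain ⟨rfl, rfl⟩ := hP.tile_unique hq hs hr hZ hX h hz
  exact hne (hP.tile_unique hq hs ht hZ hY h hz')

lemma _root_.segment_subset_triangle (u v w : ℂ) : segment ℝ u v ⊆ triangle u v w := by
  rw [← convexHull_pair]; exact convexHull_mono (by simp [Set.insert_subset_iff])

/-- The drawn edges separate pieces of a rhomb that belong to different tiles. -/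
lemma _root_.Rhomb.exists_pieces_of_mem_drawn {z : ℂ} (hz : z ∈ s.drawn q) :
    ∃ i j, z ∈ s.piece q i ∧ z ∈ s.piece q j ∧
      ((i = 0 ∧ j = 1 ∧ s.kind = .thin) ∨ (i < 2 ∧ 2 ≤ j) ∨
        (i = 2 ∧ j = 4 ∧ s.kind = .thick)) := by
  have t1 : ∀ u v w, triangle u v w = triangle v w u := fun u v w => (triangle_rotate _ _ _).symm
  have t2 : ∀ u v w, triangle u v w = triangle w u v := fun u v w => triangle_rotate _ _ _
  rcases s with ⟨κ, g⟩
  have mg : ∀ {i : Fin 6} {x u v w : ℂ}, x ∈ segment ℝ u v → κ.piece q i = triangle u v w →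
      g.map x ∈ Rhomb.piece q ⟨κ, g⟩ i :=
    fun hx hS => ⟨_, hS ▸ segment_subset_triangle _ _ _ hx, rfl⟩
  have mg' : ∀ {i : Fin 6} {x u v w : ℂ}, x ∈ segment ℝ v u → κ.piece q i = triangle u v w →
      g.map x ∈ Rhomb.piece q ⟨κ, g⟩ i := fun {i x u v w} hx => mg (segment_symm ℝ v u ▸ hx)
  cases κ
  · simp only [Rhomb.drawn, Rhomb.corner, ← Placement.image_segment, RhombKind.refCorner,
      Matrix.cons_val] at hz
    rcases hz with (⟨x, hx, rfl⟩ | ⟨x, hx, rfl⟩) | ⟨x, hx, rfl⟩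
    · refine ⟨0, 1, mg hx (t2 _ _ _), mg' hx (t1 _ _ _), by simp⟩
    · refine ⟨0, 3, mg' hx (t1 _ _ _), mg hx (t1 _ _ _), by simp⟩
    · refine ⟨1, 2, mg hx (t2 _ _ _), mg' hx (t1 _ _ _), by simp⟩
  · simp only [Rhomb.drawn, Rhomb.corner, ← Placement.image_segment, RhombKind.refCorner,
      Matrix.cons_val] at hz
    rcases hz with (((⟨x, hx, rfl⟩ | ⟨x, hx, rfl⟩) | ⟨x, hx, rfl⟩) | ⟨x, hx, rfl⟩) | ⟨x, hx, rfl⟩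
    · refine ⟨0, 2, mg hx (t2 _ _ _), mg' hx rfl, by simp⟩
    · refine ⟨0, 4, mg' hx (t1 _ _ _), mg hx (t2 _ _ _), by simp⟩
    · refine ⟨1, 5, mg hx (t2 _ _ _), mg' hx (t1 _ _ _), by simp⟩
    · refine ⟨1, 3, mg' hx (t1 _ _ _), mg hx (t1 _ _ _), by simp⟩
    · refine ⟨2, 4, mg hx (t1 _ _ _), mg' hx (t1 _ _ _), by simp⟩

/-- The triangles `ABQ` and `DAQ` of a thin rhomb do not belong to the same tile: the thin
rhomb on which that tile is based would coincide with it. -/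
lemma _root_.Rhomb.not_holds_both (hs : s.kind = .thin) (hr : r.kind = .thin)
    (h0 : r.Holds s 0) (h1 : r.Holds s 1) : False := by
  have a := (h0.corner_eq (by decide)).2
  have b := (h1.corner_eq (by decide)).1
  rw [hr, hs] at a b
  exact h0.ne (by decide) (Rhomb.eq_of_corner_eq (hr.trans hs.symm)
    (show (1 : Fin 4) ≠ 3 by decide) a b)

lemma not_mem_interior_of_mem_skeleton (hP : IsPenroseTiling P) (hq : IsAdmissible q) {z : ℂ}
    (hz : z ∈ skeleton P q) (hr : r ∈ P) (hX : X.base = r.kind) :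
    z ∉ interior (r.tile q X) := by
  simp only [skeleton, Set.mem_iUnion] at hz
  obtain ⟨s, hs, hz⟩ := hz
  obtain ⟨i, j, hi, hj, hij⟩ := s.exists_pieces_of_mem_drawn hz
  obtain ⟨t, ht, hti⟩ := hP.exists_holder hs i
  obtain ⟨t', ht', htj⟩ := hP.exists_holder hs j
  refine hP.not_mem_interior_tile hq ht ht' (RhombKind.base_owner _ _) (RhombKind.base_owner _ _)
    ?_ (hti.piece_subset_tile hq hi) (htj.piece_subset_tile hq hj) hr hX
  rintro ⟨rfl, he⟩
  rcases hij with ⟨rfl, rfl, hk⟩ | ⟨h1, h2⟩ | ⟨rfl, rfl, hk⟩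
  · refine Rhomb.not_holds_both hk ?_ hti htj
    cases h : t.kind
    · rfl
    · rw [h] at he; cases he
  · refine hti.ne h1 ?_
    rwa [Rhomb.Holds, if_neg (not_lt.2 h2)] at htj
  · obtain rfl : t = s := hti
    rw [hk] at he; cases he

/-- The two drawn edges at the apex of a piece that is held by a neighbor. -/
lemma _root_.Rhomb.Holds.segment_subset {i : Fin 6} (h : r.Holds s i) (hi : i < 2) :
    (segment ℝ (r.corner (r.kind.holdSide i + 1)) (s.place.map (s.kind.tip q i)) ⊆ s.drawn q) ∧
      segment ℝ (r.corner (r.kind.holdSide i)) (s.place.map (s.kind.tip q i)) ⊆ s.drawn q := by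
  obtain ⟨h1, h2⟩ := h.corner_eq hi
  rw [h1, h2]
  obtain ⟨e1, e2, e3⟩ := s.kind.tip_eq q
  rw [segment_symm ℝ (s.corner (s.kind.flapSide i)),
    segment_symm ℝ (s.corner (s.kind.flapSide i + 1))]
  obtain rfl | rfl : i = 0 ∨ i = 1 := by omega
  · rw [e1]
    rcases s with ⟨κ, g⟩
    cases κ <;> simp only [Rhomb.drawn, RhombKind.flapSide] <;> constructor <;> intro z hz <;>
      simp_all
  · rcases s with ⟨κ, g⟩
    cases κ
    · rw [e2]
      simp only [Rhomb.drawn, RhombKind.flapSide]; constructor <;> intro z hz <;> simp_all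
    · rw [e3]
      simp only [Rhomb.drawn, RhombKind.flapSide]; constructor <;> intro z hz <;> simp_all

/-- The boundary of a tile is drawn. -/
lemma outline_subset_skeleton (hP : IsPenroseTiling P) (hr : r ∈ P) (hX : X.base = r.kind) :
    r.place.map '' X.outline q ⊆ skeleton P q := by
  have sub : ∀ {s : Rhomb} {S : Set ℂ}, s ∈ P → S ⊆ s.drawn q → S ⊆ skeleton P q :=
    fun hs hS => hS.trans (Set.subset_biUnion_of_mem (u := fun s : Rhomb => s.drawn q) hs)
  obtain ⟨s, hs, h⟩ := hP.exists_held hr 0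
  obtain ⟨s', hs', h'⟩ := hP.exists_held hr 1
  have h0 := omega_ne_zero
  obtain ⟨a1, a2⟩ := h.segment_subset (q := q) (by decide)
  obtain ⟨b1, b2⟩ := h'.segment_subset (q := q) (by decide)
  rw [h.map_tip (by decide)] at a1 a2
  rw [h'.map_tip (by decide)] at b1 b2
  replace a1 := sub hs a1
  replace a2 := sub hs a2
  replace b1 := sub hs' b1
  replace b2 := sub hs' b2
  have d := sub hr (subset_refl (r.drawn q))
  rcases r with ⟨κ, g⟩
  simp only [Rhomb.corner, ← Placement.image_segment] at a1 a2 b1 b2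
  cases X
  · obtain rfl : κ = .thick := hX.symm
    simp [RhombKind.holdSide, RhombKind.glueSide, RhombKind.refCorner, flapTip] at a1 a2
    simp only [Rhomb.drawn, Rhomb.corner, ← Placement.image_segment, RhombKind.refCorner,
      Matrix.cons_val, Set.union_subset_iff, Set.image_subset_iff] at d
    obtain ⟨⟨⟨⟨d1, -⟩, -⟩, d4⟩, d5⟩ := d
    rw [Set.image_subset_iff]
    simp only [TileKind.outline, Set.union_subset_iff]
    exact ⟨⟨⟨⟨segment_symm ℝ q 0 ▸ d1, d5⟩, d4⟩, a2⟩, a1⟩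
  · obtain rfl : κ = .thin := hX.symm
    simp [RhombKind.holdSide, RhombKind.glueSide, RhombKind.refCorner, flapTip] at a1 a2 b1 b2
    simp only [Rhomb.drawn, Rhomb.corner, ← Placement.image_segment, RhombKind.refCorner,
      Matrix.cons_val, Set.union_subset_iff, Set.image_subset_iff] at d
    obtain ⟨⟨-, d2⟩, d3⟩ := d
    have eU : 1 + omega + -(omega * q) = 1 + omega - omega * q := by ring
    have eV : omega + (1 - omega⁻¹ * q) = 1 + omega - omega⁻¹ * q := by ring
    rw [eU] at a1 a2
    rw [eV] at b1 b2
    rw [Set.image_subset_iff]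
    simp only [TileKind.outline, Set.union_subset_iff]
    exact ⟨⟨⟨⟨⟨b2, segment_symm ℝ omega _ ▸ b1⟩, segment_symm ℝ q omega ▸ d3⟩, d2⟩, a2⟩, a1⟩
  · obtain rfl : κ = .thick := hX.symm
    simp [RhombKind.holdSide, RhombKind.glueSide, RhombKind.refCorner, flapTip] at b1 b2
    simp only [Rhomb.drawn, Rhomb.corner, ← Placement.image_segment, RhombKind.refCorner,
      Matrix.cons_val, Set.union_subset_iff, Set.image_subset_iff] at d
    obtain ⟨⟨⟨⟨-, d2⟩, d3⟩, -⟩, d5⟩ := d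
    have eW : 1 + omega ^ 2 + -(omega ^ 2 * (1 - omega⁻¹ * q)) = 1 + omega * q := by
      field_simp; ring
    rw [eW] at b1 b2
    rw [Set.image_subset_iff]
    simp only [TileKind.outline, Set.union_subset_iff]
    exact ⟨⟨⟨⟨b2, segment_symm ℝ (1 + omega ^ 2) _ ▸ b1⟩, segment_symm ℝ (refS q) _ ▸ d3⟩,
      segment_symm ℝ q _ ▸ d5⟩, segment_symm ℝ q 1 ▸ d2⟩

lemma tile_subset (hP : IsPenroseTiling P) (hq : IsAdmissible q) (hr : r ∈ P)
    (hX : X.base = r.kind) : r.tile q X ⊆ interior (r.tile q X) ∪ skeleton P q := by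
  rintro _ ⟨w, hw, rfl⟩
  rcases hq.proto_subset X hw with hw | hw
  · refine .inl ?_
    rw [Rhomb.tile, ← Placement.image_interior]
    exact ⟨w, hw, rfl⟩
  · exact .inr (hP.outline_subset_skeleton hr hX ⟨w, hw, rfl⟩)

lemma exists_mem_tile (hP : IsPenroseTiling P) (hq : IsAdmissible q) (z : ℂ) :
    ∃ r ∈ P, ∃ X : TileKind, X.base = r.kind ∧ z ∈ r.tile q X := by
  have : z ∈ ⋃ r ∈ P, r.carrier := by rw [hP.cover]; trivial
  simp only [Set.mem_iUnion] at this
  obtain ⟨s, hs, hz⟩ := this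
  obtain ⟨i, hi⟩ := Rhomb.exists_piece hq hz
  obtain ⟨r, hr, h⟩ := hP.exists_holder hs i
  exact ⟨r, hr, _, r.kind.base_owner i, h.piece_subset_tile hq hi⟩

/-- The interior of a tile is connected, and together with the interiors of the other tiles it
covers the complement of the skeleton. -/
lemma connectedComponentIn_eq (hP : IsPenroseTiling P) (hq : IsAdmissible q) (hr : r ∈ P)
    (hX : X.base = r.kind) {z : ℂ} (hz : z ∈ interior (r.tile q X)) :
    connectedComponentIn (skeleton P q)ᶜ z = interior (r.tile q X) := by
  have sub : interior (r.tile q X) ⊆ (skeleton P q)ᶜ := fun w hw hws =>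
    hP.not_mem_interior_of_mem_skeleton hq hws hr hX hw
  refine Set.Subset.antisymm ?_ ?_
  · set V : Set ℂ := ⋃ (t : Rhomb) (Y : TileKind) (_ : t ∈ P) (_ : Y.base = t.kind)
      (_ : ¬(r = t ∧ X = Y)), interior (t.tile q Y) with hV
    have hVo : IsOpen V := by
      refine isOpen_iUnion fun t => isOpen_iUnion fun Y => isOpen_iUnion fun _ =>
        isOpen_iUnion fun _ => isOpen_iUnion fun _ => isOpen_interior
    refine isPreconnected_connectedComponentIn.subset_left_of_subset_union isOpen_interior hVo
      ?_ ?_ ⟨z, mem_connectedComponentIn (sub hz), hz⟩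
    · rw [Set.disjoint_left]
      intro w hw hw'
      simp only [hV, Set.mem_iUnion] at hw'
      obtain ⟨t, Y, ht, hY, hne, hw'⟩ := hw'
      exact hne (hP.tile_unique hq hr ht hX hY hw (interior_subset hw'))
    · intro w hw
      have hws : w ∉ skeleton P q := connectedComponentIn_subset _ _ hw
      obtain ⟨t, ht, Y, hY, hwt⟩ := hP.exists_mem_tile hq w
      have hwi : w ∈ interior (t.tile q Y) := (hP.tile_subset hq ht hY hwt).resolve_right hws
      by_cases he : r = t ∧ X = Y
      · obtain ⟨rfl, rfl⟩ := he
        exact .inl hwi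
      · refine .inr ?_
        simp only [hV, Set.mem_iUnion]
        exact ⟨t, Y, ht, hY, he, hwi⟩
  · refine IsPreconnected.subset_connectedComponentIn ?_ hz sub
    rw [Rhomb.tile, ← Placement.image_interior]
    refine (hq.isPreconnected_interior_proto X).image _ ?_
    rw [← r.place.coe_homeo]
    exact r.place.homeo.continuous.continuousOn

lemma interior_tile_nonempty (hq : IsAdmissible q) (r : Rhomb) (X : TileKind) :
    (interior (r.tile q X)).Nonempty := by
  rw [← closure_nonempty_iff, Rhomb.closure_interior_tile hq, Rhomb.tile, Set.image_nonempty]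
  cases X
  · exact ⟨0, subset_convexHull ℝ _ (by simp)⟩
  · exact ⟨1, subset_convexHull ℝ _ (by simp)⟩
  · exact ⟨1, .inl (subset_convexHull ℝ _ (by simp))⟩

/-- The regions into which the drawn edges divide the plane are the expected copies of the
prototiles. -/
theorem mem_ammannTiling (hP : IsPenroseTiling P) (hq : IsAdmissible q) {T : Set ℂ} :
    T ∈ ammannTiling P q ↔ ∃ r ∈ P, ∃ X : TileKind, X.base = r.kind ∧ T = r.tile q X := by
  constructor
  · rintro ⟨z, hz, rfl⟩
    obtain ⟨r, hr, X, hX, hzr⟩ := hP.exists_mem_tile hq z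
    refine ⟨r, hr, X, hX, ?_⟩
    rw [hP.connectedComponentIn_eq hq hr hX ((hP.tile_subset hq hr hX hzr).resolve_right hz),
      Rhomb.closure_interior_tile hq]
  · rintro ⟨r, hr, X, hX, rfl⟩
    obtain ⟨z, hz⟩ := interior_tile_nonempty hq r X
    refine ⟨z, fun h => hP.not_mem_interior_of_mem_skeleton hq h hr hX hz, ?_⟩
    rw [hP.connectedComponentIn_eq hq hr hX hz, Rhomb.closure_interior_tile hq]

/-- The tiles of type `A` are those placed like the prototile `A`: the interior of a quadrilateral
`HERS` meets the interior of no other tile. -/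
theorem isTileA_iff (hP : IsPenroseTiling P) (hq : IsAdmissible q) {T : Set ℂ} :
    IsTileA P q T ↔ ∃ r ∈ P, r.kind = .thick ∧ T = r.tile q .A := by
  have quad : ∀ r : Rhomb, r.kind = .thick → r.quadHERS q ⊆ r.tile q .A ∧
      (interior (r.quadHERS q)).Nonempty := by
    intro r hr
    rcases r with ⟨κ, g⟩
    obtain rfl : κ = .thick := hr
    have e : Rhomb.quadHERS q ⟨.thick, g⟩ = g.map '' convexHull ℝ {omega ^ 2, 0, q, refS q} := by
      rw [Placement.image_convexHull]
      simp [Rhomb.quadHERS, Rhomb.corner, Set.image_insert_eq, RhombKind.refCorner]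
    rw [e, Rhomb.tile]
    refine ⟨Set.image_mono (convexHull_mono ?_), ?_⟩
    · simp [Set.insert_subset_iff]
    · rw [← Placement.image_interior, Set.image_nonempty]
      refine (interior_triangle_nonempty hq.cross_OQS).mono (interior_mono (convexHull_mono ?_))
      simp
  rw [IsTileA, hP.mem_ammannTiling hq]
  constructor
  · rintro ⟨⟨t, ht, Y, hY, rfl⟩, r, hr, hk, hsub⟩
    obtain ⟨h1, z, hz⟩ := quad r hk
    obtain ⟨rfl, rfl⟩ := hP.tile_unique hq ht hr hY (X := Y) (Y := .A) hk.symm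
      (interior_mono hsub hz) (h1 (interior_subset hz))
    exact ⟨t, ht, hk, rfl⟩
  · rintro ⟨r, hr, hk, rfl⟩
    exact ⟨⟨r, hr, .A, hk.symm, rfl⟩, r, hr, hk, (quad r hk).1⟩

end IsPenroseTiling

/-! ### Coronas of the `A` tiles -/

lemma mem_interior_or_mem_segment {K : Set ℂ} (hK : Convex ℝ K) {u v w z : ℂ} (hu : u ∈ K)
    (hv : v ∈ K) (hw : w ∈ interior K) (hz : z ∈ triangle u v w) :
    z ∈ interior K ∨ z ∈ segment ℝ u v := by
  rw [← triangle_rotate, ← triangle_rotate, triangle, convexHull_insert (by simp),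
    convexHull_pair, convexJoin_singleton_left] at hz
  simp only [Set.mem_iUnion] at hz
  obtain ⟨m, hm, a, b, ha, hb, hab, rfl⟩ := hz
  rcases ha.eq_or_lt with rfl | ha
  · obtain rfl : b = 1 := by linarith
    simp [hm]
  · exact .inl (hK.combo_interior_self_mem_interior hw (hK.segment_subset hu hv hm) ha hb hab)

lemma mem_interior_or_eq {K : Set ℂ} (hK : Convex ℝ K) {u v w z : ℂ} (hu : u ∈ K)
    (hv : v ∈ interior K) (hw : w ∈ interior K) (hz : z ∈ triangle u v w) :
    z ∈ interior K ∨ z = u := by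
  rcases mem_interior_or_mem_segment hK hu (interior_subset hv) hw hz with h | h
  · exact .inl h
  rw [segment_symm] at h
  obtain ⟨a, b, ha, hb, hab, rfl⟩ := h
  rcases ha.eq_or_lt with rfl | ha
  · obtain rfl : b = 1 := by linarith
    simp
  · exact .inl (hK.combo_interior_self_mem_interior hv hu ha hb hab)

lemma triangle_swap (u v w : ℂ) : triangle u w v = triangle u v w := by
  rw [triangle, Set.pair_comm, triangle]

namespace Rhomb

lemma corner_not_mem_interior (r : Rhomb) (i : Fin 4) : r.corner i ∉ interior r.carrier :=
  (r.side_subset (left_mem_segment ℝ (r.corner i) (r.corner (i + 1)))).2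

end Rhomb

namespace IsPenroseTiling

variable {P : Set Rhomb} {q : ℂ} {r s t n : Rhomb} {X Y : TileKind}

lemma mem_corona (hP : IsPenroseTiling P) (hq : IsAdmissible q) {T : Set ℂ} (ht : t ∈ P)
    (hY : Y.base = t.kind) {z w : ℂ} (hzw : z ≠ w) (hz : z ∈ T) (hw : w ∈ T)
    (hz' : z ∈ t.tile q Y) (hw' : w ∈ t.tile q Y) :
    t.tile q Y ∈ corona (ammannTiling P q) T :=
  ⟨(hP.mem_ammannTiling hq).2 ⟨t, ht, Y, hY, rfl⟩, z, ⟨hz, hz'⟩, w, ⟨hw, hw'⟩, hzw⟩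

/-- A corner of a rhomb is not interior to any rhomb. -/
lemma corner_not_mem_interior (hP : IsPenroseTiling P) (hr : r ∈ P) (hs : s ∈ P) (i : Fin 4) :
    r.corner i ∉ interior s.carrier := by
  intro h
  obtain rfl := hP.eq_of_mem_interior hs hr h (r.corner_mem i)
  exact s.corner_not_mem_interior i h

lemma _root_.Rhomb.openSegment_subset_interior_tileA (hq : IsAdmissible q)
    (hk : r.kind = .thick) : openSegment ℝ (r.corner 0) (r.corner 3) ⊆ interior (r.tile q .A) := by
  have e := hq.protoA_eq
  have h : openSegment ℝ 0 (omega ^ 2) ⊆ interior (protoA q) := by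
    refine (openSegment_subset_interior_union hq.cross_OHR
      (cross_pos_rotate (cross_pos_rotate hq.cross_OSH))).trans (interior_mono ?_)
    rw [← triangle_rotate (omega ^ 2) 0 (refS q), e]
    exact Set.union_subset Set.subset_union_right
      (Set.subset_union_right.trans Set.subset_union_left)
  rw [Rhomb.tile, ← Placement.image_interior, Rhomb.corner, Rhomb.corner, hk]
  refine Set.Subset.trans ?_ (Set.image_mono h)
  rintro _ ⟨a, b, ha, hb, hab, rfl⟩
  refine ⟨a • 0 + b • omega ^ 2, ⟨a, b, ha, hb, hab, rfl⟩, ?_⟩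
  have hab' : (a : ℂ) + b = 1 := by exact_mod_cast hab
  simp [Placement.map, RhombKind.refCorner]
  linear_combination -r.place.pos * hab'

/-- Apart from the points `E` and `H`, an `A` tile lies in the interior of the union of the rhomb
on which it is based and the neighbor across the side `HE`. -/
lemma _root_.Rhomb.mem_interior_of_mem_tileA (hq : IsAdmissible q) (hk : r.kind = .thick)
    (hn : r.Holds n 0) {z : ℂ} (hz : z ∈ r.tile q .A) :
    z ∈ interior r.carrier ∨ (z ∈ interior n.carrier ∧ z ∈ n.piece q 0) ∨
      z ∈ interior (r.tile q .A) ∨ z = r.corner 0 ∨ z = r.corner 3 := by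
  have hp := hn.piece_eq (q := q)
  have hseg : ∀ w ∈ segment ℝ (0 : ℂ) (omega ^ 2), r.place.map w ∈ interior (r.tile q .A) ∨
      r.place.map w = r.corner 0 ∨ r.place.map w = r.corner 3 := by
    intro w hw
    have hm : r.place.map w ∈ segment ℝ (r.corner 0) (r.corner 3) := by
      rw [Rhomb.corner, Rhomb.corner, ← Placement.image_segment, hk]; exact ⟨w, hw, rfl⟩
    rw [← insert_endpoints_openSegment] at hm
    rcases hm with hm | hm | hm
    · exact .inr (.inl hm)
    · exact .inr (.inr hm)
    · exact .inl (Rhomb.openSegment_subset_interior_tileA hq hk hm)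
  obtain ⟨w, hw, rfl⟩ := hz
  have hconv := convex_convexHull ℝ (Set.range r.kind.refCorner)
  have h0 : (0 : ℂ) ∈ r.kind.region := r.kind.zero_mem
  have hH : omega ^ 2 ∈ r.kind.region := by rw [hk]; exact RhombKind.tau_mem .thick
  have hQ : q ∈ interior r.kind.region := hq.mem_interior _
  have hS : refS q ∈ interior r.kind.region := by rw [hk]; exact hq.refS_mem_interior
  rw [r.interior_carrier, r.place.map_injective.mem_set_image]
  rw [TileKind.proto, hq.protoA_eq] at hw
  rcases hw with (hw | hw) | hw
  · rcases mem_interior_or_eq hconv h0 hQ hS hw with hw | rfl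
    · exact .inl hw
    · exact .inr (.inr (.inr (.inl (by simp [Rhomb.corner, hk, RhombKind.refCorner]))))
  · rw [triangle_swap] at hw
    rcases mem_interior_or_mem_segment hconv h0 hH hS hw with hw | hw
    · exact .inl hw
    · exact .inr (.inr (hseg w hw))
  · have hz : r.place.map w ∈ n.piece q 0 := by
      rw [hp, hk]; exact ⟨w, hw, rfl⟩
    rw [Rhomb.piece] at hz
    obtain ⟨v, hv, hvw⟩ := id hz
    rw [RhombKind.piece_eq_tip q _ (by decide), (n.kind.tip_eq q).1] at hv
    have hc := hn.corner_eq (by decide)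
    rcases mem_interior_or_mem_segment (convex_convexHull ℝ (Set.range n.kind.refCorner))
      (subset_convexHull ℝ _ (Set.mem_range_self _)) (subset_convexHull ℝ _ (Set.mem_range_self _))
      (hq.mem_interior _) hv with hv | hv
    · refine .inr (.inl ⟨?_, hz⟩)
      rw [n.interior_carrier]
      exact ⟨v, hv, hvw⟩
    · refine .inr (.inr (hseg w ?_))
      have hm : n.place.map v ∈ segment ℝ (n.corner (n.kind.flapSide 0))
          (n.corner (n.kind.flapSide 0 + 1)) := by
        rw [Rhomb.corner, Rhomb.corner, ← Placement.image_segment]; exact ⟨v, hv, rfl⟩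
      rw [← hc.1, ← hc.2, hvw, Rhomb.corner, Rhomb.corner, ← Placement.image_segment,
        r.place.map_injective.mem_set_image, hk] at hm
      exact hm

/-- If a tile contains two corners of rhombs, then it contains the segment between them. This
needs an argument for the tiles `C`, which need not be convex: their part beyond the diagonal `FS`
contains no corner but `F`. -/
lemma segment_subset_tile (hP : IsPenroseTiling P) (hq : IsAdmissible q) (hr : r ∈ P) (ht : t ∈ P)
    (hY : Y.base = t.kind) {i j : Fin 4} (hi : r.corner i ∈ t.tile q Y)
    (hj : r.corner j ∈ t.tile q Y) : segment ℝ (r.corner i) (r.corner j) ⊆ t.tile q Y := by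
  have main : ∀ s : Set ℂ, t.place.map '' convexHull ℝ s ⊆ t.tile q Y →
      r.corner i ∈ t.place.map '' convexHull ℝ s → r.corner j ∈ t.place.map '' convexHull ℝ s →
      segment ℝ (r.corner i) (r.corner j) ⊆ t.tile q Y := by
    intro s hs h1 h2
    rw [Placement.image_convexHull] at hs h1 h2
    exact ((convex_convexHull ℝ _).segment_subset h1 h2).trans hs
  cases Y
  · exact main _ subset_rfl hi hj
  · exact main _ subset_rfl hi hj
  · have corner : ∀ k, r.corner k ∈ t.tile q .C → r.corner k ∈ t.place.map ''
        convexHull ℝ {1 + omega ^ 2, 1 + omega * q, 1, refS q} := by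
      rintro k ⟨w, hw, hwk⟩
      refine ⟨w, ?_, hwk⟩
      rcases hw with hw | hw
      · exact hw
      have hnot := hP.corner_not_mem_interior hr ht k
      rw [t.interior_carrier, ← hwk, t.place.map_injective.mem_set_image] at hnot
      rcases mem_interior_or_eq (convex_convexHull ℝ _) t.kind.one_mem (hq.mem_interior _)
        (by rw [← hY]; exact hq.refS_mem_interior) hw with hw | rfl
      · exact absurd hw hnot
      · exact subset_convexHull ℝ _ (by simp)
    exact main _ (Set.image_mono Set.subset_union_left) (corner i hi) (corner j hj)

lemma _root_.Rhomb.disjoint_piece_zero_one (hq : IsAdmissible q) (hk : n.kind = .thick) :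
    Disjoint (n.piece q 0) (n.piece q 1) := by
  obtain ⟨h1, h2, h3⟩ := hq.im_lt
  rw [Rhomb.piece, Rhomb.piece, Set.disjoint_image_iff n.place.map_injective, hk,
    Set.disjoint_left]
  intro z hz hz'
  have a : cross q (q + 1) z ≤ 0 := by
    refine cross_nonpos_of_mem_triangle ?_ ?_ ?_ hz <;> rw [cross_add_one] <;> simp <;> linarith
  have b : 0 ≤ cross (refS q) (refS q + 1) z := by
    refine cross_nonneg_of_mem_triangle ?_ ?_ ?_ hz' <;> rw [cross_add_one] <;> simp <;> linarith
  rw [cross_add_one] at a b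
  linarith

/-- A tile that meets the `A` tile of `r` outside of `E` and `H` contains a piece of `r` or of the
neighbor `n`. -/
lemma exists_piece_of_meets (hP : IsPenroseTiling P) (hq : IsAdmissible q) (hr : r ∈ P)
    (hk : r.kind = .thick) (hnP : n ∈ P) (hn : r.Holds n 0) (ht : t ∈ P) (hY : Y.base = t.kind)
    (hne : ¬(r = t ∧ .A = Y)) {x : ℂ} (hx : x ∈ r.tile q .A) (hx' : x ∈ t.tile q Y)
    (h0 : x ≠ r.corner 0) (h3 : x ≠ r.corner 3) :
    ∃ s i, t.Holds s i ∧ t.kind.owner i = Y ∧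
      (s = r ∨ s = n ∧ i ≠ 0 ∧ (n.kind = .thick → i ≠ 1)) := by
  obtain ⟨s, hs, i, hi, hiY, hxs⟩ := hP.exists_mem_piece hq ht hY hx'
  refine ⟨s, i, hi, hiY, ?_⟩
  rcases Rhomb.mem_interior_of_mem_tileA hq hk hn hx with h | ⟨h, hp⟩ | h | h | h
  · exact .inl (hP.eq_of_mem_interior hr hs h (s.piece_subset hq i hxs)).symm
  · obtain rfl := hP.eq_of_mem_interior hnP hs h (s.piece_subset hq i hxs)
    refine .inr ⟨rfl, ?_, ?_⟩
    · rintro rfl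
      obtain rfl := hP.holder_unique hr ht hn hi
      rw [hk] at hiY
      exact hne ⟨rfl, hiY⟩
    · rintro hnk rfl
      exact Set.disjoint_left.1 (n.disjoint_piece_zero_one hq hnk) hp hxs
  · exact absurd (hP.tile_unique (X := .A) hq hr ht hk.symm hY h hx') hne
  · exact absurd h h0
  · exact absurd h h3

/-- A tile whose common points with the `A` tile were only `E` and `H` would contain the side `EH`,
whose midpoint is interior to the `A` tile. -/
lemma exists_piece_of_mem_corona (hP : IsPenroseTiling P) (hq : IsAdmissible q) (hr : r ∈ P)
    (hk : r.kind = .thick) (hnP : n ∈ P) (hn : r.Holds n 0) (ht : t ∈ P) (hY : Y.base = t.kind)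
    (hne : ¬(r = t ∧ .A = Y)) (h : t.tile q Y ∈ corona (ammannTiling P q) (r.tile q .A)) :
    ∃ s i, t.Holds s i ∧ t.kind.owner i = Y ∧
      (s = r ∨ s = n ∧ i ≠ 0 ∧ (n.kind = .thick → i ≠ 1)) := by
  have main : ∀ x ∈ r.tile q .A ∩ t.tile q Y, x ≠ r.corner 0 → x ≠ r.corner 3 → _ :=
    fun x hx => hP.exists_piece_of_meets hq hr hk hnP hn ht hY hne hx.1 hx.2
  obtain ⟨-, x, hx, y, hy, hxy⟩ := h
  by_contra hcon
  have hx2 : x = r.corner 0 ∨ x = r.corner 3 := by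
    by_contra! hc; exact hcon (main x hx hc.1 hc.2)
  have hy2 : y = r.corner 0 ∨ y = r.corner 3 := by
    by_contra! hc; exact hcon (main y hy hc.1 hc.2)
  have hc : r.corner 0 ∈ t.tile q Y ∧ r.corner 3 ∈ t.tile q Y := by
    rcases hx2 with rfl | rfl <;> rcases hy2 with rfl | rfl
    · exact absurd rfl hxy
    · exact ⟨hx.2, hy.2⟩
    · exact ⟨hy.2, hx.2⟩
    · exact absurd rfl hxy
  -- the midpoint of `EH` is interior to the `A` tile
  have hm : midpoint ℝ (r.corner 0) (r.corner 3) ∈ openSegment ℝ (r.corner 0) (r.corner 3) :=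
    ⟨1 / 2, 1 / 2, by norm_num, by norm_num, by norm_num, by
      rw [midpoint_eq_smul_add, smul_add]; simp⟩
  exact hne (hP.tile_unique (X := .A) hq hr ht hk.symm hY
    (Rhomb.openSegment_subset_interior_tileA hq hk hm)
    (hP.segment_subset_tile hq hr ht hY hc.1 hc.2 (openSegment_subset_segment ℝ _ _ hm)))

lemma _root_.Rhomb.map_mem_tile (hq : IsAdmissible q) {s : Rhomb} {i : Fin 6} (h : t.Holds s i)
    {z : ℂ} (hz : z ∈ s.kind.piece q i) : s.place.map z ∈ t.tile q (t.kind.owner i) :=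
  h.piece_subset_tile hq ⟨z, hz, rfl⟩

/-- Tiles with pieces of the same rhomb `s` that have two points in common. -/
lemma mem_corona_of_piece (hP : IsPenroseTiling P) (hq : IsAdmissible q) {i j : Fin 6}
    (ht : t ∈ P) (hri : r.Holds s i) (htj : t.Holds s j) {z w : ℂ} (hzw : z ≠ w)
    (hz : z ∈ s.kind.piece q i) (hw : w ∈ s.kind.piece q i) (hz' : z ∈ s.kind.piece q j)
    (hw' : w ∈ s.kind.piece q j) : t.tile q (t.kind.owner j) ∈
      corona (ammannTiling P q) (r.tile q (r.kind.owner i)) :=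
  hP.mem_corona hq ht (RhombKind.base_owner _ _) (s.place.map_injective.ne hzw)
    (Rhomb.map_mem_tile hq hri hz) (Rhomb.map_mem_tile hq hri hw) (Rhomb.map_mem_tile hq htj hz')
    (Rhomb.map_mem_tile hq htj hw')

lemma self_mem_corona (hP : IsPenroseTiling P) (hq : IsAdmissible q) (hr : r ∈ P)
    (hk : r.kind = .thick) :
    r.tile q .A ∈ corona (ammannTiling P q) (r.tile q .A) := by
  have h0 : (0 : ℂ) ∈ protoA q := subset_convexHull ℝ _ (by simp)
  have h1 : q ∈ protoA q := subset_convexHull ℝ _ (by simp)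
  exact hP.mem_corona hq hr hk.symm
    (r.place.map_injective.ne (ne_of_cross_pos hq.cross_OIQ).2.2) ⟨0, h0, rfl⟩ ⟨q, h1, rfl⟩
    ⟨0, h0, rfl⟩ ⟨q, h1, rfl⟩

/-- The part of the corona that does not depend on the neighbor across `HE`: the tile itself, the
`C` tile of the same rhomb, and the tiles that contain `EFR` and `GHS`. -/
lemma subset_corona (hP : IsPenroseTiling P) (hq : IsAdmissible q) (hr : r ∈ P)
    (hk : r.kind = .thick) {t₀ t₁ : Rhomb} (ht₀ : t₀ ∈ P) (ht₁ : t₁ ∈ P) (h₀ : t₀.Holds r 0)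
    (h₁ : t₁.Holds r 1) :
    {r.tile q .A, r.tile q .C, t₀.tile q (t₀.kind.owner 0), t₁.tile q (t₁.kind.owner 1)} ⊆
      corona (ammannTiling P q) (r.tile q .A) := by
  have hr2 : r.Holds r 2 := by simp [Rhomb.Holds]
  have hr3 : r.Holds r 3 := rfl
  have hr4 : r.Holds r 4 := rfl
  have hA2 : r.kind.owner 2 = .A := by rw [hk]; rfl
  have hA3 : r.kind.owner 3 = .A := by rw [hk]; rfl
  have hC4 : r.kind.owner 4 = .C := by rw [hk]; rfl
  simp only [Set.insert_subset_iff, Set.singleton_subset_iff]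
  refine ⟨hP.self_mem_corona hq hr hk, ?_, ?_, ?_⟩
  · have := hP.mem_corona_of_piece hq (i := 2) (j := 4) hr hr2 hr4
      (ne_of_cross_pos hq.cross_OQS).2.1 ?_ ?_ ?_ ?_
    · rwa [hA2, hC4] at this
    all_goals rw [hk]; exact subset_convexHull ℝ _ (by simp)
  · have := hP.mem_corona_of_piece hq (i := 2) (j := 0) ht₀ hr2 h₀
      (ne_of_cross_pos hq.cross_OQS).1 ?_ ?_ ?_ ?_
    · rwa [hA2] at this
    all_goals rw [hk]; exact subset_convexHull ℝ _ (by simp)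
  · have := hP.mem_corona_of_piece hq (i := 3) (j := 1) ht₁ hr3 h₁
      (ne_of_cross_pos hq.cross_OSH).2.1 ?_ ?_ ?_ ?_
    · rwa [hA3] at this
    all_goals rw [hk]; exact subset_convexHull ℝ _ (by simp)

/-- A tile of the corona that is not in the list of `subset_corona` contains a piece of the neighbor
`n` across `HE`: not `EFR` or `ABQ`, which belongs to the `A` tile, and not `GHS`. -/
lemma corona_subset (hP : IsPenroseTiling P) (hq : IsAdmissible q) (hr : r ∈ P)
    (hk : r.kind = .thick) {t₀ t₁ : Rhomb} (ht₀ : t₀ ∈ P) (ht₁ : t₁ ∈ P) (h₀ : t₀.Holds r 0)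
    (h₁ : t₁.Holds r 1) (hnP : n ∈ P) (hn : r.Holds n 0) {T : Set ℂ}
    (hT : T ∈ corona (ammannTiling P q) (r.tile q .A)) :
    T ∈ ({r.tile q .A, r.tile q .C, t₀.tile q (t₀.kind.owner 0),
      t₁.tile q (t₁.kind.owner 1)} : Set (Set ℂ)) ∨
      ∃ t ∈ P, ∃ i, t.Holds n i ∧ T = t.tile q (t.kind.owner i) ∧ i ≠ 0 ∧
        (n.kind = .thick → i ≠ 1) := by
  obtain ⟨t, ht, Y, hY, rfl⟩ := (hP.mem_ammannTiling hq).1 hT.1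
  by_cases he : r = t ∧ .A = Y
  · obtain ⟨rfl, rfl⟩ := he
    exact .inl (.inl rfl)
  obtain ⟨s, i, hi, rfl, rfl | ⟨rfl, h1, h2⟩⟩ :=
    hP.exists_piece_of_mem_corona hq hr hk hnP hn ht hY he hT
  · left
    have own : 2 ≤ i → t.tile q (t.kind.owner i) = s.tile q .A ∨
        t.tile q (t.kind.owner i) = s.tile q .C := by
      intro h2
      rw [Rhomb.Holds, if_neg (not_lt.2 h2)] at hi
      subst hi
      rw [hk]
      fin_cases i <;> simp [RhombKind.owner]
    by_cases h2 : 2 ≤ i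
    · rcases own h2 with h | h <;> rw [h] <;> simp
    obtain rfl | rfl : i = 0 ∨ i = 1 := by omega
    · rw [hP.holder_unique ht ht₀ hi h₀]; simp
    · rw [hP.holder_unique ht ht₁ hi h₁]; simp
  · exact .inr ⟨t, ht, i, hi, rfl, h1, h2⟩

/-- If the neighbor `n` across `HE` is thin, then the corona is completed by the `B` tile of `n` and
the tile that contains its triangle `DAQ`. -/
theorem corona_eq_of_thin (hP : IsPenroseTiling P) (hq : IsAdmissible q) (hr : r ∈ P)
    (hk : r.kind = .thick) {t₀ t₁ m : Rhomb} (ht₀ : t₀ ∈ P) (ht₁ : t₁ ∈ P) (h₀ : t₀.Holds r 0)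
    (h₁ : t₁.Holds r 1) (hnP : n ∈ P) (hn : r.Holds n 0) (hnk : n.kind = .thin) (hm : m ∈ P)
    (hmn : m.Holds n 1) : corona (ammannTiling P q) (r.tile q .A) =
      {r.tile q .A, r.tile q .C, t₀.tile q (t₀.kind.owner 0), t₁.tile q (t₁.kind.owner 1)} ∪
        {n.tile q .B, m.tile q (m.kind.owner 1)} := by
  refine Set.Subset.antisymm (fun T hT => ?_) (Set.union_subset
    (hP.subset_corona hq hr hk ht₀ ht₁ h₀ h₁) ?_)
  · refine (hP.corona_subset hq hr hk ht₀ ht₁ h₀ h₁ hnP hn hT).imp_right ?_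
    rintro ⟨t, ht, i, hi, rfl, h0, -⟩
    by_cases h2 : 2 ≤ i
    · rw [Rhomb.Holds, if_neg (not_lt.2 h2)] at hi
      subst hi
      rw [hnk]
      exact .inl rfl
    · obtain rfl : i = 1 := by omega
      rw [hP.holder_unique ht hm hi hmn]; simp
  · have hA : r.kind.owner 0 = .A := by rw [hk]; rfl
    have hB : n.kind.owner 3 = .B := by rw [hnk]; rfl
    have h3 : n.Holds n 3 := rfl
    simp only [Set.insert_subset_iff, Set.singleton_subset_iff]
    refine ⟨?_, ?_⟩
    · have := hP.mem_corona_of_piece hq (i := 0) (j := 3) hnP hn h3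
        (ne_of_cross_pos hq.cross_OIQ).2.1 ?_ ?_ ?_ ?_
      · rwa [hA, hB] at this
      all_goals rw [hnk]; exact subset_convexHull ℝ _ (by simp)
    · have := hP.mem_corona_of_piece hq (i := 0) (j := 1) hm hn hmn
        (ne_of_cross_pos hq.cross_OIQ).2.2 ?_ ?_ ?_ ?_
      · rwa [hA] at this
      all_goals rw [hnk]; exact subset_convexHull ℝ _ (by simp)

/-- If the neighbor `n` across `HE` is thick, then the corona is completed by the two tiles of `n`.
Its triangle `GHS` does not meet its triangle `EFR`, which belongs to the `A` tile. -/
theorem corona_eq_of_thick (hP : IsPenroseTiling P) (hq : IsAdmissible q) (hr : r ∈ P)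
    (hk : r.kind = .thick) {t₀ t₁ : Rhomb} (ht₀ : t₀ ∈ P) (ht₁ : t₁ ∈ P) (h₀ : t₀.Holds r 0)
    (h₁ : t₁.Holds r 1) (hnP : n ∈ P) (hn : r.Holds n 0) (hnk : n.kind = .thick) :
    corona (ammannTiling P q) (r.tile q .A) =
      {r.tile q .A, r.tile q .C, t₀.tile q (t₀.kind.owner 0), t₁.tile q (t₁.kind.owner 1)} ∪
        {n.tile q .A, n.tile q .C} := by
  refine Set.Subset.antisymm (fun T hT => ?_) (Set.union_subset
    (hP.subset_corona hq hr hk ht₀ ht₁ h₀ h₁) ?_)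
  · refine (hP.corona_subset hq hr hk ht₀ ht₁ h₀ h₁ hnP hn hT).imp_right ?_
    rintro ⟨t, ht, i, hi, rfl, h0, h1⟩
    have h2 : 2 ≤ i := by have := h1 hnk; omega
    rw [Rhomb.Holds, if_neg (not_lt.2 h2)] at hi
    subst hi
    rw [hnk]
    fin_cases i <;> simp_all [RhombKind.owner]
  · have hA : r.kind.owner 0 = .A := by rw [hk]; rfl
    have hA2 : n.kind.owner 2 = .A := by rw [hnk]; rfl
    have hC4 : n.kind.owner 4 = .C := by rw [hnk]; rfl
    have h2 : n.Holds n 2 := rfl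
    have h4 : n.Holds n 4 := rfl
    simp only [Set.insert_subset_iff, Set.singleton_subset_iff]
    refine ⟨?_, ?_⟩
    · have := hP.mem_corona_of_piece hq (i := 0) (j := 2) hnP hn h2
        (ne_of_cross_pos hq.cross_OIQ).2.2 ?_ ?_ ?_ ?_
      · rwa [hA, hA2] at this
      all_goals rw [hnk]; exact subset_convexHull ℝ _ (by simp)
    · have := hP.mem_corona_of_piece hq (i := 0) (j := 4) hnP hn h4
        (ne_of_cross_pos hq.cross_OIQ).2.1 ?_ ?_ ?_ ?_
      · rwa [hA, hC4] at this
      all_goals rw [hnk]; exact subset_convexHull ℝ _ (by simp)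

end IsPenroseTiling

/-! ### The five coronas -/

lemma Rhomb.tile_toRhomb (q : ℂ) (g : Placement) (u : LatticeRhomb) (X : TileKind) {p : ℂ}
    (hp : u.pos.val = p) : (u.toRhomb g).tile q X = g.map '' moved p u.dir (X.proto q) := by
  rw [Rhomb.tile, moved, Set.image_image, ← hp]
  exact Set.image_congr fun z _ => g.map_sub_apply _ _ z

lemma LatticeRhomb.holds (g : Placement) {s t : LatticeRhomb} {i : Fin 6} (hi : i < 2)
    (h : s.neighbor (s.kind.flapSide i) t.kind = t) : (t.toRhomb g).Holds (s.toRhomb g) i := by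
  rw [Rhomb.Holds, if_pos hi, ← h]
  exact LatticeRhomb.isNeighbor_neighbor g s _ t.kind

namespace IsPenroseTiling

variable {P : Set Rhomb} {q : ℂ}

/-- The corona that belongs to each of the five patterns. -/
theorem corona_eq_coronaOfA (hP : IsPenroseTiling P) (hq : IsAdmissible q) {r : Rhomb}
    (hr : r ∈ P) (hk : r.kind = .thick) {k : Fin 5} (h : HasPattern P r k) :
    corona (ammannTiling P q) (r.tile q .A) =
      (fun X => r.place.map '' X) '' coronaOfA q k := by
  set g := r.place with hg
  have hr0 : thickOrigin.toRhomb g = r := toRhomb_thickOrigin r hk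
  have hA : r.tile q .A = g.map '' protoA q := rfl
  have hC : r.tile q .C = g.map '' protoC q := rfl
  have h4 : omega ^ 4 = omega ^ 3 - omega ^ 2 + omega - 1 := by
    linear_combination omega_pow_four - omega_pow_three + omega_sq
  have h6 : omega ^ 6 = -omega := by linear_combination omega * omega_pow_five
  have h9 : omega ^ 9 = -omega ^ 4 := by linear_combination omega ^ 4 * omega_pow_five
  have tile := fun u X p hp => Rhomb.tile_toRhomb q g u X (p := p) hp
  have tB2 : (LatticeRhomb.toRhomb g ⟨.thin, (0, 0, 0, 0), 2⟩).tile q .B =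
      g.map '' moved 0 2 (protoB q) := tile _ .B _ (by simp [Coeffs.val])
  have tB4 : (LatticeRhomb.toRhomb g ⟨.thin, (2, -1, 1, -1), 4⟩).tile q .B =
      g.map '' moved (1 + omega ^ 9) 4 (protoB q) :=
    tile _ .B _ (by rw [h9, h4]; simp [Coeffs.val]; ring)
  have tB8 : (LatticeRhomb.toRhomb g ⟨.thin, (-1, 1, -1, 2), 8⟩).tile q .B =
      g.map '' moved (omega ^ 3 + omega ^ 4) 8 (protoB q) :=
    tile _ .B _ (by rw [h4]; simp [Coeffs.val]; ring)
  have tB5 : (LatticeRhomb.toRhomb g ⟨.thin, (1, 1, 1, 0), 5⟩).tile q .B =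
      g.map '' moved (1 + omega + omega ^ 2) 5 (protoB q) := tile _ .B _ (by simp [Coeffs.val])
  have tC1 : (LatticeRhomb.toRhomb g ⟨.thick, (0, -1, 0, 0), 1⟩).tile q .C =
      g.map '' moved (omega ^ 6) 1 (protoC q) := tile _ .C _ (by rw [h6]; simp [Coeffs.val])
  have tC8 : (LatticeRhomb.toRhomb g ⟨.thick, (0, 0, 1, 1), 8⟩).tile q .C =
      g.map '' moved (omega ^ 2 + omega ^ 3) 8 (protoC q) := tile _ .C _ (by simp [Coeffs.val])
  have tA8 : (LatticeRhomb.toRhomb g ⟨.thick, (0, 0, 0, 0), 8⟩).tile q .A =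
      g.map '' moved 0 8 (protoA q) := tile _ .A _ (by simp [Coeffs.val])
  have tA2 : (LatticeRhomb.toRhomb g ⟨.thick, (0, 0, 0, 0), 2⟩).tile q .A =
      g.map '' moved 0 2 (protoA q) := tile _ .A _ (by simp [Coeffs.val])
  have tC2 : (LatticeRhomb.toRhomb g ⟨.thick, (0, 0, 0, 0), 2⟩).tile q .C =
      g.map '' moved 0 2 (protoC q) := tile _ .C _ (by simp [Coeffs.val])
  -- the rhombs around `r`: `n` at `HE`, `a` at `EF`, `b` at `GH`, and `m` at the side `DA` of `n`
  have thin : ∀ (a b n m : LatticeRhomb) (X Y Z : TileKind), a.toRhomb g ∈ P → b.toRhomb g ∈ P →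
      n.toRhomb g ∈ P → m.toRhomb g ∈ P → n.kind = .thin →
      thickOrigin.neighbor 0 a.kind = a → thickOrigin.neighbor 2 b.kind = b →
      n.neighbor 0 .thick = thickOrigin → n.neighbor 3 m.kind = m →
      a.kind.owner 0 = X → b.kind.owner 1 = Y → m.kind.owner 1 = Z →
      corona (ammannTiling P q) (r.tile q .A) =
        {r.tile q .A, r.tile q .C, (a.toRhomb g).tile q X, (b.toRhomb g).tile q Y} ∪
          {(n.toRhomb g).tile q .B, (m.toRhomb g).tile q Z} := by
    rintro a b n m _ _ _ ha hb hn hm hnk h1 h2 h3 h4 rfl rfl rfl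
    exact hP.corona_eq_of_thin hq hr hk ha hb
      (hr0 ▸ LatticeRhomb.holds g (s := thickOrigin) (i := 0) (by decide) h1)
      (hr0 ▸ LatticeRhomb.holds g (s := thickOrigin) (i := 1) (by decide) h2) hn
      (hr0 ▸ LatticeRhomb.holds g (t := thickOrigin) (i := 0) (by decide) h3) hnk hm
      (LatticeRhomb.holds g (i := 1) (by decide) (by rw [hnk]; exact h4))
  have thick : ∀ (a b n : LatticeRhomb) (X Y : TileKind), a.toRhomb g ∈ P → b.toRhomb g ∈ P →
      n.toRhomb g ∈ P → n.kind = .thick →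
      thickOrigin.neighbor 0 a.kind = a → thickOrigin.neighbor 2 b.kind = b →
      n.neighbor 0 .thick = thickOrigin → a.kind.owner 0 = X → b.kind.owner 1 = Y →
      corona (ammannTiling P q) (r.tile q .A) =
        {r.tile q .A, r.tile q .C, (a.toRhomb g).tile q X, (b.toRhomb g).tile q Y} ∪
          {(n.toRhomb g).tile q .A, (n.toRhomb g).tile q .C} := by
    rintro a b n _ _ ha hb hn hnk h1 h2 h3 rfl rfl
    exact hP.corona_eq_of_thick hq hr hk ha hb
      (hr0 ▸ LatticeRhomb.holds g (s := thickOrigin) (i := 0) (by decide) h1)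
      (hr0 ▸ LatticeRhomb.holds g (s := thickOrigin) (i := 1) (by decide) h2) hn
      (hr0 ▸ LatticeRhomb.holds g (t := thickOrigin) (i := 0) (by decide) h3) hnk
  fin_cases k
  · rw [thin ⟨.thin, (2, -1, 1, -1), 4⟩ ⟨.thick, (0, 0, 1, 1), 8⟩
      ⟨.thin, (0, 0, 0, 0), 2⟩ ⟨.thick, (0, -1, 0, 0), 1⟩ .B .C .C
      (h _ (by decide)) (h _ (by decide)) (h _ (by decide)) (h _ (by decide))
      rfl (by decide) (by decide) (by decide) (by decide) rfl rfl rfl, hA, hC, tB4, tC8, tB2, tC1]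
    ext T
    simp only [coronaOfA, Set.image_insert_eq, Set.image_singleton, Fin.zero_eta, Matrix.cons_val,
      Set.mem_union, Set.mem_insert_iff, Set.mem_singleton_iff]
    tauto
  · rw [thin ⟨.thin, (2, -1, 1, -1), 4⟩ ⟨.thick, (0, 0, 1, 1), 8⟩
      ⟨.thin, (0, 0, 0, 0), 2⟩ ⟨.thin, (-1, 1, -1, 2), 8⟩ .B .C .B
      (h _ (by decide)) (h _ (by decide)) (h _ (by decide)) (h _ (by decide))
      rfl (by decide) (by decide) (by decide) (by decide) rfl rfl rfl, hA, hC, tB4, tC8, tB2, tB8]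
    ext T
    simp only [coronaOfA, Set.image_insert_eq, Set.image_singleton, Fin.mk_one, Matrix.cons_val,
      Set.mem_union, Set.mem_insert_iff, Set.mem_singleton_iff]
    tauto
  · rw [thin ⟨.thick, (0, 0, 0, 0), 8⟩ ⟨.thick, (0, 0, 1, 1), 8⟩
      ⟨.thin, (0, 0, 0, 0), 2⟩ ⟨.thin, (-1, 1, -1, 2), 8⟩ .A .C .B
      (h _ (by decide)) (h _ (by decide)) (h _ (by decide)) (h _ (by decide))
      rfl (by decide) (by decide) (by decide) (by decide) rfl rfl rfl, hA, hC, tA8, tC8, tB2, tB8]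
    ext T
    simp only [coronaOfA, Set.image_insert_eq, Set.image_singleton, Fin.reduceFinMk,
      Matrix.cons_val, Set.mem_union, Set.mem_insert_iff, Set.mem_singleton_iff]
    tauto
  · rw [thick ⟨.thin, (2, -1, 1, -1), 4⟩ ⟨.thin, (1, 1, 1, 0), 5⟩
      ⟨.thick, (0, 0, 0, 0), 2⟩ .B .B
      (h _ (by decide)) (h _ (by decide)) (h _ (by decide))
      rfl (by decide) (by decide) (by decide) rfl rfl, hA, hC, tB4, tB5, tA2, tC2]
    ext T
    simp only [coronaOfA, Set.image_insert_eq, Set.image_singleton, Fin.reduceFinMk,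
      Matrix.cons_val, Set.mem_union, Set.mem_insert_iff, Set.mem_singleton_iff]
    tauto
  · rw [thick ⟨.thick, (0, 0, 0, 0), 8⟩ ⟨.thin, (1, 1, 1, 0), 5⟩
      ⟨.thick, (0, 0, 0, 0), 2⟩ .A .B
      (h _ (by decide)) (h _ (by decide)) (h _ (by decide))
      rfl (by decide) (by decide) (by decide) rfl rfl, hA, hC, tA8, tB5, tA2, tC2]
    ext T
    simp only [coronaOfA, Set.image_insert_eq, Set.image_singleton, Fin.reduceFinMk,
      Matrix.cons_val, Set.mem_union, Set.mem_insert_iff, Set.mem_singleton_iff]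
    tauto

end IsPenroseTiling

theorem theorem4p1 (P : Set Rhomb) (hP : IsPenroseTiling P) (q : ℂ) (hq : IsAdmissible q) :
    (∀ T : Set ℂ, IsTileA P q T → ∃ k : Fin 5, HasCorona q (ammannTiling P q) T k) ∧
      (∀ k : Fin 5, ∃ T : Set ℂ, IsTileA P q T ∧ HasCorona q (ammannTiling P q) T k) := by
  have main : ∀ r ∈ P, r.kind = .thick → ∀ k, HasPattern P r k →
      HasCorona q (ammannTiling P q) (r.tile q .A) k := fun r hr hk k h =>
    ⟨r.place, rfl, hP.corona_eq_coronaOfA hq hr hk h⟩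
  constructor
  · intro T hT
    obtain ⟨r, hr, hk, rfl⟩ := (hP.isTileA_iff hq).1 hT
    obtain ⟨k, h⟩ := hP.hasPattern_of_thick hr hk
    exact ⟨k, main r hr hk k h⟩
  · intro k
    obtain ⟨r, hr, hk, h⟩ := hP.exists_hasPattern k
    exact ⟨_, (hP.isTileA_iff hq).2 ⟨r, hr, hk, rfl⟩, main r hr hk k h⟩
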